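/- Let $\Sigma$ be an alphabet (a finite nonempty set) and $w\ge 1$. A $(\Sigma,w)$-layer is a tuple $(\ell,r,T,I,F,\iota,\phi)$ with $\ell,r\subseteq\{0,\dots,w-1\}$, $T\subseteq \ell\times\Sigma\times r$, $I\subseteq \ell$, $F\subseteq r$ and $\iota,\phi\in\{0,1\}$ such that $I=\emptyset$ if $\iota=0$ and $F=\emptyset$ if $\phi=0$. A $(\Sigma,w)$-ODD of length $k\ge 1$ is a string $D=B_1\cdots B_k$ of $(\Sigma,w)$-layers with $\ell(B_{i+1})=r(B_i)$ for $1\le i<k$, in which $\iota(B_i)=1$ exactly for $i=1$ and $\phi(B_i)=1$ exactly for $i=k$. It accepts $s_1\cdots s_k\in\Sigma^k$ if there are transitions $(p_i,s_i,q_i)\in T(B_i)$, $1\le i\le k$, with $p_{i+1}=q_i$ for $1\le i<k$, $p_1\in I(B_1)$ and $q_k\in F(B_k)$; the function $\Sigma^k\to\{0,1\}$ computed by $D$ is the indicator function of the set of strings that $D$ accepts. A $(\Sigma,w)$-second-order finite automaton (SOFA) is a (possibly nondeterministic) finite automaton $\mathcal F$ over the alphabet of all $(\Sigma,w)$-layers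 such that every string in its language $L(\mathcal F)$ is a $(\Sigma,w)$-ODD. Theorem. There is an algorithm that, given an alphabet $\Sigma$, a width $w\ge 1$, a $(\Sigma,w)$-SOFA $\mathcal F$ with $n$ states and a length $k\in\mathbb N$, computes the number of distinct functions $\Sigma^k\to\{0,1\}$ that are computed by ODDs of length $k$ in $L(\mathcal F)$, in time $$2^{\,n\cdot 2^{O(|\Sigma|\cdot w\cdot 2^{w})}}\cdot k^2,$$ where $n$ and $k$ are read as $\max(n,1)$ and $\max(k,1)$. More precisely, a single multi-stack Turing machine does this on all inputs, with one absolute constant in the $O(\cdot)$. Its input is a string presenting $k$, $|\Sigma|$, $w$ and $n$ in binary, the initial and final states, and a list of the transitions of $\mathcal F$ (each layer written as the bit vectors of its components), for arbitrary numberings of $\Sigma$ and of the states; its output is the number in binary. -/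

import Mathlib

/-- A layer of width `w` over the alphabet `A`; the states are elements of `{0, ..., w - 1}`. -/
@[ext]
structure Layer (A : Type) (w : ℕ) where
  left : Set (Fin w)
  right : Set (Fin w)
  trans : Set (Fin w × A × Fin w)
  init : Set (Fin w)
  final : Set (Fin w)
  initFlag : Bool
  finalFlag : Bool
  trans_subset : ∀ t ∈ trans, t.1 ∈ left ∧ t.2.2 ∈ right
  init_subset : init ⊆ left
  final_subset : final ⊆ right
  init_eq_empty : initFlag = false → init = ∅
  final_eq_empty : finalFlag = false → final = ∅

/-- A string of layers is an ordered decision diagram if it is nonempty, the frontiers of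
consecutive layers match, the initial flag is set in the first layer and in no other one, and the
final flag is set in the last layer and in no other one. Its length is the length of the string. -/
def IsODD {A : Type} {w : ℕ} (D : List (Layer A w)) : Prop :=
  D ≠ [] ∧
  D.IsChain (fun L L' => L'.left = L.right) ∧
  (∀ L ∈ D.head?, L.initFlag = true) ∧ (∀ L ∈ D.tail, L.initFlag = false) ∧
  (∀ L ∈ D.getLast?, L.finalFlag = true) ∧ (∀ L ∈ D.dropLast, L.finalFlag = false)

/-- `D` accepts `s`: there is a sequence of transitions `tr`, the `i`-th one taken from the `i`-th
layer and labelled by the `i`-th symbol of `s`, each starting in the state in which the previous one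
ends, which starts in an initial state of the first layer and ends in a final state of the last. -/
def ODDAccepts {A : Type} {w : ℕ} (D : List (Layer A w)) (s : List A) : Prop :=
  ∃ tr : List (Fin w × A × Fin w),
    tr.map (fun t => t.2.1) = s ∧
    List.Forall₂ (fun t L => t ∈ L.trans) tr D ∧
    tr.IsChain (fun t t' => t'.1 = t.2.2) ∧
    (∀ t ∈ tr.head?, ∀ L ∈ D.head?, t.1 ∈ L.init) ∧
    (∀ t ∈ tr.getLast?, ∀ L ∈ D.getLast?, t.2.2 ∈ L.final)

open Classical in
/-- The function `A ^ k → {0, 1}` computed by a diagram of length `k`. -/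
noncomputable def oddFunction {A : Type} {w : ℕ} (D : List (Layer A w)) (k : ℕ) :
    (Fin k → A) → Bool :=
  fun s => decide (ODDAccepts D (List.ofFn s))

/-- A finite automaton over the alphabet of layers is a second-order finite automaton if every
string that it accepts is an ordered decision diagram. -/
def IsSOFA {A Q : Type} {w : ℕ} (F : NFA (Layer A w) Q) : Prop :=
  ∀ D ∈ F.accepts, IsODD D

/-- The number of distinct functions `A ^ k → {0, 1}` computed by the diagrams of length `k` in the
language of `F`. -/
noncomputable def countFunctions {A Q : Type} {w : ℕ} (F : NFA (Layer A w) Q) (k : ℕ) : ℕ :=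
  Set.ncard {f : (Fin k → A) → Bool | ∃ D ∈ F.accepts, D.length = k ∧ f = oddFunction D k}

/-! The input of the counting problem as a string over `{0, 1, #}`: the symbols `0`, `1` are
`some false`, `some true`, and `#` is `none`. -/

/-- A number in binary (least significant digit first), followed by `#`. -/
def numCode (n : ℕ) : List (Option Bool) :=
  (Nat.bits n).map some ++ [none]

open Classical in
/-- The characteristic vector of a set. -/
noncomputable def setCode {n : ℕ} (S : Set (Fin n)) : List (Option Bool) :=
  (List.finRange n).map (fun i => some (decide (i ∈ S)))

open Classical in
/-- A layer is written as the characteristic vectors of its components, followed by its flags; the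
letters of the alphabet are numbered by `eA`. -/
noncomputable def layerCode {A : Type} {w m : ℕ} (eA : A ≃ Fin m) (L : Layer A w) :
    List (Option Bool) :=
  setCode L.left ++ setCode L.right ++
  ((List.finRange w).flatMap fun p => (List.finRange m).flatMap fun a =>
    (List.finRange w).map fun q => some (decide ((p, eA.symm a, q) ∈ L.trans))) ++
  setCode L.init ++ setCode L.final ++ [some L.initFlag, some L.finalFlag]

/-- The list `ts` enumerates the transitions of `F` without repetition. -/
def IsTransitionList {A Q : Type} {w : ℕ} (F : NFA (Layer A w) Q)
    (ts : List (Q × Layer A w × Q)) : Prop :=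
  ts.Nodup ∧ ∀ p L q, (p, L, q) ∈ ts ↔ q ∈ F.step p L

/-- The string that presents the length `k` and the automaton `F`, for numberings `eA` of the
alphabet and `eQ` of the states and a list `ts` of the transitions: the numbers `k`, `|A|`, `w`,
`|Q|` and `|ts|` in binary, the sets of initial and of final states as characteristic vectors, and
then the transitions one after the other. -/
noncomputable def sofaCode {A Q : Type} {w m n : ℕ} (eA : A ≃ Fin m) (eQ : Q ≃ Fin n)
    (F : NFA (Layer A w) Q) (ts : List (Q × Layer A w × Q)) (k : ℕ) : List (Option Bool) :=
  numCode k ++ numCode m ++ numCode w ++ numCode n ++ numCode ts.length ++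
  setCode (eQ.symm ⁻¹' F.start) ++ setCode (eQ.symm ⁻¹' F.accept) ++
  ts.flatMap fun t => numCode (eQ t.1) ++ layerCode eA t.2.1 ++ numCode (eQ t.2.2)

/-- The multi-stack Turing machine `M` (with input alphabet `{0, 1, #}` and output alphabet
`{0, 1}`), started on `input`, halts with `output` within `T` steps. -/
def OutputsWithin (M : Turing.TM2ComputableAux (Option Bool) Bool)
    (input : List (Option Bool)) (output : List Bool) (T : ℕ) : Prop :=
  Nonempty (Turing.TM2OutputsInTime M.tm (input.map M.inputAlphabet.symm)
    (some (output.map M.outputAlphabet.symm)) T)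

/-! A layer acts on sets of states: adjoin the initial states to the set reached so far, read a
letter, and in the last layer keep only the final states. A diagram thus becomes a word of
transformations of the `W = 2 ^ w` subsets, and it accepts a string exactly if the run from the
empty set ends in a nonempty set (`oddAccepts_iff`). It remains to count the functions given by the
words of length `k` that label accepting paths, where one function may come from many words.

Functions are counted through a canonical description. Given a list `h` of `N` distinct functions of
`j + 1` letters, let `d` list their residuals after the first letter without repetition, in the
order of first occurrence, and let `κ` be the `N × m` table of the positions of the residuals in
`d`. The entries of `κ` form a restricted growth sequence, and `h` corresponds bijectively to `(κ,
d)` (`exists_combine`, `combine_mem`, `combine_injective`, which rests on `eq_of_growth`). All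
residuals of functions computed from the states of one diagram are computed by its tail, so there
are at most `W` of them and the number of tables does not depend on `k`.

Which lists arise is decided by guessing a path and an assignment `ρ` that names, for each subset
`i`, the position in the current list of the function computed from `i`. The guesses are made
deterministic by a subset construction: a state of the counting automaton is `(N, X)` with `X` a set
of pairs `(q, ρ)`, and `κ` sends `X` to the set of all compatible successors. The bijection then
becomes the linear recurrence `ncard_tuples_succ`, so the counts for length `k` are a power of a
fixed matrix applied to a fixed vector, and the answer is one entry (`getD_iterate_mulVec`). There
are `(W + 1) * 2 ^ (n * (W + 1) ^ W)` states, which is within the bound `blowup`.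

The factor `k ^ 2` comes from the multiplication. The vector is stored by binary digits, one column
for each digit, and a product with the matrix is one pass over the columns with bounded carries
(`columnValue_mulColumns`), in time linear in the number of columns (`exists_mulColumns`). A product
adds a constant number of columns, so `k` products are quadratic in `k`. The binary counter costs a
power of the number of digits of `k` per round, which is at most linear in `k`
(`exists_pow_length_bits_le`).

For the machine, structured programs on four stacks are compiled (`Exec.stepsTo`), and data are
trees written on the stacks. The class `PolyB B` of functions computable in time polynomial in the
size of the argument and in `B` is closed under composition, case distinction and bounded folds;
this yields the construction of the counting automaton (`polyB_countData`). Only the iteration has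
an explicit time analysis (`exists_iteration`), and `exists_program` joins the pieces. -/

/-! ### A structured language for four stacks over `{0, 1, #}` -/

/-- The contents of the four stacks. -/
structure Mem where
  main : List (Option Bool)
  fst : List (Option Bool)
  snd : List (Option Bool)
  cnt : List (Option Bool)

def Mem.get (m : Mem) : Fin 4 → List (Option Bool)
  | 0 => m.main
  | 1 => m.fst
  | 2 => m.snd
  | 3 => m.cnt

def Mem.set (m : Mem) : Fin 4 → List (Option Bool) → Mem
  | 0, l => { m with main := l }
  | 1, l => { m with fst := l }
  | 2, l => { m with snd := l }
  | 3, l => { m with cnt := l }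

/-- Structured programs on four stacks with one variable that holds the last popped symbol. -/
inductive Prog
  | skip : Prog
  | push : Fin 4 → Option Bool → Prog
  | pop : Fin 4 → Prog
  | put : Fin 4 → Prog
  | seq : Prog → Prog → Prog
  | ite : (Option (Option Bool) → Bool) → Prog → Prog → Prog
  | loop : (Option (Option Bool) → Bool) → Prog → Prog

infixr:60 " ;; " => Prog.seq

/-- `Exec p v m v' m' t`: started with variable `v` and stacks `m`, the program `p` terminates with
`v'` and `m'` after `t` machine steps. -/
inductive Exec : Prog → Option (Option Bool) → Mem → Option (Option Bool) → Mem → ℕ → Prop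
  | skip (v m) : Exec .skip v m v m 1
  | push (k x v m) : Exec (.push k x) v m v (m.set k (x :: m.get k)) 1
  | pop (k v m) : Exec (.pop k) v m (m.get k).head? (m.set k (m.get k).tail) 1
  | put (k x m) : Exec (.put k) (some x) m (some x) (m.set k (x :: m.get k)) 1
  | seq {p q v m v₁ m₁ v₂ m₂ t₁ t₂} : Exec p v m v₁ m₁ t₁ → Exec q v₁ m₁ v₂ m₂ t₂ →
      Exec (.seq p q) v m v₂ m₂ (t₁ + t₂)
  | ite_true {c p q v m v' m' t} : c v = true → Exec p v m v' m' t →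
      Exec (.ite c p q) v m v' m' (1 + t)
  | ite_false {c p q v m v' m' t} : c v = false → Exec q v m v' m' t →
      Exec (.ite c p q) v m v' m' (1 + t)
  | loop_false {c p v m} : c v = false → Exec (.loop c p) v m v m 1
  | loop_true {c p v m v₁ m₁ v₂ m₂ t₁ t₂} : c v = true → Exec p v m v₁ m₁ t₁ →
      Exec (.loop c p) v₁ m₁ v₂ m₂ t₂ → Exec (.loop c p) v m v₂ m₂ (1 + t₁ + t₂)

/-! ### Compilation to multi-stack Turing machines -/

namespace Prog

/-- The machine labels of a program. -/
def Label : Prog → Type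
  | skip => Unit
  | push _ _ => Unit
  | pop _ => Unit
  | put _ => Unit
  | seq p q => Label p ⊕ Label q
  | ite _ p q => Option (Label p ⊕ Label q)
  | loop _ p => Option (Label p)

noncomputable instance instFintypeLabel : (p : Prog) → Fintype (Label p)
  | skip => inferInstanceAs (Fintype Unit)
  | push _ _ => inferInstanceAs (Fintype Unit)
  | pop _ => inferInstanceAs (Fintype Unit)
  | put _ => inferInstanceAs (Fintype Unit)
  | seq p q =>
    letI := instFintypeLabel p
    letI := instFintypeLabel q
    inferInstanceAs (Fintype (Label p ⊕ Label q))
  | ite _ p q =>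
    letI := instFintypeLabel p
    letI := instFintypeLabel q
    inferInstanceAs (Fintype (Option (Label p ⊕ Label q)))
  | loop _ p =>
    letI := instFintypeLabel p
    inferInstanceAs (Fintype (Option (Label p)))

def entry : (p : Prog) → Label p
  | skip => ()
  | push _ _ => ()
  | pop _ => ()
  | put _ => ()
  | seq p _ => Sum.inl (entry p)
  | ite _ _ _ => (none : Option _)
  | loop _ _ => (none : Option _)

/-- The stack alphabets of the compiled machine: the stack `none` is the output stack. -/
def StackSym : Option (Fin 4) → Type
  | none => Bool
  | some _ => Option Bool

open Turing.TM2.Stmt in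
/-- The statement at a label, for an embedding `emb` of the labels and an exit label. -/
def code {Λ : Type} : (p : Prog) → (Label p → Λ) → Λ → Label p →
    Turing.TM2.Stmt StackSym Λ (Option (Option Bool))
  | skip, _, exit, _ => goto fun _ => exit
  | push k x, _, exit, _ => Turing.TM2.Stmt.push (some k) (fun _ => x) (goto fun _ => exit)
  | pop k, _, exit, _ => Turing.TM2.Stmt.pop (some k) (fun _ x => x) (goto fun _ => exit)
  | put k, _, exit, _ =>
    Turing.TM2.Stmt.push (some k) (fun v => v.getD none) (goto fun _ => exit)
  | seq p q, emb, exit, l =>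
    Sum.casesOn l (fun l => code p (fun l => emb (Sum.inl l)) (emb (Sum.inr (entry q))) l)
      (fun l => code q (fun l => emb (Sum.inr l)) exit l)
  | ite c p q, emb, exit, l =>
    Option.casesOn l
      (branch c (goto fun _ => emb (some (Sum.inl (entry p))))
        (goto fun _ => emb (some (Sum.inr (entry q)))))
      (fun l => Sum.casesOn l (fun l => code p (fun l => emb (some (Sum.inl l))) exit l)
        (fun l => code q (fun l => emb (some (Sum.inr l))) exit l))
  | loop c p, emb, exit, l =>
    Option.casesOn l
      (branch c (goto fun _ => emb (some (entry p))) (goto fun _ => exit))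
      (fun l => code p (fun l => emb (some l)) (emb none) l)

end Prog

/-- The stacks of the compiled machine. -/
def Mem.stk (m : Mem) (out : List Bool) : (k : Option (Fin 4)) → List (Prog.StackSym k)
  | none => out
  | some k => m.get k

theorem Mem.get_set (m : Mem) (k j : Fin 4) (l) : (m.set k l).get j = if j = k then l else m.get j := by
  fin_cases k <;> fin_cases j <;> rfl

/-- Translates the update of a stack family in the machine into `Mem.set`. -/
theorem Mem.update_stk (m : Mem) (out : List Bool) (k : Fin 4) (l : List (Option Bool)) :
    Function.update (m.stk out) (some k) l = (m.set k l).stk out := by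
  funext j
  rcases j with _ | j
  · rfl
  · by_cases h : j = k
    · subst h
      refine (Function.update_self ..).trans ?_
      simp [Mem.stk, Mem.get_set]
      rfl
    · refine (Function.update_of_ne (by simpa using h) ..).trans ?_
      simp [Mem.stk, Mem.get_set, h]
      rfl

theorem Mem.update_stk_none (m : Mem) (out out' : List Bool) :
    Function.update (m.stk out) none out' = m.stk out' := by
  funext j
  rcases j with _ | j
  · exact Function.update_self ..
  · exact Function.update_of_ne (by simp) ..

/-- `t` steps of a partial function. -/
def StepsTo {α : Type*} (f : α → Option α) (t : ℕ) (a b : α) : Prop :=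
  (flip bind f)^[t] (some a) = some b

theorem StepsTo.trans {α : Type*} {f : α → Option α} {t t' : ℕ} {a b c : α}
    (h : StepsTo f t a b) (h' : StepsTo f t' b c) : StepsTo f (t + t') a c := by
  unfold StepsTo at *
  rw [add_comm, Function.iterate_add_apply, h, h']

theorem StepsTo.one {α : Type*} {f : α → Option α} {a b : α} (h : f a = some b) :
    StepsTo f 1 a b := h

/-- Correctness of the compilation. The embedding and the exit label are arbitrary, so that a
subprogram may sit anywhere in a larger machine: in a sequence the first part exits to the entry of
the second, and the body of a loop exits to the test. -/
theorem Exec.stepsTo {Λ : Type} {M : Λ → Turing.TM2.Stmt Prog.StackSym Λ (Option (Option Bool))}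
    {p : Prog} {v m v' m' t} (h : Exec p v m v' m' t) (emb : p.Label → Λ) (exit : Λ)
    (hM : ∀ l, M (emb l) = p.code emb exit l) (out : List Bool) :
    StepsTo (Turing.TM2.step M) t ⟨some (emb p.entry), v, m.stk out⟩
      ⟨some exit, v', m'.stk out⟩ := by
  induction h generalizing exit with
  | skip v m =>
    apply StepsTo.one
    rw [Turing.TM2.step, hM]
    rfl
  | push k x v m =>
    apply StepsTo.one
    rw [Turing.TM2.step, hM, ← Mem.update_stk]
    rfl
  | pop k v m =>
    apply StepsTo.one
    rw [Turing.TM2.step, hM, ← Mem.update_stk]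
    rfl
  | put k x m =>
    apply StepsTo.one
    rw [Turing.TM2.step, hM, ← Mem.update_stk]
    rfl
  | seq _ _ ih₁ ih₂ =>
    exact (ih₁ _ _ fun l => hM (Sum.inl l)).trans (ih₂ _ _ fun l => hM (Sum.inr l))
  | ite_true hc _ ih =>
    refine StepsTo.trans (StepsTo.one ?_) (ih _ _ fun l => hM (some (Sum.inl l)))
    rw [Turing.TM2.step, hM]
    simp [Prog.code, Prog.entry, hc]
  | ite_false hc _ ih =>
    refine StepsTo.trans (StepsTo.one ?_) (ih _ _ fun l => hM (some (Sum.inr l)))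
    rw [Turing.TM2.step, hM]
    simp [Prog.code, Prog.entry, hc]
  | loop_false hc =>
    apply StepsTo.one
    rw [Turing.TM2.step, hM]
    simp [Prog.code, Prog.entry, hc]
  | loop_true hc _ _ ih₁ ih₂ =>
    refine StepsTo.trans (StepsTo.trans (StepsTo.one ?_) (ih₁ _ _ fun l => hM (some l)))
      (ih₂ _ _ hM)
    rw [Turing.TM2.step, hM]
    simp [Prog.code, Prog.entry, hc]

open Turing.TM2.Stmt in
/-- The machine that runs `p` on the input and then moves the second stack to the output. -/
noncomputable def Prog.machine (p : Prog) : Turing.FinTM2 where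
  K := Option (Fin 4)
  k₀ := some 0
  k₁ := none
  Γ := StackSym
  Λ := Option p.Label
  main := some p.entry
  σ := Option (Option Bool)
  initialState := none
  Γk₀Fin := inferInstanceAs (Fintype (Option Bool))
  m l := Option.casesOn l
    (Turing.TM2.Stmt.pop (some 1) (fun _ x => x)
      (branch (fun v => v.isSome)
        (Turing.TM2.Stmt.push none (fun v => (v.getD none).getD false) (goto fun _ => none)) halt))
    (fun l => p.code some none l)

/-- The alphabets of the compiled machine. -/
noncomputable def Prog.computer (p : Prog) : Turing.TM2ComputableAux (Option Bool) Bool where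
  tm := p.machine
  inputAlphabet := Equiv.refl (Option Bool)
  outputAlphabet := Equiv.refl Bool

theorem Prog.finite_stackSym (p : Prog) (i) : Finite (p.computer.tm.Γ i) := by
  rcases i with _ | i
  · exact inferInstanceAs (Finite Bool)
  · exact inferInstanceAs (Finite (Option Bool))

/-- Each round moves one symbol to the output stack, which reverses the word; the last pop finds the
stack empty and the machine halts. -/
theorem Prog.machine_output (p : Prog) (l out : List Bool) (v : Option (Option Bool)) :
    StepsTo (Turing.TM2.step p.machine.m) (l.length + 1)
      ⟨some none, v, (⟨[], l.map some, [], []⟩ : Mem).stk out⟩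
      ⟨none, none, (⟨[], [], [], []⟩ : Mem).stk (l.reverse ++ out)⟩ := by
  induction l generalizing v out with
  | nil =>
    apply StepsTo.one
    have h := Mem.update_stk ⟨[], [], [], []⟩ out 1 []
    exact congrArg (fun x => some (Turing.TM2.Cfg.mk none none x)) h
  | cons b l ih =>
    rw [List.length_cons, add_comm (l.length + 1)]
    refine StepsTo.trans (StepsTo.one ?_)
      (by simpa using ih (b :: out) (some (some b)))
    have h := Mem.update_stk ⟨[], some b :: l.map some, [], []⟩ out 1 (l.map some)
    have h' := Mem.update_stk_none ⟨[], l.map some, [], []⟩ out (b :: out)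
    refine Eq.trans ?_ (congrArg (fun x => some (Turing.TM2.Cfg.mk (some none) (some (some b)) x)) h')
    refine congrArg (fun x => some (Turing.TM2.Cfg.mk (some none) (some (some b))
      (Function.update x none (b :: out)))) h

/-- The halting configuration must have all stacks empty except the output. Hence the program has to
clean up and leave the output reversed on the second stack; the final transfer undoes the reversal.
-/
theorem Prog.outputsWithin (p : Prog) {input : List (Option Bool)} {output : List Bool} {T t v}
    (h : Exec p none ⟨input, [], [], []⟩ v ⟨[], output.reverse.map some, [], []⟩ t)
    (hT : t + output.length + 1 ≤ T) : OutputsWithin p.computer input output T := by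
  have h₁ := (h.stepsTo (M := p.machine.m) some none (fun _ => rfl) []).trans
    (p.machine_output output.reverse [] v)
  rw [List.reverse_reverse, List.append_nil, List.length_reverse] at h₁
  refine ⟨⟨⟨t + (output.length + 1), Eq.trans ?_ (Eq.trans h₁ ?_)⟩, by omega⟩⟩
  · refine congrArg (fun x => (flip bind (Turing.TM2.step p.machine.m))^[t + (output.length + 1)]
      (some (Turing.TM2.Cfg.mk (some (some p.entry)) none x))) ?_
    funext k
    rcases k with _ | k
    · rfl
    · fin_cases k
      · exact List.map_id _
      all_goals rfl
  · refine congrArg (fun x => some (Turing.TM2.Cfg.mk none none x)) ?_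
    funext k
    rcases k with _ | k
    · exact (List.map_id _).symm
    · fin_cases k <;> rfl

/-! ### Binary trees on the stacks -/

/-- Binary trees, the values that programs operate on. -/
inductive V
  | nil : V
  | cons : V → V → V

namespace V

/-- The prefix code of a tree. -/
def code : V → List (Option Bool)
  | nil => [some false]
  | cons a b => some true :: (code a ++ code b)

def size (x : V) : ℕ := x.code.length

@[simp] theorem size_nil : nil.size = 1 := rfl

@[simp] theorem size_cons (a b : V) : (cons a b).size = a.size + b.size + 1 := by
  simp [size, code]

theorem size_pos (x : V) : 0 < x.size := by
  cases x <;> simp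

/-- Frees the symbol `none` for use as a mark between trees on a stack. -/
theorem ne_none_of_mem_code {x : V} {y : Option Bool} (h : y ∈ x.code) : y ≠ none := by
  induction x with
  | nil => simp_all [code]
  | cons a b iha ihb =>
    simp only [code, List.mem_cons, List.mem_append] at h
    rcases h with rfl | h | h
    exacts [by simp, iha h, ihb h]

end V

/-! ### Timed execution and basic stack manipulations -/

/-- Execution within a time bound. -/
def Run (p : Prog) (v : Option (Option Bool)) (m : Mem) (v' : Option (Option Bool)) (m' : Mem)
    (T : ℕ) : Prop :=
  ∃ t ≤ T, Exec p v m v' m' t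

namespace Run

variable {p q : Prog} {v v' v₁ v₂ : Option (Option Bool)} {m m' m₁ m₂ : Mem} {T T' T₁ T₂ : ℕ}

theorem mono (h : Run p v m v' m' T) (hT : T ≤ T') : Run p v m v' m' T' :=
  let ⟨t, ht, h⟩ := h
  ⟨t, ht.trans hT, h⟩

theorem skip (v m) : Run .skip v m v m 1 := ⟨1, le_rfl, .skip v m⟩

theorem push (k x v m) : Run (.push k x) v m v (m.set k (x :: m.get k)) 1 :=
  ⟨1, le_rfl, .push k x v m⟩

theorem pop (k v m) : Run (.pop k) v m (m.get k).head? (m.set k (m.get k).tail) 1 :=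
  ⟨1, le_rfl, .pop k v m⟩

theorem put (k x m) : Run (.put k) (some x) m (some x) (m.set k (x :: m.get k)) 1 :=
  ⟨1, le_rfl, .put k x m⟩

theorem seq (h : Run p v m v₁ m₁ T₁) (h' : Run q v₁ m₁ v₂ m₂ T₂) :
    Run (.seq p q) v m v₂ m₂ (T₁ + T₂) :=
  let ⟨_, ht, h⟩ := h
  let ⟨_, ht', h'⟩ := h'
  ⟨_, Nat.add_le_add ht ht', .seq h h'⟩

theorem ite_true {c} (hc : c v = true) (h : Run p v m v' m' T) :
    Run (.ite c p q) v m v' m' (1 + T) :=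
  let ⟨_, ht, h⟩ := h
  ⟨_, Nat.add_le_add_left ht 1, .ite_true hc h⟩

theorem ite_false {c} (hc : c v = false) (h : Run q v m v' m' T) :
    Run (.ite c p q) v m v' m' (1 + T) :=
  let ⟨_, ht, h⟩ := h
  ⟨_, Nat.add_le_add_left ht 1, .ite_false hc h⟩

theorem loop_false {c} (hc : c v = false) : Run (.loop c p) v m v m 1 :=
  ⟨_, le_rfl, .loop_false hc⟩

theorem loop_true {c} (hc : c v = true) (h : Run p v m v₁ m₁ T₁)
    (h' : Run (.loop c p) v₁ m₁ v₂ m₂ T₂) : Run (.loop c p) v m v₂ m₂ (1 + T₁ + T₂) :=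
  let ⟨_, ht, h⟩ := h
  let ⟨_, ht', h'⟩ := h'
  ⟨_, by omega, .loop_true hc h h'⟩

end Run

namespace Prog

def isOne (v : Option (Option Bool)) : Bool := v == some (some true)

def notMark (v : Option (Option Bool)) : Bool := v != some none

theorem notMark_some {y : Option Bool} (h : y ≠ none) : notMark (some y) = true := by
  cases y <;> simp_all [notMark]

/-- Move a tree from the main stack to stack `k`, reversed and above a mark. -/
def moveTo (k : Fin 4) : Prog :=
  -- The last stack holds in unary the number of subtrees still to be read. The unit for the current
  -- one is in the variable; a symbol `true` opens two further subtrees.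
  .push k none ;; .push 3 (some true) ;; .pop 3 ;;
  .loop Option.isSome (.pop 0 ;; .put k ;;
    .ite isOne (.push 3 (some true) ;; .push 3 (some true)) .skip ;; .pop 3)

/-- Move a tree from stack `k` to the main stack. -/
def moveFrom (k : Fin 4) : Prog :=
  .pop k ;; .loop notMark (.put 0 ;; .pop k)

/-- Remove the top tree of the main stack. -/
def drop : Prog :=
  moveTo 1 ;; .pop 1 ;; .loop notMark (.skip ;; .pop 1)

/-- Duplicate the top tree of the main stack. -/
def dup : Prog :=
  -- The reversed tree is poured onto the main stack and onto stack 2 at once; the second copy is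
  -- turned around again on stack 1, from where `moveFrom` brings it to the main stack.
  moveTo 1 ;; .push 2 none ;; (.pop 1 ;; .loop notMark ((.put 0 ;; .put 2) ;; .pop 1)) ;;
  .push 1 none ;; (.pop 2 ;; .loop notMark (.put 1 ;; .pop 2)) ;; moveFrom 1

/-- Exchange the two top trees of the main stack. -/
def swap : Prog :=
  moveTo 1 ;; moveTo 2 ;; moveFrom 1 ;; moveFrom 2

end Prog

namespace Run

open Prog

variable (v : Option (Option Bool)) (x y : V) (r s u : List (Option Bool))

/-- In continuation form: what the loop does once the tree is consumed is given by `h`. The code of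
a node is one symbol and two codes, so the two induction hypotheses simply compose. Here `y` is the
pending unit for the tree itself and `c` counts what comes after it. -/
theorem moveTo_one_loop {x : V} {r s u c : List (Option Bool)} {y : Option Bool}
    {v' m' T} (h : Run (.loop Option.isSome (.pop 0 ;; .put 1 ;;
      .ite isOne (.push 3 (some true) ;; .push 3 (some true)) .skip ;; .pop 3))
      c.head? ⟨r, x.code.reverse ++ s, u, c.tail⟩ v' m' T) :
    Run (.loop Option.isSome (.pop 0 ;; .put 1 ;;
      .ite isOne (.push 3 (some true) ;; .push 3 (some true)) .skip ;; .pop 3))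
      (some y) ⟨x.code ++ r, s, u, c⟩ v' m' (T + 7 * x.size) := by
  induction x generalizing r s c y T with
  | nil =>
    refine mono (loop_true rfl ((pop _ _ _).seq ((put _ _ _).seq ((ite_false rfl (skip _ _)).seq
      (pop _ _ _)))) h) ?_
    simp
    omega
  | cons a b iha ihb =>
    simp only [V.code, List.reverse_cons, List.reverse_append, List.append_assoc,
      List.singleton_append] at h
    have h₁ := iha (c := some true :: c) (y := some true) (r := b.code ++ r)
      (s := some true :: s) (ihb (y := some true) h)
    rw [show (V.cons a b).code ++ r = some true :: (a.code ++ (b.code ++ r)) by simp [V.code]]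
    refine mono (loop_true rfl ((pop _ _ _).seq ((put _ _ _).seq ((ite_true rfl
      ((push _ _ _ _).seq (push _ _ _ _))).seq
      (pop _ _ _)))) h₁) ?_
    simp
    omega

theorem moveTo_two_loop {x : V} {r s u c : List (Option Bool)} {y : Option Bool}
    {v' m' T} (h : Run (.loop Option.isSome (.pop 0 ;; .put 2 ;;
      .ite isOne (.push 3 (some true) ;; .push 3 (some true)) .skip ;; .pop 3))
      c.head? ⟨r, s, x.code.reverse ++ u, c.tail⟩ v' m' T) :
    Run (.loop Option.isSome (.pop 0 ;; .put 2 ;;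
      .ite isOne (.push 3 (some true) ;; .push 3 (some true)) .skip ;; .pop 3))
      (some y) ⟨x.code ++ r, s, u, c⟩ v' m' (T + 7 * x.size) := by
  induction x generalizing r u c y T with
  | nil =>
    refine mono (loop_true rfl ((pop _ _ _).seq ((put _ _ _).seq ((ite_false rfl (skip _ _)).seq
      (pop _ _ _)))) h) ?_
    simp
    omega
  | cons a b iha ihb =>
    simp only [V.code, List.reverse_cons, List.reverse_append, List.append_assoc,
      List.singleton_append] at h
    have h₁ := iha (c := some true :: c) (y := some true) (r := b.code ++ r)
      (u := some true :: u) (ihb (y := some true) h)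
    rw [show (V.cons a b).code ++ r = some true :: (a.code ++ (b.code ++ r)) by simp [V.code]]
    refine mono (loop_true rfl ((pop _ _ _).seq ((put _ _ _).seq ((ite_true rfl
      ((push _ _ _ _).seq (push _ _ _ _))).seq
      (pop _ _ _)))) h₁) ?_
    simp
    omega

theorem moveTo_one : Run (moveTo 1) v ⟨x.code ++ r, s, u, []⟩ none
    ⟨r, x.code.reverse ++ none :: s, u, []⟩ (7 * x.size + 4) :=
  ((push _ _ _ _).seq ((push _ _ _ _).seq ((pop _ _ _).seq
    (moveTo_one_loop (c := []) (y := some true) (loop_false rfl))))).mono (by omega)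

theorem moveTo_two : Run (moveTo 2) v ⟨x.code ++ r, s, u, []⟩ none
    ⟨r, s, x.code.reverse ++ none :: u, []⟩ (7 * x.size + 4) :=
  ((push _ _ _ _).seq ((push _ _ _ _).seq ((pop _ _ _).seq
    (moveTo_two_loop (c := []) (y := some true) (loop_false rfl))))).mono (by omega)

/-- `M c l` is the memory in which stack `k` still holds `l` while the symbols `c` have been
processed. Its abstract form covers every way of distributing popped symbols over the other stacks.
-/
theorem pour_loop {p : Prog} {k : Fin 4} {T : ℕ} (M : List (Option Bool) → List (Option Bool) → Mem)
    (hg : ∀ c l, (M c l).get k = l) (hs : ∀ c l l', (M c l).set k l' = M c l')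
    (hp : ∀ y c l, Run p (some y) (M c l) (some y) (M (y :: c) l) T)
    (l c s : List (Option Bool)) (hl : ∀ y ∈ l, y ≠ none) :
    Run (.loop notMark (p ;; .pop k)) (l ++ none :: s).head? (M c (l ++ none :: s).tail)
      (some none) (M (l.reverse ++ c) s) ((T + 2) * l.length + 1) := by
  induction l generalizing c with
  | nil => exact loop_false rfl
  | cons y l ih =>
    have h₁ := pop k (some y) (M (y :: c) (l ++ none :: s))
    rw [hg, hs] at h₁
    have h₂ := ih (y :: c) fun y hy => hl y (List.mem_cons_of_mem _ hy)
    refine mono (loop_true (notMark_some (hl y List.mem_cons_self)) ((hp _ _ _).seq h₁)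
      (by simpa using h₂)) ?_
    rw [List.length_cons, mul_add]
    omega

/-- A loop that pops stack `k` up to a mark and processes each symbol with `p`. -/
theorem pour {p : Prog} {k : Fin 4} {T : ℕ} (M : List (Option Bool) → List (Option Bool) → Mem)
    (hg : ∀ c l, (M c l).get k = l) (hs : ∀ c l l', (M c l).set k l' = M c l')
    (hp : ∀ y c l, Run p (some y) (M c l) (some y) (M (y :: c) l) T)
    (l c s : List (Option Bool)) (hl : ∀ y ∈ l, y ≠ none) :
    Run (.pop k ;; .loop notMark (p ;; .pop k)) v (M c (l ++ none :: s))
      (some none) (M (l.reverse ++ c) s) ((T + 2) * l.length + 2) := by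
  have h₁ := pop k v (M c (l ++ none :: s))
  rw [hg, hs] at h₁
  exact (h₁.seq (pour_loop M hg hs hp l c s hl)).mono (by omega)

variable {x}

theorem ne_none_code : ∀ y ∈ x.code, y ≠ none := fun _ => V.ne_none_of_mem_code

theorem ne_none_reverse_code : ∀ y ∈ x.code.reverse, y ≠ none :=
  fun _ h => V.ne_none_of_mem_code (List.mem_reverse.1 h)

variable (x)

theorem moveFrom_one : Run (moveFrom 1) v ⟨r, x.code.reverse ++ none :: s, u, []⟩ (some none)
    ⟨x.code ++ r, s, u, []⟩ (3 * x.size + 2) := by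
  have := pour v (k := 1) (p := .put 0) (fun c l => ⟨c ++ r, l, u, []⟩) (fun _ _ => rfl)
    (fun _ _ _ => rfl) (fun _ _ _ => put _ _ _) x.code.reverse [] s ne_none_reverse_code
  simpa [V.size, moveFrom] using this

theorem moveFrom_two : Run (moveFrom 2) v ⟨r, s, x.code.reverse ++ none :: u, []⟩ (some none)
    ⟨x.code ++ r, s, u, []⟩ (3 * x.size + 2) := by
  have := pour v (k := 2) (p := .put 0) (fun c l => ⟨c ++ r, s, l, []⟩) (fun _ _ => rfl)
    (fun _ _ _ => rfl) (fun _ _ _ => put _ _ _) x.code.reverse [] u ne_none_reverse_code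
  simpa [V.size, moveFrom] using this

theorem drop : Run drop v ⟨x.code ++ r, s, u, []⟩ (some none) ⟨r, s, u, []⟩
    (10 * x.size + 6) := by
  have := pour none (k := 1) (p := .skip) (fun _ l => ⟨r, l, u, []⟩) (fun _ _ => rfl)
    (fun _ _ _ => rfl) (fun _ _ _ => skip _ _) x.code.reverse [] s ne_none_reverse_code
  refine ((moveTo_one v x r s u).seq this).mono ?_
  simp only [List.length_reverse, V.size]
  omega

theorem dup : Run dup v ⟨x.code ++ r, s, u, []⟩ (some none) ⟨x.code ++ (x.code ++ r), s, u, []⟩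
    (17 * x.size + 12) := by
  have h₁ := pour none (k := 1) (p := .put 0 ;; .put 2) (fun c l => ⟨c ++ r, l, c ++ none :: u, []⟩)
    (fun _ _ => rfl) (fun _ _ _ => rfl) (fun _ _ _ => (put _ _ _).seq (put _ _ _)) x.code.reverse [] s
    ne_none_reverse_code
  have h₂ := pour (some none) (k := 2) (p := .put 1)
    (fun c l => ⟨x.code ++ r, c ++ none :: s, l, []⟩)
    (fun _ _ => rfl) (fun _ _ _ => rfl) (fun _ _ _ => put _ _ _) x.code [] u ne_none_code
  simp only [List.reverse_reverse, List.append_nil] at h₁ h₂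
  refine ((moveTo_one v x r s u).seq ((push _ _ _ _).seq (h₁.seq ((push _ _ _ _).seq (h₂.seq
    (moveFrom_one _ x _ _ _)))))).mono ?_
  simp only [List.length_reverse, V.size]
  omega

theorem swap : Run swap v ⟨x.code ++ (y.code ++ r), s, u, []⟩ (some none)
    ⟨y.code ++ (x.code ++ r), s, u, []⟩ (10 * x.size + 10 * y.size + 12) :=
  ((moveTo_one v x _ _ _).seq ((moveTo_two none y _ _ _).seq
    ((moveFrom_one none x _ _ _).seq (moveFrom_two _ y _ _ _)))).mono (by omega)

end Run

/-! ### Left-to-right passes, encodings by trees, and program combinators -/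

/-- Process the elements of a list from left to right, with a state. -/
def mapAcc {β γ σ : Type} (g : σ → β → σ × γ) : σ → List β → σ × List γ
  | s, [] => (s, [])
  | s, x :: l => ((mapAcc g (g s x).1 l).1, (g s x).2 :: (mapAcc g (g s x).1 l).2)

theorem mapAcc_append_singleton {β γ σ : Type} (g : σ → β → σ × γ) (s : σ) (l : List β) (x : β) :
    mapAcc g s (l ++ [x]) =
      ((g (mapAcc g s l).1 x).1, (mapAcc g s l).2 ++ [(g (mapAcc g s l).1 x).2]) := by
  induction l generalizing s with
  | nil => rfl
  | cons y l ih => simp [mapAcc, ih]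

theorem length_mapAcc {β γ σ : Type} (g : σ → β → σ × γ) (s : σ) (l : List β) :
    (mapAcc g s l).2.length = l.length := by
  induction l generalizing s with
  | nil => rfl
  | cons y l ih => simp [mapAcc, ih]

/-- Encodings by trees. -/
class Enc (α : Type) where
  enc : α → V

open Enc

instance : Enc V := ⟨id⟩

instance : Enc Unit := ⟨fun _ => V.nil⟩

instance : Enc Bool := ⟨fun b => if b then V.cons V.nil V.nil else V.nil⟩

instance {α β : Type} [Enc α] [Enc β] : Enc (α × β) := ⟨fun p => V.cons (enc p.1) (enc p.2)⟩

def V.ofList : List V → V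
  | [] => V.nil
  | x :: l => V.cons x (V.ofList l)

instance {α : Type} [Enc α] : Enc (List α) := ⟨fun l => V.ofList (l.map enc)⟩

/-- Unary, so that polynomial in the size means polynomial in the value. Binary numbers are lists of
Booleans. -/
instance : Enc ℕ := ⟨fun n => enc (List.replicate n ())⟩

section

variable {α β γ σ : Type} [Enc α] [Enc β] [Enc γ] [Enc σ]

/-- The size of the encoding. -/
def sz (a : α) : ℕ := (enc a).size

theorem sz_pos (a : α) : 0 < sz a := V.size_pos _

@[simp] theorem enc_pair (a : α) (b : β) : enc (a, b) = V.cons (enc a) (enc b) := rfl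

@[simp] theorem enc_cons (a : α) (l : List α) : enc (a :: l) = V.cons (enc a) (enc l) := rfl

@[simp] theorem enc_true : enc true = V.cons V.nil V.nil := rfl

@[simp] theorem enc_false : enc false = V.nil := rfl

@[simp] theorem sz_pair (a : α) (b : β) : sz (a, b) = sz a + sz b + 1 := V.size_cons _ _

@[simp] theorem sz_nil : sz ([] : List α) = 1 := rfl

@[simp] theorem sz_cons (a : α) (l : List α) : sz (a :: l) = sz a + sz l + 1 := V.size_cons _ _

/-- The program `p` replaces the tree `x` on top of the main stack by `y` in time `T`. -/
def Computes (p : Prog) (x y : V) (T : ℕ) : Prop :=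
  ∀ v r s u, ∃ v', Run p v ⟨x.code ++ r, s, u, []⟩ v' ⟨y.code ++ r, s, u, []⟩ T

namespace Prog

def first (p : Prog) : Prog := .pop 0 ;; p ;; .push 0 (some true)

def second (p : Prog) : Prog := .pop 0 ;; moveTo 1 ;; p ;; moveFrom 1 ;; .push 0 (some true)

def pair (p q : Prog) : Prog := dup ;; q ;; swap ;; p ;; .push 0 (some true)

def fstP : Prog := .pop 0 ;; .ite isOne (swap ;; drop) (.push 0 (some false))

def sndP : Prog := .pop 0 ;; .ite isOne drop (.push 0 (some false))

def nilP : Prog := drop ;; .push 0 (some false)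

/-- The code of `true` is a node with two leaves: after its first symbol is popped, two leaves
remain for the two `drop`s. The code of `false` vanishes with the pop. -/
def cond (c p q : Prog) : Prog := dup ;; c ;; .pop 0 ;; .ite isOne (drop ;; drop ;; p) q

def whileLoop (c p : Prog) : Prog :=
  dup ;; c ;; .pop 0 ;; .loop isOne (drop ;; drop ;; p ;; dup ;; c ;; .pop 0)

/-- Process the elements of a list from left to right, with a state. -/
def mapAcc (p : Prog) : Prog :=
  -- The state waits on stack 1, the unread part of the list stays on the main stack, and the
  -- outputs pile up on stack 2 above a mark. The second loop conses them from the last to the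
  -- first.
  .pop 0 ;; moveTo 1 ;; .push 2 none ;; .pop 0 ;;
  .loop isOne (moveFrom 1 ;; .push 0 (some true) ;; p ;; .pop 0 ;; moveTo 1 ;; moveTo 2 ;; .pop 0) ;;
  .push 0 (some false) ;; .pop 2 ;;
  .loop notMark (.put 2 ;; moveFrom 2 ;; .push 0 (some true) ;; .pop 2) ;;
  moveFrom 1 ;; .push 0 (some true)

end Prog

namespace Computes

variable {p q c : Prog} {x y z : V} {T T₁ T₂ T₃ : ℕ}

theorem mono {T'} (h : Computes p x y T) (hT : T ≤ T') : Computes p x y T' := fun v r s u =>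
  let ⟨v', h⟩ := h v r s u
  ⟨v', h.mono hT⟩

theorem seq (hp : Computes p x y T₁) (hq : Computes q y z T₂) :
    Computes (.seq p q) x z (T₁ + T₂) := fun v r s u =>
  let ⟨v₁, h₁⟩ := hp v r s u
  let ⟨v₂, h₂⟩ := hq v₁ r s u
  ⟨v₂, h₁.seq h₂⟩

theorem skip (x : V) : Computes .skip x x 1 := fun _ _ _ _ => ⟨_, Run.skip _ _⟩

theorem code_cons_append (x y : V) (r : List (Option Bool)) :
    (V.cons x y).code ++ r = some true :: (x.code ++ (y.code ++ r)) := by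
  simp [V.code]

theorem first (hp : Computes p x y T) (z : V) :
    Computes (Prog.first p) (V.cons x z) (V.cons y z) (T + 2) := fun v r s u => by
  obtain ⟨v', h⟩ := hp (some (some true)) (z.code ++ r) s u
  rw [code_cons_append, code_cons_append]
  exact ⟨_, ((Run.pop _ _ _).seq (h.seq (Run.push _ _ _ _))).mono (by omega)⟩

theorem second (hp : Computes p x y T) (z : V) :
    Computes (Prog.second p) (V.cons z x) (V.cons z y) (T + 10 * z.size + 8) := fun v r s u => by
  obtain ⟨v', h⟩ := hp none r (z.code.reverse ++ none :: s) u
  rw [code_cons_append, code_cons_append]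
  exact ⟨_, ((Run.pop _ _ _).seq ((Run.moveTo_one _ z _ _ _).seq (h.seq
    ((Run.moveFrom_one _ z _ _ _).seq (Run.push _ _ _ _))))).mono (by omega)⟩

theorem pair (hp : Computes p x y T₁) (hq : Computes q x z T₂) :
    Computes (Prog.pair p q) x (V.cons y z) (T₁ + T₂ + 27 * x.size + 10 * z.size + 25) :=
  fun v r s u => by
  obtain ⟨v₂, h₂⟩ := hq (some none) (x.code ++ r) s u
  obtain ⟨v₁, h₁⟩ := hp (some none) (z.code ++ r) s u
  rw [code_cons_append]
  exact ⟨_, ((Run.dup v x _ _ _).seq (h₂.seq ((Run.swap _ z x _ _ _).seq (h₁.seq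
    (Run.push _ _ _ _))))).mono (by omega)⟩

theorem fst (x y : V) : Computes Prog.fstP (V.cons x y) x (10 * x.size + 20 * y.size + 20) :=
  fun v r s u => by
  rw [code_cons_append]
  exact ⟨_, ((Run.pop _ _ _).seq (Run.ite_true rfl ((Run.swap _ x y _ _ _).seq
    (Run.drop _ y _ _ _)))).mono (by omega)⟩

theorem fst_nil : Computes Prog.fstP V.nil V.nil 3 :=
  fun _ _ _ _ => ⟨_, (Run.pop _ _ _).seq (Run.ite_false rfl (Run.push _ _ _ _))⟩

theorem snd (x y : V) : Computes Prog.sndP (V.cons x y) y (10 * x.size + 8) :=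
  fun v r s u => by
  rw [code_cons_append]
  exact ⟨_, ((Run.pop _ _ _).seq (Run.ite_true rfl (Run.drop _ x _ _ _))).mono (by omega)⟩

theorem snd_nil : Computes Prog.sndP V.nil V.nil 3 :=
  fun _ _ _ _ => ⟨_, (Run.pop _ _ _).seq (Run.ite_false rfl (Run.push _ _ _ _))⟩

theorem nil (x : V) : Computes Prog.nilP x V.nil (10 * x.size + 7) :=
  fun _ _ _ _ => ⟨_, (Run.drop _ x _ _ _).seq (Run.push _ _ _ _)⟩

theorem cond {b : Bool} (hc : Computes c x (enc b) T) (hp : b = true → Computes p x y T₁)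
    (hq : b = false → Computes q x y T₁) :
    Computes (Prog.cond c p q) x y (T + T₁ + 17 * x.size + 46) := fun v r s u => by
  obtain ⟨v₁, h₁⟩ := hc (some none) (x.code ++ r) s u
  cases b with
  | false =>
    obtain ⟨v₂, h₂⟩ := hq rfl (some (some false)) r s u
    exact ⟨_, ((Run.dup v x _ _ _).seq (h₁.seq ((Run.pop _ _ _).seq
      (Run.ite_false rfl h₂)))).mono (by omega)⟩
  | true =>
    obtain ⟨v₂, h₂⟩ := hp rfl (some none) r s u
    refine ⟨_, ((Run.dup v x _ _ _).seq (h₁.seq ((Run.pop _ _ _).seq (Run.ite_true rfl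
      ((Run.drop _ V.nil _ _ _).seq ((Run.drop _ V.nil _ _ _).seq h₂)))))).mono ?_⟩
    simp
    omega

/-- A loop that runs through the trees `x 0, x 1, ...` and stops after `j` rounds. -/
theorem whileLoop {t : ℕ → Bool} {x : ℕ → V} {j : ℕ} {M : ℕ}
    (hc : ∀ i ≤ j, Computes c (x i) (enc (t i)) M)
    (hp : ∀ i < j, Computes p (x i) (x (i + 1)) M)
    (hs : ∀ i ≤ j, (x i).size ≤ M)
    (ht : ∀ i < j, t i = true) (hj : t j = false) :
    Computes (Prog.whileLoop c p) (x 0) (x j) ((j + 1) * (19 * M + 50)) := fun v r s u => by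
  -- `i` is the number of rounds still to run, so the loop stands at the tree `x (j - i)`.
  have key : ∀ i ≤ j, ∀ v : Option (Option Bool), ∃ v', Run (.loop Prog.isOne
      (Prog.drop ;; Prog.drop ;; p ;; Prog.dup ;; c ;; .pop 0))
      (((enc (t (j - i))).code ++ ((x (j - i)).code ++ r)).head?)
      ⟨((enc (t (j - i))).code ++ ((x (j - i)).code ++ r)).tail, s, u, []⟩
      v' ⟨(x j).code ++ r, s, u, []⟩ (i * (19 * M + 50) + 1) := by
    intro i hi
    induction i with
    | zero =>
      intro v
      rw [Nat.sub_zero, hj]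
      exact ⟨_, (Run.loop_false rfl).mono (by omega)⟩
    | succ i ih =>
      intro v
      have e : j - i = j - (i + 1) + 1 := by omega
      rw [ht _ (by omega)]
      obtain ⟨v₁, h₁⟩ := hp (j - (i + 1)) (by omega) (some none) r s u
      rw [← e] at h₁
      obtain ⟨v₂, h₂⟩ := hc (j - i) (by omega) (some none) ((x (j - i)).code ++ r) s u
      obtain ⟨v₃, h₃⟩ := ih (by omega) v₂
      refine ⟨_, (Run.loop_true rfl ((Run.drop _ V.nil _ _ _).seq ((Run.drop _ V.nil _ _ _).seq
        (h₁.seq ((Run.dup _ (x (j - i)) _ _ _).seq (h₂.seq (Run.pop _ _ _)))))) h₃).mono ?_⟩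
      have := hs (j - i) (by omega)
      simp only [V.size_nil, add_mul]
      omega
  obtain ⟨v₂, h₂⟩ := hc 0 (by omega) (some none) ((x 0).code ++ r) s u
  obtain ⟨v₃, h₃⟩ := key j le_rfl v₂
  rw [Nat.sub_self] at h₃
  refine ⟨_, ((Run.dup _ (x 0) _ _ _).seq (h₂.seq ((Run.pop _ _ _).seq h₃))).mono ?_⟩
  have := hs 0 (by omega)
  rw [add_mul]
  omega

end Computes

/-- The reversed contents of a stack on which trees have been pushed one after the other. -/
def revStack : List V → List (Option Bool) → List (Option Bool)
  | [], u => u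
  | y :: l, u => revStack l (y.code.reverse ++ none :: u)

theorem revStack_append (l l' : List V) (u) : revStack (l ++ l') u = revStack l' (revStack l u) := by
  induction l generalizing u with
  | nil => rfl
  | cons y l ih => exact ih _

-- The tree pushed last is on top, hence the induction from the right. A code is nonempty and free
-- of marks, while a mark lies below the first tree; so the top symbol tells whether another tree
-- follows.
open Prog in
theorem Run.rebuild {r s u : List (Option Bool)} {M : ℕ} (l : List V) (hl : ∀ y ∈ l, y.size ≤ M)
    (z : V) :
    Run (.loop notMark (.put 2 ;; moveFrom 2 ;; .push 0 (some true) ;; .pop 2))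
      (revStack l (none :: u)).head? ⟨z.code ++ r, s, (revStack l (none :: u)).tail, []⟩
      (some none) ⟨(l.foldr V.cons z).code ++ r, s, u, []⟩ (l.length * (3 * M + 6) + 1) := by
  induction l using List.reverseRecOn generalizing z with
  | nil => exact (Run.loop_false rfl).mono (by omega)
  | append_singleton l y ih =>
    rw [revStack_append]
    obtain ⟨b, c, hc⟩ : ∃ b c, (y.code.reverse ++ none :: revStack l (none :: u)) = some b :: c := by
      have h : y.code.reverse ≠ [] := by cases y <;> simp [V.code]
      rcases h' : y.code.reverse with _ | ⟨_ | b, c⟩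
      · exact absurd h' h
      · have : (none : Option Bool) ∈ y.code := by
          rw [← List.mem_reverse, h']; simp
        exact absurd rfl (V.ne_none_of_mem_code this)
      · exact ⟨_, _, rfl⟩
    have h₁ := Run.moveFrom_two (some (some b)) y (z.code ++ r) s (revStack l (none :: u))
    have h₂ := ih (fun x hx => hl x (by simp [hx])) (V.cons y z)
    have hy := hl y (by simp)
    simp only [revStack] at *
    rw [hc] at h₁ ⊢
    rw [Computes.code_cons_append] at h₂
    rw [List.foldr_append]
    refine (Run.loop_true rfl ((Run.put _ _ _).seq (h₁.seq ((Run.push _ _ _ _).seq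
      (Run.pop _ _ _)))) h₂).mono ?_
    simp only [List.length_append, List.length_singleton, add_mul]
    omega

theorem enc_list (l : List β) : enc l = (l.map enc).foldr V.cons V.nil := by
  induction l with
  | nil => rfl
  | cons x l ih => rw [enc_cons, ih]; rfl

-- The hypothesis is restricted to states reached after a prefix of `l`, because size bounds for the
-- state are available only along the actual run.
open Prog in
theorem Computes.mapAcc {p : Prog} {g : σ → β → σ × γ} {M : ℕ} (s₀ : σ) (l : List β)
    (hs₀ : sz s₀ ≤ M)
    (h : ∀ l₁ x l₂, l = l₁ ++ x :: l₂ →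
      Computes p (enc ((mapAcc g s₀ l₁).1, x)) (enc (g (mapAcc g s₀ l₁).1 x)) M ∧
      sz (g (mapAcc g s₀ l₁).1 x) ≤ M) :
    Computes (Prog.mapAcc p) (enc (s₀, l)) (enc (mapAcc g s₀ l)) ((l.length + 1) * (21 * M + 30)) := by
  intro v r s u
  -- Generalized over the part `l₁` already read, the state `s₁` reached there and the outputs `L`
  -- already on stack 2.
  have key : ∀ (l' l₁ : List β), l = l₁ ++ l' → ∀ (s₁ : σ) (L : List V) (v : Option (Option Bool)),
      s₁ = (_root_.mapAcc g s₀ l₁).1 → sz s₁ ≤ M →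
      ∃ v', Run (.loop isOne (moveFrom 1 ;; .push 0 (some true) ;; p ;; .pop 0 ;; moveTo 1 ;;
        moveTo 2 ;; .pop 0)) ((enc l').code ++ r).head?
        ⟨((enc l').code ++ r).tail, (enc s₁).code.reverse ++ none :: s, revStack L (none :: u), []⟩
        v' ⟨r, (enc (_root_.mapAcc g s₁ l').1).code.reverse ++ none :: s,
          revStack (L ++ (_root_.mapAcc g s₁ l').2.map enc) (none :: u), []⟩
        (l'.length * (18 * M + 20) + 1) ∧ sz (_root_.mapAcc g s₁ l').1 ≤ M ∧
        ∀ y ∈ (_root_.mapAcc g s₁ l').2, sz y ≤ M := by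
    intro l'
    induction l' with
    | nil =>
      intro l₁ _ s₁ L v _ hs
      refine ⟨((enc ([] : List β)).code ++ r).head?, ?_, hs, by simp [_root_.mapAcc]⟩
      simp only [_root_.mapAcc, List.map_nil, List.append_nil]
      exact (Run.loop_false rfl).mono (Nat.le_add_left _ _)
    | cons x l' ih =>
      intro l₁ hl s₁ L v hs₁ hs
      obtain ⟨hp, hM⟩ := h l₁ x l' hl
      rw [← hs₁] at hp hM
      rw [show g s₁ x = ((g s₁ x).1, (g s₁ x).2) from rfl, sz_pair] at hM
      obtain ⟨v₁, h₁⟩ := hp (some none) ((enc l').code ++ r) s (revStack L (none :: u))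
      obtain ⟨v₂, h₂, hs₂, hy₂⟩ := ih (l₁ ++ [x]) (by simp [hl]) (g s₁ x).1
        (L ++ [enc (g s₁ x).2]) none (by rw [mapAcc_append_singleton, hs₁]) (by omega)
      rw [show g s₁ x = ((g s₁ x).1, (g s₁ x).2) from rfl, enc_pair, enc_pair,
        Computes.code_cons_append, Computes.code_cons_append] at h₁
      rw [show revStack (L ++ [enc (g s₁ x).2]) (none :: u) = (enc (g s₁ x).2).code.reverse ++
        none :: revStack L (none :: u) from revStack_append _ _ _, List.append_assoc] at h₂
      refine ⟨v₂, ?_, hs₂, ?_⟩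
      · rw [enc_cons, Computes.code_cons_append]
        refine (Run.loop_true rfl ((Run.moveFrom_one _ (enc s₁) _ _ _).seq ((Run.push _ _ _ _).seq
          (h₁.seq ((Run.pop _ _ _).seq ((Run.moveTo_one _ (enc (g s₁ x).1) _ _ _).seq
            ((Run.moveTo_two _ (enc (g s₁ x).2) _ _ _).seq (Run.pop _ _ _))))))) h₂).mono ?_
        simp only [sz, List.length_cons, add_mul] at *
        omega
      · simp only [_root_.mapAcc, List.mem_cons]
        rintro y (rfl | hy)
        exacts [by omega, hy₂ y hy]
  obtain ⟨v₁, h₁, hs, hy⟩ := key l [] rfl s₀ [] none rfl hs₀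
  have h₂ := Run.rebuild (r := r) (s := (enc (_root_.mapAcc g s₀ l).1).code.reverse ++ none :: s)
    (u := u) (M := M) ((_root_.mapAcc g s₀ l).2.map enc) (by simpa [sz] using hy) V.nil
  rw [List.nil_append] at h₁
  rw [show _root_.mapAcc g s₀ l = ((_root_.mapAcc g s₀ l).1, (_root_.mapAcc g s₀ l).2) from rfl,
    enc_pair, enc_pair, code_cons_append, code_cons_append, enc_list (_root_.mapAcc g s₀ l).2]
  refine ⟨_, ((Run.pop _ _ _).seq ((Run.moveTo_one _ (enc s₀) _ _ _).seq ((Run.push _ _ _ _).seq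
    ((Run.pop _ _ _).seq (h₁.seq ((Run.push _ _ _ _).seq ((Run.pop _ _ _).seq (h₂.seq
    ((Run.moveFrom_one _ (enc (_root_.mapAcc g s₀ l).1) _ _ _).seq (Run.push _ _ _ _)))))))))).mono ?_⟩
  simp only [sz, List.length_map, length_mapAcc, add_mul] at *
  have : l.length * (21 * M + 30) = l.length * (18 * M + 20) + l.length * (3 * M + 6) + l.length * 4 := by ring
  simp only [mul_add] at this ⊢
  omega

end

/-! ### Functions computable in polynomial time relative to a bound -/

/-- `T` is bounded by a polynomial in `X`. -/
def PolyBd {α : Type} (X T : α → ℕ) : Prop := ∃ c, ∀ a, T a ≤ (X a + 2) ^ c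

namespace PolyBd

variable {α β : Type} {X Y T U : α → ℕ}

theorem mono (h : PolyBd X T) (hU : ∀ a, U a ≤ T a) : PolyBd X U :=
  let ⟨c, h⟩ := h
  ⟨c, fun a => (hU a).trans (h a)⟩

theorem self (X : α → ℕ) : PolyBd X X := ⟨1, fun a => by rw [pow_one]; omega⟩

theorem of_le (h : ∀ a, T a ≤ X a) : PolyBd X T := (self X).mono h

/-- The summand 2 in the base makes this work: `n` is below the `n`-th power of any base that is at
least 2. -/
theorem const (X : α → ℕ) (n : ℕ) : PolyBd X fun _ => n :=
  ⟨n, fun a => n.lt_two_pow_self.le.trans (Nat.pow_le_pow_left (by omega) n)⟩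

theorem mul (h : PolyBd X T) (h' : PolyBd X U) : PolyBd X fun a => T a * U a :=
  let ⟨c, h⟩ := h
  let ⟨c', h'⟩ := h'
  ⟨c + c', fun a => by rw [pow_add]; exact Nat.mul_le_mul (h a) (h' a)⟩

theorem add (h : PolyBd X T) (h' : PolyBd X U) : PolyBd X fun a => T a + U a := by
  obtain ⟨c, h⟩ := h
  obtain ⟨c', h'⟩ := h'
  refine ⟨c + c' + 1, fun a => ?_⟩
  have h₁ : (X a + 2) ^ c ≤ (X a + 2) ^ (c + c') := Nat.pow_le_pow_right (by omega) (by omega)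
  have h₂ : (X a + 2) ^ c' ≤ (X a + 2) ^ (c + c') := Nat.pow_le_pow_right (by omega) (by omega)
  have h₃ : (X a + 2) ^ (c + c') * 2 ≤ (X a + 2) ^ (c + c') * (X a + 2) :=
    Nat.mul_le_mul_left _ (by omega)
  rw [pow_succ]
  linarith [h a, h' a]

theorem pow (h : PolyBd X T) (n : ℕ) : PolyBd X fun a => T a ^ n :=
  let ⟨c, h⟩ := h
  ⟨c * n, fun a => by rw [pow_mul]; exact Nat.pow_le_pow_left (h a) n⟩

/-- Substitution of a polynomial bound. -/
theorem trans (h : PolyBd Y T) (hY : PolyBd X Y) : PolyBd X T := by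
  obtain ⟨c, h⟩ := h
  exact ((hY.add (const X 2)).pow c).mono h

theorem comp {X T : β → ℕ} (h : PolyBd X T) (f : α → β) :
    PolyBd (fun a => X (f a)) fun a => T (f a) :=
  let ⟨c, h⟩ := h
  ⟨c, fun a => h (f a)⟩

end PolyBd

/-! ### Relative polynomial time and its closure properties -/

section

variable {α β γ δ σ : Type} [Enc α] [Enc β] [Enc γ] [Enc δ] [Enc σ]

theorem sz_prod (p : α × β) : sz p = sz p.1 + sz p.2 + 1 := V.size_cons _ _

theorem size_enc (a : α) : (enc a).size = sz a := rfl

/-- The function `f` is computed by a program whose running time is bounded by a polynomial in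
`B` and the size of the argument. -/
def PolyB (B : α → ℕ) (f : α → β) : Prop :=
  ∃ (p : Prog) (T : α → ℕ), (∀ a, Computes p (enc a) (enc (f a)) (T a)) ∧
    PolyBd (fun a => B a + sz a) T ∧ PolyBd (fun a => B a + sz a) fun a => sz (f a)

/-- Computable in polynomial time. -/
abbrev PolyT (f : α → β) : Prop := PolyB (fun _ => 0) f

namespace PolyB

variable {B C : α → ℕ}

theorem bd {f : α → β} (h : PolyB B f) : PolyBd (fun a => B a + sz a) fun a => sz (f a) :=
  let ⟨_, _, _, _, h⟩ := h
  h

theorem mono {f : α → β} (h : PolyB B f) (hC : PolyBd (fun a => C a + sz a) B) : PolyB C f := by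
  obtain ⟨p, T, hp, hT, hs⟩ := h
  have := hC.add (PolyBd.of_le (X := fun a => C a + sz a) (T := fun a => sz a) fun a => by omega)
  exact ⟨p, T, hp, hT.trans this, hs.trans this⟩

theorem of_poly {f : α → β} (h : PolyT f) : PolyB B f := h.mono (PolyBd.const _ 0)

theorem id : PolyB B fun a : α => a :=
  ⟨.skip, fun _ => 1, fun _ => Computes.skip _, PolyBd.const _ _, PolyBd.of_le fun _ => Nat.le_add_left _ _⟩

/-- Programs see only encodings, so a function may be exchanged for any other with the same encoded
values, even of another type. This is how a composed program is identified with the function it is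
meant to compute. -/
theorem congr_enc {f : α → β} {g : α → γ} (h : PolyB B f) (hg : ∀ a, enc (g a) = enc (f a)) :
    PolyB B g := by
  obtain ⟨p, T, hp, hT, hs⟩ := h
  exact ⟨p, T, fun a => by rw [hg]; exact hp a, hT, hs.mono fun a => by simp [sz, hg]⟩

/-- The outer function is evaluated at arguments produced by the inner one, so its bound must be
polynomial there; the bound on output sizes in `PolyB` serves this purpose. -/
theorem comp' {D : β → ℕ} {g : β → γ} {f : α → β} (hg : PolyB D g) (hf : PolyB B f)
    (hD : PolyBd (fun a => B a + sz a) fun a => D (f a)) : PolyB B fun a => g (f a) := by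
  obtain ⟨p, T, hp, hT, hs⟩ := hf
  obtain ⟨q, U, hq, hU, hu⟩ := hg
  have := hD.add hs
  exact ⟨.seq p q, fun a => T a + U (f a), fun a => (hp a).seq (hq (f a)),
    hT.add ((hU.comp f).trans this), (hu.comp f).trans this⟩

theorem comp {g : β → γ} {f : α → β} (hg : PolyT g) (hf : PolyB B f) : PolyB B fun a => g (f a) :=
  hg.comp' hf (PolyBd.const _ 0)

theorem pair {f : α → β} {g : α → γ} (hf : PolyB B f) (hg : PolyB B g) :
    PolyB B fun a => (f a, g a) := by
  obtain ⟨p, T, hp, hT, hs⟩ := hf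
  obtain ⟨q, U, hq, hU, hu⟩ := hg
  refine ⟨p.pair q, _, fun a => (hp a).pair (hq a), ?_, ?_⟩
  · exact (((hT.add hU).add ((PolyBd.const _ 27).mul (PolyBd.of_le fun a => by simp [sz]))).add
      ((PolyBd.const _ 10).mul hu)).add (PolyBd.const _ 25)
  · simp only [sz_pair]
    exact (hs.add hu).add (PolyBd.const _ 1)

theorem poly_fst : PolyT fun p : α × β => p.1 :=
  ⟨Prog.fstP, _, fun p => Computes.fst _ _,
    (((PolyBd.const _ 10).mul (PolyBd.of_le fun p => by simp only [size_enc, sz_prod p]; omega)).add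
      ((PolyBd.const _ 20).mul (PolyBd.of_le fun p => by simp only [size_enc, sz_prod p]; omega))).add (PolyBd.const _ 20),
    PolyBd.of_le fun p => by simp only [sz_prod p]; omega⟩

theorem poly_snd : PolyT fun p : α × β => p.2 :=
  ⟨Prog.sndP, _, fun p => Computes.snd _ _,
    ((PolyBd.const _ 10).mul (PolyBd.of_le fun p => by simp only [size_enc, sz_prod p]; omega)).add (PolyBd.const _ 8),
    PolyBd.of_le fun p => by simp only [sz_prod p]; omega⟩

theorem fst {f : α → β × γ} (hf : PolyB B f) : PolyB B fun a => (f a).1 := poly_fst.comp hf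

theorem snd {f : α → β × γ} (hf : PolyB B f) : PolyB B fun a => (f a).2 := poly_snd.comp hf

theorem constV (x : V) : PolyT fun _ : α => x := by
  induction x with
  | nil =>
    exact ⟨Prog.nilP, _, fun a => Computes.nil _,
      ((PolyBd.const _ 10).mul (PolyBd.of_le fun p => by simp [sz])).add (PolyBd.const _ 7),
      PolyBd.const _ _⟩
  | cons x y hx hy => exact (hx.pair hy).congr_enc fun a => rfl

theorem const (b : β) : PolyB B fun _ : α => b :=
  of_poly ((constV (enc b)).congr_enc fun _ => rfl)

theorem ite {c : α → Bool} {f g : α → β} (hc : PolyB B c) (hf : PolyB B f) (hg : PolyB B g) :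
    PolyB B fun a => if c a = true then f a else g a := by
  obtain ⟨p, T, hp, hT, hs⟩ := hf
  obtain ⟨q, U, hq, hU, hu⟩ := hg
  obtain ⟨r, W, hr, hW, hw⟩ := hc
  refine ⟨.cond r p q, _, fun a => Computes.cond (T₁ := T a + U a) (hr a) (fun h => ?_)
    (fun h => ?_), ?_, ?_⟩
  · simpa [h] using (hp a).mono (by omega)
  · simpa [h] using (hq a).mono (by omega)
  · exact ((hW.add (hT.add hU)).add ((PolyBd.const _ 17).mul (PolyBd.of_le fun a => by simp [sz]))).add
      (PolyBd.const _ 46)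
  · refine (hs.add hu).mono fun a => ?_
    dsimp only
    split <;> omega

theorem not {f : α → Bool} (hf : PolyB B f) : PolyB B fun a => !f a :=
  (hf.ite (const false) (const true)).congr_enc fun a => by cases f a <;> rfl

theorem and {f g : α → Bool} (hf : PolyB B f) (hg : PolyB B g) : PolyB B fun a => f a && g a :=
  (hf.ite hg (const false)).congr_enc fun a => by cases f a <;> rfl

theorem or {f g : α → Bool} (hf : PolyB B f) (hg : PolyB B g) : PolyB B fun a => f a || g a :=
  (hf.ite (const true) hg).congr_enc fun a => by cases f a <;> rfl

theorem cons {f : α → β} {g : α → List β} (hf : PolyB B f) (hg : PolyB B g) :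
    PolyB B fun a => f a :: g a :=
  (hf.pair hg).congr_enc fun _ => rfl

theorem isEmpty {f : α → List β} (hf : PolyB B f) : PolyB B fun a => (f a).isEmpty := by
  refine comp (g := fun l : List β => l.isEmpty) ⟨.pop 0 ;; .ite Prog.isOne
    (Prog.drop ;; Prog.drop ;; .push 0 (some false))
    (.push 0 (some false) ;; .push 0 (some false) ;; .push 0 (some true)),
    fun l => 10 * sz l + 20, fun l v r s u => ?_,
    ((PolyBd.const _ 10).mul (PolyBd.of_le fun a => by omega)).add (PolyBd.const _ 20),
    (PolyBd.const _ 3).mono fun l => by cases l <;> simp [sz]⟩ hf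
  cases l with
  | nil =>
    exact ⟨_, ((Run.pop _ _ _).seq (Run.ite_false rfl ((Run.push _ _ _ _).seq ((Run.push _ _ _ _).seq
      (Run.push _ _ _ _))))).mono (Nat.le_add_left _ _)⟩
  | cons x l =>
    rw [enc_cons, Computes.code_cons_append]
    refine ⟨_, ((Run.pop _ _ _).seq (Run.ite_true rfl ((Run.drop _ (enc x) _ _ _).seq
      ((Run.drop _ (enc l) _ _ _).seq (Run.push _ _ _ _))))).mono ?_⟩
    simp only [sz_cons, size_enc]
    omega

theorem tail {f : α → List β} (hf : PolyB B f) : PolyB B fun a => (f a).tail := by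
  refine comp (g := fun l : List β => l.tail) ⟨Prog.sndP, fun l => 10 * sz l + 20, fun l => ?_,
    ((PolyBd.const _ 10).mul (PolyBd.of_le fun a => by omega)).add (PolyBd.const _ 20),
    PolyBd.of_le fun l => by cases l <;> simp; omega⟩ hf
  cases l with
  | nil => exact Computes.snd_nil.mono (Nat.le_add_left _ _)
  | cons x l => exact (Computes.snd _ _).mono (by simp only [size_enc, sz_cons]; omega)

theorem headD {f : α → List β} {d : α → β} (hf : PolyB B f) (hd : PolyB B d) :
    PolyB B fun a => (f a).headD (d a) := by
  have : PolyT fun l : List β => (match l with | [] => V.nil | x :: _ => enc x : V) := by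
    refine ⟨Prog.fstP, fun l => 20 * sz l + 20, fun l => ?_,
      ((PolyBd.const _ 20).mul (PolyBd.of_le fun a => by omega)).add (PolyBd.const _ 20),
      PolyBd.of_le fun l => ?_⟩
    · cases l with
      | nil => exact Computes.fst_nil.mono (Nat.le_add_left _ _)
      | cons x l =>
        refine (Computes.fst (enc x) (enc l)).mono ?_
        simp only [size_enc, sz_cons]
        omega
    · cases l with
      | nil => exact Nat.le_add_left _ _
      | cons x l =>
        rw [sz_cons]
        exact le_trans (le_refl (sz x)) (by omega)
  refine ((hf.isEmpty).ite (hd.congr_enc fun a => rfl : PolyB B fun a => enc (d a))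
    (this.comp hf)).congr_enc fun a => ?_
  cases f a <;> rfl

theorem length_lt_sz (l : List β) : l.length < sz l := by
  induction l with
  | nil => simp
  | cons x l ih => simp; omega

theorem sz_lt_of_mem {l : List β} {x : β} (h : x ∈ l) : sz x < sz l := by
  induction l with
  | nil => simp at h
  | cons y l ih =>
    rw [sz_cons]
    rcases List.mem_cons.1 h with rfl | h
    · omega
    · have := ih h; omega

theorem sz_le_of_forall {l : List β} {M : ℕ} (h : ∀ x ∈ l, sz x ≤ M) :
    sz l ≤ l.length * (M + 1) + 1 := by
  induction l with
  | nil => simp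
  | cons y l ih =>
    have := ih fun x hx => h x (by simp [hx])
    have := h y (by simp)
    rw [sz_cons, List.length_cons, add_mul]
    omega

/-- Recursion over a list from the left, with outputs. -/
theorem mapAcc {l : α → List β} {s₀ : α → σ} {g : α → σ → β → σ × γ} (S : α → ℕ)
    (hl : PolyB B l) (hs : PolyB B s₀)
    (hg : PolyB (fun p : α × σ × β => B p.1) fun p => g p.1 p.2.1 p.2.2)
    (hS : PolyBd (fun a => B a + sz a) S)
    (hb : ∀ a l₁, l₁ <+: l a → sz (mapAcc (g a) (s₀ a) l₁).1 ≤ S a) :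
    PolyB B fun a => mapAcc (g a) (s₀ a) (l a) := by
  -- The program of a pass sees only the state and the current element, so the parameter `a` travels
  -- inside the state.
  have h₁ : PolyB (fun p : (α × σ) × β => B p.1.1)
      fun p => ((p.1.1, (g p.1.1 p.1.2 p.2).1), (g p.1.1 p.1.2 p.2).2) := by
    have : PolyB (fun p : (α × σ) × β => B p.1.1) fun p => g p.1.1 p.1.2 p.2 :=
      hg.comp' (id.fst.fst.pair (id.fst.snd.pair id.snd)) (PolyBd.of_le fun p => by simp)
    exact (id.fst.fst.pair this.fst).pair this.snd
  obtain ⟨p, T, hp, ⟨c, hT⟩, ⟨d, hd⟩⟩ := h₁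
  let X : α → ℕ := fun a => B a + sz a
  let Y : α → ℕ := fun a => B a + sz a + S a + sz (l a)
  have hY : PolyBd X Y := ((PolyBd.self _).add hS).add hl.bd
  -- `Y` controls the arguments met along the run, and `M` the time and the output size of every
  -- step on them.
  let M : α → ℕ := fun a => (Y a + 4) ^ c + (Y a + 4) ^ d + Y a + 2
  have hM : PolyBd X M := ((((hY.add (PolyBd.const _ 4)).pow c).add
    ((hY.add (PolyBd.const _ 4)).pow d)).add hY).add (PolyBd.const _ 2)
  have key : ∀ a l₁, _root_.mapAcc (fun (q : α × σ) (x : β) => ((q.1, (g q.1 q.2 x).1),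
      (g q.1 q.2 x).2)) (a, s₀ a) l₁ = ((a, (_root_.mapAcc (g a) (s₀ a) l₁).1),
        (_root_.mapAcc (g a) (s₀ a) l₁).2) := by
    intro a l₁
    generalize s₀ a = s
    induction l₁ generalizing s with
    | nil => rfl
    | cons x l₁ ih => simp [_root_.mapAcc, ih]
  have hstep : ∀ a l₁ x l₂, l a = l₁ ++ x :: l₂ → sz (_root_.mapAcc (g a) (s₀ a) l₁).1 ≤ S a ∧
      sz x < sz (l a) := fun a l₁ x l₂ h =>
    ⟨hb a l₁ ⟨_, h.symm⟩, sz_lt_of_mem (by simp [h])⟩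
  have hrun : ∀ a, Computes p.mapAcc (enc ((a, s₀ a), l a))
      (enc ((a, (_root_.mapAcc (g a) (s₀ a) (l a)).1), (_root_.mapAcc (g a) (s₀ a) (l a)).2))
      (((l a).length + 1) * (21 * M a + 30)) := by
    intro a
    rw [← key]
    refine Computes.mapAcc (g := fun (q : α × σ) (x : β) => ((q.1, (g q.1 q.2 x).1),
      (g q.1 q.2 x).2)) (a, s₀ a) (l a) ?_ fun l₁ x l₂ h => ?_
    · have : sz (s₀ a) ≤ S a := hb a [] (by simp)
      simp only [sz_pair, M, Y]
      omega
    · rw [key]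
      obtain ⟨h₁, h₂⟩ := hstep a l₁ x l₂ h
      have hle : B a + sz ((a, (_root_.mapAcc (g a) (s₀ a) l₁).1), x) + 2 ≤ Y a + 4 := by
        simp only [sz_pair, Y]
        omega
      have hT' := (hT ((a, (_root_.mapAcc (g a) (s₀ a) l₁).1), x)).trans (Nat.pow_le_pow_left hle c)
      have hd' := (hd ((a, (_root_.mapAcc (g a) (s₀ a) l₁).1), x)).trans (Nat.pow_le_pow_left hle d)
      refine ⟨(hp ((a, (_root_.mapAcc (g a) (s₀ a) l₁).1), x)).mono (hT'.trans ?_), hd'.trans ?_⟩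
      · simp only [M]; omega
      · simp only [M]; omega
  have hin : PolyB B fun a => ((a, s₀ a), l a) := (id.pair hs).pair hl
  obtain ⟨q, U, hq, hU, hu⟩ := hin
  have hlen : PolyBd X fun a => (l a).length := hl.bd.mono fun a => (length_lt_sz _).le
  have hmid : PolyB B fun a => ((a, (_root_.mapAcc (g a) (s₀ a) (l a)).1),
      (_root_.mapAcc (g a) (s₀ a) (l a)).2) := by
    refine ⟨.seq q p.mapAcc, _, fun a => (hq a).seq (hrun a), hU.add ((hlen.add (PolyBd.const _ 1)).mul
      (((PolyBd.const _ 21).mul hM).add (PolyBd.const _ 30))), ?_⟩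
    refine (((hM.add (hlen.mul (hM.add (PolyBd.const _ 1)))).add (PolyBd.const _ 2))).mono fun a => ?_
    have hout : ∀ y ∈ (_root_.mapAcc (g a) (s₀ a) (l a)).2, sz y ≤ M a := by
      have : ∀ l₁, l₁ <+: l a → ∀ y ∈ (_root_.mapAcc (g a) (s₀ a) l₁).2, sz y ≤ M a := by
        intro l₁
        induction l₁ using List.reverseRecOn with
        | nil => simp [_root_.mapAcc]
        | append_singleton l₁ x ih =>
          rintro ⟨l₂, h⟩ y hy
          rw [List.append_assoc] at h
          rw [mapAcc_append_singleton] at hy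
          rcases List.mem_append.1 hy with hy | hy
          · exact ih ⟨_, h⟩ y hy
          · obtain ⟨h₁, h₂⟩ := hstep a l₁ x l₂ h.symm
            have hle : B a + sz ((a, (_root_.mapAcc (g a) (s₀ a) l₁).1), x) + 2 ≤ Y a + 4 := by
              simp only [sz_pair, Y]
              omega
            have hd' := (hd ((a, (_root_.mapAcc (g a) (s₀ a) l₁).1), x)).trans
              (Nat.pow_le_pow_left hle d)
            simp only [List.mem_singleton] at hy
            subst hy
            simp only [sz_pair] at hd'
            simp only [M]
            omega
      exact this _ (List.prefix_refl _)
    have h₁ := sz_le_of_forall hout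
    rw [length_mapAcc] at h₁
    have h₂ := hb a (l a) (List.prefix_refl _)
    simp only [sz_pair]
    simp only [M, Y] at *
    omega
  exact hmid.fst.snd.pair hmid.snd

end PolyB

end

/-! ### Lists and unary numbers in polynomial time -/

section

variable {α β γ δ σ : Type} [Enc α] [Enc β] [Enc γ] [Enc δ] [Enc σ]

namespace PolyB

variable {B : α → ℕ}

theorem foldl {l : α → List β} {s₀ : α → σ} {g : α → σ → β → σ} (S : α → ℕ)
    (hl : PolyB B l) (hs : PolyB B s₀)
    (hg : PolyB (fun p : α × σ × β => B p.1) fun p => g p.1 p.2.1 p.2.2)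
    (hS : PolyBd (fun a => B a + sz a) S)
    (hb : ∀ a l₁, l₁ <+: l a → sz (l₁.foldl (g a) (s₀ a)) ≤ S a) :
    PolyB B fun a => (l a).foldl (g a) (s₀ a) := by
  have key : ∀ a (l₁ : List β), (_root_.mapAcc (fun s x => (g a s x, ())) (s₀ a) l₁).1 =
      l₁.foldl (g a) (s₀ a) := by
    intro a l₁
    generalize s₀ a = s
    induction l₁ generalizing s with
    | nil => rfl
    | cons x l ih => exact ih _
  have := (mapAcc (g := fun a s x => (g a s x, ())) S hl hs (hg.pair (const ())) hS
    fun a l₁ h => by rw [key]; exact hb a l₁ h).fst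
  exact this.congr_enc fun a => by rw [key]

theorem map {l : α → List β} {f : α → β → γ} (hl : PolyB B l)
    (hf : PolyB (fun p : α × β => B p.1) fun p => f p.1 p.2) :
    PolyB B fun a => (l a).map (f a) := by
  have key : ∀ a (l₁ : List β), (_root_.mapAcc (fun (_ : Unit) x => ((), f a x)) () l₁).2 =
      l₁.map (f a) := by
    intro a l₁
    induction l₁ with
    | nil => rfl
    | cons x l ih => exact congrArg _ ih
  have h₁ : PolyB (fun p : α × Unit × β => B p.1) fun p => f p.1 p.2.2 :=
    hf.comp' (f := fun p : α × Unit × β => (p.1, p.2.2)) (id.fst.pair id.snd.snd)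
      (PolyBd.of_le fun p => by simp)
  have := (mapAcc (g := fun a (_ : Unit) x => ((), f a x)) (fun _ => 1) hl (const ())
    ((const ()).pair h₁) (PolyBd.const _ _) fun a l₁ h => le_refl _).snd
  exact this.congr_enc fun a => by rw [key]

theorem reverseOnto {l l' : α → List β} (hl : PolyB B l) (hl' : PolyB B l') :
    PolyB B fun a => (l a).reverse ++ l' a := by
  have key : ∀ l₁ l₂ : List β, l₁.foldl (fun s x => x :: s) l₂ = l₁.reverse ++ l₂ := by
    intro l₁
    induction l₁ with
    | nil => intro; rfl
    | cons x l ih => intro l₂; simp [ih]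
  have hsz : ∀ l₁ l₂ : List β, sz (l₁.foldl (fun s x => x :: s) l₂) + 1 = sz l₁ + sz l₂ := by
    intro l₁
    induction l₁ with
    | nil => intro; simp; omega
    | cons x l ih =>
      intro l₂
      rw [List.foldl_cons, ih]
      simp
      omega
  refine (foldl (g := fun _ s x => x :: s) (fun a => sz (l a) + sz (l' a)) hl hl'
    (id.snd.snd.cons id.snd.fst) (hl.bd.add hl'.bd) fun a l₁ h => ?_).congr_enc fun a => by rw [key]
  obtain ⟨l₂, h⟩ := h
  have h₁ := hsz l₁ (l' a)
  have h₂ := hsz (l a) (l' a)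
  have h₃ := hsz l₂ (l₁.foldl (fun s x => x :: s) (l' a))
  rw [← List.foldl_append, h] at h₃
  have := sz_pos l₂
  have := sz_pos (l' a)
  have := sz_pos (l a)
  omega

theorem reverse {l : α → List β} (hl : PolyB B l) : PolyB B fun a => (l a).reverse :=
  (hl.reverseOnto (const [])).congr_enc fun a => by rw [List.append_nil]

theorem append {l l' : α → List β} (hl : PolyB B l) (hl' : PolyB B l') :
    PolyB B fun a => l a ++ l' a :=
  (hl.reverse.reverseOnto hl').congr_enc fun a => by rw [List.reverse_reverse]

theorem foldr {l : α → List β} {s₀ : α → σ} {g : α → β → σ → σ} (S : α → ℕ)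
    (hl : PolyB B l) (hs : PolyB B s₀)
    (hg : PolyB (fun p : α × β × σ => B p.1) fun p => g p.1 p.2.1 p.2.2)
    (hS : PolyBd (fun a => B a + sz a) S)
    (hb : ∀ a l₁, l₁ <:+ l a → sz (l₁.foldr (g a) (s₀ a)) ≤ S a) :
    PolyB B fun a => (l a).foldr (g a) (s₀ a) := by
  have h₁ : PolyB (fun p : α × σ × β => B p.1) fun p => g p.1 p.2.2 p.2.1 :=
    hg.comp' (f := fun p : α × σ × β => (p.1, p.2.2, p.2.1)) (id.fst.pair (id.snd.snd.pair id.snd.fst))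
      (PolyBd.of_le fun p => by simp)
  refine (foldl (g := fun a s x => g a x s) S hl.reverse hs h₁ hS fun a l₁ h => ?_).congr_enc
    fun a => by rw [List.foldl_reverse]
  have := hb a l₁.reverse (by rw [← List.reverse_prefix, List.reverse_reverse]; exact h)
  rwa [List.foldr_reverse] at this

theorem sz_append (l l' : List β) : sz (l ++ l') + 1 = sz l + sz l' := by
  induction l with
  | nil => simp; omega
  | cons x l ih =>
    rw [List.cons_append, sz_cons, sz_cons]
    omega

theorem sz_flatten_le (L : List (List β)) : sz L.flatten ≤ sz L := by
  induction L with
  | nil => simp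
  | cons l L ih =>
    have := sz_append l L.flatten
    rw [List.flatten_cons, sz_cons]
    omega

theorem sz_le_of_suffix {l l' : List β} (h : l <:+ l') : sz l ≤ sz l' := by
  obtain ⟨t, rfl⟩ := h
  have := sz_append t l
  have := sz_pos t
  omega

theorem flatten {l : α → List (List β)} (hl : PolyB B l) : PolyB B fun a => (l a).flatten :=
  (foldr (g := fun _ x s => x ++ s) (s₀ := fun _ => []) (fun a => sz (l a)) hl (const [])
    (id.snd.fst.append id.snd.snd) hl.bd fun a l₁ h => by
      have : l₁.foldr (fun x s => x ++ s) [] = l₁.flatten := by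
        induction l₁ with
        | nil => rfl
        | cons x l ih => rw [List.foldr_cons, ih ((List.suffix_cons _ _).trans h)]; rfl
      rw [this]
      exact (sz_flatten_le l₁).trans (sz_le_of_suffix h)).congr_enc fun a => by
    have : ∀ l₁ : List (List β), l₁.foldr (fun x s => x ++ s) [] = l₁.flatten := by
      intro l₁
      induction l₁ with
      | nil => rfl
      | cons x l ih => rw [List.foldr_cons, ih]; rfl
    rw [this]

theorem flatMap {l : α → List β} {f : α → β → List γ} (hl : PolyB B l)
    (hf : PolyB (fun p : α × β => B p.1) fun p => f p.1 p.2) :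
    PolyB B fun a => (l a).flatMap (f a) :=
  (hl.map hf).flatten.congr_enc fun a => by rw [List.flatMap_def]

theorem filter {l : α → List β} {f : α → β → Bool} (hl : PolyB B l)
    (hf : PolyB (fun p : α × β => B p.1) fun p => f p.1 p.2) :
    PolyB B fun a => (l a).filter (f a) := by
  refine (hl.flatMap (f := fun a x => if f a x = true then [x] else [])
    (hf.ite (id.snd.cons (const [])) (const []))).congr_enc fun a => ?_
  congr 1
  induction l a with
  | nil => rfl
  | cons x l ih =>
    rw [List.filter_cons, List.flatMap_cons, ← ih]
    split <;> rfl

theorem sz_bool_le (b : Bool) : sz b ≤ 3 := by cases b <;> decide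

theorem any {l : α → List β} {f : α → β → Bool} (hl : PolyB B l)
    (hf : PolyB (fun p : α × β => B p.1) fun p => f p.1 p.2) :
    PolyB B fun a => (l a).any (f a) :=
  (hl.filter hf).isEmpty.not.congr_enc fun a => by
    congr 1
    rw [Bool.eq_iff_iff]
    simp

theorem all {l : α → List β} {f : α → β → Bool} (hl : PolyB B l)
    (hf : PolyB (fun p : α × β => B p.1) fun p => f p.1 p.2) :
    PolyB B fun a => (l a).all (f a) :=
  (hl.any (f := fun a x => !f a x) hf.not).not.congr_enc fun a => by
    congr 1
    rw [Bool.eq_iff_iff]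
    simp

/-! Natural numbers are written in unary. -/

theorem units {f : α → ℕ} (hf : PolyB B f) : PolyB B fun a => List.replicate (f a) () :=
  hf.congr_enc fun _ => rfl

theorem of_units {f : α → ℕ} (hf : PolyB B fun a => List.replicate (f a) ()) : PolyB B f :=
  hf.congr_enc fun _ => rfl

theorem enc_nat (n : ℕ) : enc n = enc (List.replicate n ()) := rfl

theorem sz_nat (n : ℕ) : sz n = 2 * n + 1 := by
  rw [sz, enc_nat]
  induction n with
  | zero => rfl
  | succ n ih =>
    rw [List.replicate_succ, enc_cons, V.size_cons, ih]
    change 1 + _ + 1 = _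
    omega

theorem length {l : α → List β} (hl : PolyB B l) : PolyB B fun a => (l a).length :=
  of_units ((hl.map (const ())).congr_enc fun a => by rw [List.map_const'])

theorem add {f g : α → ℕ} (hf : PolyB B f) (hg : PolyB B g) : PolyB B fun a => f a + g a :=
  of_units ((hf.units.append hg.units).congr_enc fun a => by rw [List.replicate_add])

theorem replicate {f : α → ℕ} {g : α → β} (hf : PolyB B f) (hg : PolyB B g) :
    PolyB B fun a => List.replicate (f a) (g a) :=
  (hf.units.map (f := fun a _ => g a) (hg.comp' id.fst (PolyBd.of_le fun p => by simp))).congr_enc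
    fun a => by rw [List.map_replicate]

theorem mul {f g : α → ℕ} (hf : PolyB B f) (hg : PolyB B g) : PolyB B fun a => f a * g a :=
  (hf.replicate hg.units).flatten.length.congr_enc fun a => by simp

theorem range {f : α → ℕ} (hf : PolyB B f) : PolyB B fun a => List.range (f a) := by
  have key : ∀ n s, _root_.mapAcc (fun s (_ : Unit) => (s + 1, s)) s (List.replicate n ()) =
      (s + n, List.range' s n) := by
    intro n
    induction n with
    | zero => intro; rfl
    | succ n ih =>
      intro s
      rw [List.replicate_succ, _root_.mapAcc, ih, List.range'_succ]
      simp only [Prod.mk.injEq, and_true]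
      omega
  refine (mapAcc (g := fun _ s (_ : Unit) => (s + 1, s)) (s₀ := fun _ => 0)
    (fun a => sz (f a)) hf.units (const 0)
    ((id.snd.fst.add (const 1)).pair id.snd.fst) hf.bd fun a l₁ h => ?_).snd.congr_enc fun a => ?_
  · have h₁ : l₁ = List.replicate l₁.length () := by rw [List.eq_replicate_iff]; simp
    rw [h₁, key]
    have := h.length_le
    rw [List.length_replicate] at this
    rw [sz_nat, sz_nat]
    omega
  · rw [key, List.range_eq_range']

theorem drop {l : α → List β} {n : α → ℕ} (hl : PolyB B l) (hn : PolyB B n) :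
    PolyB B fun a => (l a).drop (n a) := by
  have key : ∀ n (l : List β), (List.replicate n ()).foldl (fun l _ => l.tail) l = l.drop n := by
    intro n
    induction n with
    | zero => intro; rfl
    | succ n ih => intro l; rw [List.replicate_succ, List.foldl_cons, ih, List.drop_tail]
  refine (foldl (g := fun _ s (_ : Unit) => s.tail) (fun a => sz (l a)) hn.units hl
    (id.snd.fst.tail) hl.bd fun a l₁ h => ?_).congr_enc fun a => by rw [key]
  have h₁ : l₁ = List.replicate l₁.length () := by rw [List.eq_replicate_iff]; simp
  rw [h₁, key]
  exact sz_le_of_suffix (List.drop_suffix _ _)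

theorem getD {l : α → List β} {n : α → ℕ} {d : α → β} (hl : PolyB B l) (hn : PolyB B n)
    (hd : PolyB B d) : PolyB B fun a => (l a).getD (n a) (d a) :=
  ((hl.drop hn).headD hd).congr_enc fun a => by
    rw [List.headD_eq_head?_getD, List.head?_drop, List.getD_eq_getElem?_getD]

theorem take {l : α → List β} {n : α → ℕ} (hl : PolyB B l) (hn : PolyB B n) :
    PolyB B fun a => (l a).take (n a) := by
  -- The first `n` elements remain if the reversed list loses as many elements as `drop n` would
  -- leave.
  have h := (hl.reverse.drop (hl.drop hn).length).reverse
  refine h.congr_enc fun a => ?_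
  rw [List.drop_reverse, List.reverse_reverse, List.length_drop]
  congr 1
  rw [List.take_eq_take_iff]
  omega

theorem lt {f g : α → ℕ} (hf : PolyB B f) (hg : PolyB B g) :
    PolyB B fun a => decide (f a < g a) :=
  (hg.units.drop hf).isEmpty.not.congr_enc fun a => by
    congr 1
    rw [Bool.eq_iff_iff]
    simp [Nat.sub_eq_zero_iff_le]

theorem eq_nat {f g : α → ℕ} (hf : PolyB B f) (hg : PolyB B g) :
    PolyB B fun a => decide (f a = g a) :=
  ((hf.lt hg).or (hg.lt hf)).not.congr_enc fun a => by
    congr 1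
    rw [Bool.eq_iff_iff]
    simp
    omega

end PolyB

/-! ### Equality, membership and indices -/

/-- Equality is decided in polynomial time. -/
class PolyEq (α : Type) [Enc α] [DecidableEq α] : Prop where
  poly : PolyT fun p : α × α => decide (p.1 = p.2)

instance : PolyEq ℕ := ⟨PolyB.id.fst.eq_nat PolyB.id.snd⟩

theorem PolyB.eq {B : α → ℕ} [DecidableEq β] [PolyEq β] {f g : α → β} (hf : PolyB B f)
    (hg : PolyB B g) : PolyB B fun a => decide (f a = g a) :=
  PolyEq.poly.comp (hf.pair hg)

instance : PolyEq Bool := ⟨by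
  refine ((PolyB.id.fst.ite PolyB.id.snd PolyB.id.snd.not)).congr_enc fun p => ?_
  rcases p with ⟨_ | _, _ | _⟩ <;> rfl⟩

instance [DecidableEq α] [DecidableEq β] [PolyEq α] [PolyEq β] : PolyEq (α × β) := ⟨by
  refine ((PolyB.id.fst.fst.eq PolyB.id.snd.fst).and
    (PolyB.id.fst.snd.eq PolyB.id.snd.snd)).congr_enc fun p => ?_
  congr 1
  rw [Bool.eq_iff_iff]
  simp [Prod.ext_iff]⟩

instance [DecidableEq α] [PolyEq α] : PolyEq (List α) := ⟨by
  -- One pass over the first list, with the unread part of the second in the state. Equality also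
  -- requires that nothing of the second list is left at the end. The default of `headD` is harmless
  -- because emptiness is tested first.
  let g : Bool × List α → α → Bool × List α := fun s x =>
    (s.1 && (!s.2.isEmpty && decide (x = s.2.headD x)), s.2.tail)
  have key : ∀ (l r : List α) (b : Bool), (l.foldl g (b, r)).2 = r.drop l.length ∧
      ((l.foldl g (b, r)).1 && (l.foldl g (b, r)).2.isEmpty) = (b && decide (l = r)) := by
    intro l
    induction l with
    | nil => intro r b; cases r <;> simp
    | cons x l ih =>
      intro r b
      rw [List.foldl_cons, (ih _ _).2, (ih _ _).1]
      cases r with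
      | nil => simp
      | cons y r =>
        rw [Bool.eq_iff_iff]
        simp only [List.length_cons, List.drop_succ_cons, List.tail_cons, List.isEmpty_cons,
          Bool.not_false, List.headD_cons, Bool.true_and, Bool.and_eq_true, List.cons.injEq, and_assoc,
          true_and, decide_eq_true_iff]
        exact and_congr_right fun _ => and_congr decide_eq_true_iff decide_eq_true_iff
  have h : PolyT fun p : List α × List α => p.1.foldl g (true, p.2) := by
    refine PolyB.foldl (g := fun _ => g) (fun p => sz p.2 + 4) PolyB.id.fst
      ((PolyB.const true).pair PolyB.id.snd) ?_
      (((PolyB.id.snd.bd.mono fun _ => le_rfl)).add (PolyBd.const _ 4)) fun p l _ => ?_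
    · have hs : PolyB (fun _ => 0) fun p : (List α × List α) × (Bool × List α) × α => p.2.1.2 :=
        PolyB.id.snd.fst.snd
      have hx : PolyB (fun _ => 0) fun p : (List α × List α) × (Bool × List α) × α => p.2.2 :=
        PolyB.id.snd.snd
      exact (PolyB.id.snd.fst.fst.and (hs.isEmpty.not.and (hx.eq (hs.headD hx)))).pair hs.tail
    · rw [sz_prod, (key _ _ _).1]
      have := PolyB.sz_bool_le (l.foldl g (true, p.2)).1
      have := PolyB.sz_le_of_suffix (List.drop_suffix l.length p.2)
      omega
  exact (h.fst.and h.snd.isEmpty).congr_enc fun p => by rw [(key _ _ _).2, Bool.true_and]⟩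

namespace PolyB

variable {B : α → ℕ}

theorem contains [DecidableEq β] [PolyEq β] {l : α → List β} {x : α → β} (hl : PolyB B l)
    (hx : PolyB B x) : PolyB B fun a => decide (x a ∈ l a) :=
  (hl.any (f := fun a y => decide (x a = y)) ((hx.comp' id.fst (PolyBd.of_le fun p => by simp)).eq
    id.snd)).congr_enc fun a => by
    congr 1
    rw [Bool.eq_iff_iff]
    simp

theorem idxOf [BEq β] [LawfulBEq β] [DecidableEq β] [PolyEq β] {l : α → List β} {x : α → β} (hl : PolyB B l)
    (hx : PolyB B x) : PolyB B fun a => (l a).idxOf (x a) := by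
  have key : ∀ (x : β) (l : List β), l.foldr (fun y n => if decide (y = x) = true then 0 else n + 1) 0 =
      l.idxOf x := by
    intro x l
    induction l with
    | nil => rfl
    | cons y l ih =>
      rw [List.foldr_cons, ih, List.idxOf_cons]
      by_cases h : y = x
      · simp [h]
      · simp [h, beq_eq_false_iff_ne.2 h]
  refine (foldr (g := fun a y n => if decide (y = x a) = true then 0 else n + 1) (s₀ := fun _ => 0)
    (fun a => 2 * sz (l a) + 1) hl (const 0) (ite (id.snd.fst.eq
      (hx.comp' id.fst (PolyBd.of_le fun p => by simp)))
    (const 0) (id.snd.snd.add (const 1))) (((PolyBd.const _ 2).mul hl.bd).add (PolyBd.const _ 1))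
    fun a l₁ h => ?_).congr_enc fun a => by rw [key]
  rw [key, sz_nat]
  have := List.idxOf_le_length (a := x a) (l := l₁)
  have := h.length_le
  have := length_lt_sz (l a)
  omega

end PolyB

end

/-! ### Counting the functions computed by a nondeterministic family of automata -/

/-- All lists of a given length with entries from `l`. -/
def allLists {α : Type} (l : List α) : ℕ → List (List α)
  | 0 => [[]]
  | n + 1 => l.flatMap fun x => (allLists l n).map fun t => x :: t

theorem mem_allLists {α : Type} {l : List α} {n : ℕ} {t : List α} :
    t ∈ allLists l n ↔ t.length = n ∧ ∀ x ∈ t, x ∈ l := by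
  induction n generalizing t with
  | zero => simp +contextual [allLists]
  | succ n ih =>
    cases t with
    | nil => simp [allLists]
    | cons x t => simp [allLists, ih]; tauto

theorem nodup_allLists {α : Type} {l : List α} (hl : l.Nodup) (n : ℕ) : (allLists l n).Nodup := by
  induction n with
  | zero => simp [allLists]
  | succ n ih =>
    rw [allLists, List.nodup_flatMap]
    refine ⟨fun x _ => ih.map fun _ _ h => by simpa using h, hl.imp fun h => ?_⟩
    simp only [Function.onFun, List.disjoint_left, List.mem_map, not_exists, not_and]
    rintro _ ⟨t, _, rfl⟩ t' _ h'
    exact h (List.cons.inj h').1.symm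

theorem length_allLists {α : Type} (l : List α) (n : ℕ) :
    (allLists l n).length = l.length ^ n := by
  induction n with
  | zero => rfl
  | succ n ih => simp [allLists, List.length_flatMap, ih, pow_succ, mul_comm]

/-! ### Restricted growth sequences -/

/-- Scan a list of numbers for restricted growth: whether each entry is at most the number of
distinct previous ones, which are then an initial segment, and the number of distinct entries. -/
def growth (l : List ℕ) : Bool × ℕ :=
  l.foldl (fun s c => (s.1 && !decide (s.2 < c), if decide (c < s.2) = true then s.2 else s.2 + 1))
    (true, 0)

theorem growth_append_singleton (l : List ℕ) (c : ℕ) :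
    growth (l ++ [c]) = ((growth l).1 && !decide ((growth l).2 < c),
      if decide (c < (growth l).2) = true then (growth l).2 else (growth l).2 + 1) := by
  simp [growth]

theorem growth_append_fst {l l' : List ℕ} (h : (growth (l ++ l')).1 = true) : (growth l).1 = true := by
  induction l' using List.reverseRecOn with
  | nil => simpa using h
  | append_singleton l' c ih =>
    rw [← List.append_assoc, growth_append_singleton] at h
    exact ih (by simp at h; exact h.1)

/-- An entry either repeats a value below the counter or equals the counter and raises it, so the
values that occur always form an initial segment. -/
theorem mem_iff_lt_growth {l : List ℕ} (h : (growth l).1 = true) (c : ℕ) :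
    c ∈ l ↔ c < (growth l).2 := by
  induction l using List.reverseRecOn with
  | nil => simp [growth]
  | append_singleton l x ih =>
    rw [growth_append_singleton] at h ⊢
    simp only [Bool.and_eq_true, Bool.not_eq_true', decide_eq_false_iff_not, not_lt] at h
    simp only [List.mem_append, List.mem_singleton, ih h.1, decide_eq_true_eq]
    split <;> omega

/-- The list of distinct entries, in the order of their first occurrences. -/
def firsts {α : Type} [DecidableEq α] (l : List α) : List α :=
  l.foldl (fun d x => if x ∈ d then d else d ++ [x]) []

theorem firsts_append_singleton {α : Type} [DecidableEq α] (l : List α) (x : α) :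
    firsts (l ++ [x]) = if x ∈ firsts l then firsts l else firsts l ++ [x] := by
  rw [firsts, List.foldl_append]
  rfl

theorem mem_firsts {α : Type} [DecidableEq α] {l : List α} {x : α} : x ∈ firsts l ↔ x ∈ l := by
  induction l using List.reverseRecOn with
  | nil => simp [firsts]
  | append_singleton l y ih =>
    rw [firsts_append_singleton]
    split_ifs with h
    · rw [List.mem_append, List.mem_singleton, ih]
      constructor
      · exact Or.inl
      · rintro (h' | rfl)
        exacts [h', ih.1 h]
    · simp [ih]

theorem nodup_firsts {α : Type} [DecidableEq α] (l : List α) : (firsts l).Nodup := by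
  induction l using List.reverseRecOn with
  | nil => simp [firsts]
  | append_singleton l y ih =>
    rw [firsts_append_singleton]
    split_ifs with h
    · exact ih
    · rw [List.nodup_append]
      exact ⟨ih, by simp, by rintro a ha b hb rfl; simp at hb; exact h (hb ▸ ha)⟩

/-- An old entry has an index below the number of distinct entries so far, a new one has exactly
that number as index, and indices already assigned do not change when the list grows. -/
theorem growth_map_idxOf {α : Type} [DecidableEq α] (l : List α) :
    growth (l.map (firsts l).idxOf) = (true, (firsts l).length) := by
  induction l using List.reverseRecOn with
  | nil => rfl
  | append_singleton l x ih =>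
    have h : l.map (firsts (l ++ [x])).idxOf = l.map (firsts l).idxOf := by
      refine List.map_congr_left fun y hy => ?_
      rw [firsts_append_singleton]
      split_ifs
      · rfl
      · rw [List.idxOf_append_of_mem (mem_firsts.2 hy)]
    rw [List.map_append, h, List.map_singleton, growth_append_singleton, ih, firsts_append_singleton]
    split_ifs with h₁ h₂ h₂
    · have := List.idxOf_lt_length_of_mem h₁
      simp; omega
    · have := List.idxOf_lt_length_of_mem h₁
      simp at h₂; omega
    · rw [List.idxOf_append_of_notMem h₁] at h₂
      simp at h₂
    · rw [List.idxOf_append_of_notMem h₁]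
      simp

/-- A list determines its restricted growth pattern and its list of distinct entries. -/
theorem eq_of_growth {α : Type} {κ κ' : List ℕ} {d d' : List α} {z : α}
    (hκ : (growth κ).1 = true) (hκ' : (growth κ').1 = true)
    (hd : d.Nodup) (hd' : d'.Nodup) (hn : d.length = (growth κ).2) (hn' : d'.length = (growth κ').2)
    (h : κ.map (fun c => d.getD c z) = κ'.map (fun c => d'.getD c z)) : κ = κ' ∧ d = d' := by
  have hlen : κ.length = κ'.length := by simpa using congrArg List.length h
  have inj : ∀ {d : List α}, d.Nodup → ∀ {a b}, a < d.length → b < d.length →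
      d.getD a z = d.getD b z → a = b := by
    intro d hd a b ha hb hab
    rw [List.getD_eq_getElem _ _ ha, List.getD_eq_getElem _ _ hb] at hab
    exact (hd.getElem_inj_iff).1 hab
  -- Induction by removal of the last entry. It is either an old class, on which `d` and `d'` agree
  -- by the equality of the shorter lists, or the next new class. In the mixed cases injectivity of
  -- `d` or `d'` gives equality, and two new classes have the same number.
  have key : ∀ n (κ κ' : List ℕ), κ.length = n → κ'.length = n → (growth κ).1 = true →
      (growth κ').1 = true → (growth κ).2 ≤ d.length → (growth κ').2 ≤ d'.length →
      κ.map (fun c => d.getD c z) = κ'.map (fun c => d'.getD c z) → κ = κ' := by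
    intro n
    induction n with
    | zero =>
      intro κ κ' h h' _ _ _ _ _
      rw [List.length_eq_zero_iff] at h h'
      rw [h, h']
    | succ n ih =>
      intro κ₁ κ₁' hl hl' hg hg' hm hm' hmap
      obtain ⟨κ, c, rfl⟩ : ∃ κ c, κ₁ = κ ++ [c] := by
        rw [← List.dropLast_append_getLast (l := κ₁) (by rintro rfl; simp at hl)]
        exact ⟨_, _, rfl⟩
      obtain ⟨κ', c', rfl⟩ : ∃ κ c, κ₁' = κ ++ [c] := by
        rw [← List.dropLast_append_getLast (l := κ₁') (by rintro rfl; simp at hl')]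
        exact ⟨_, _, rfl⟩
      simp only [List.length_append, List.length_singleton, add_left_inj] at hl hl'
      have hgκ := growth_append_fst hg
      have hgκ' := growth_append_fst hg'
      have hc := (mem_iff_lt_growth hg c).1 (by simp)
      have hc' := (mem_iff_lt_growth hg' c').1 (by simp)
      have hsub : (growth κ).2 ≤ (growth (κ ++ [c])).2 := by
        rw [growth_append_singleton]; dsimp only; split <;> omega
      have hsub' : (growth κ').2 ≤ (growth (κ' ++ [c'])).2 := by
        rw [growth_append_singleton]; dsimp only; split <;> omega
      rw [List.map_append, List.map_append] at hmap
      obtain ⟨h₁, h₂⟩ := List.append_inj hmap (by simp [hl, hl'])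
      have e := ih κ κ' hl hl' hgκ hgκ' (by omega) (by omega) h₁
      subst e
      simp only [List.map_cons, List.map_nil, List.cons.injEq, and_true] at h₂
      have hle : c ≤ (growth κ).2 := by
        rw [growth_append_singleton] at hg; simp at hg; omega
      have hle' : c' ≤ (growth κ).2 := by
        rw [growth_append_singleton] at hg'; simp at hg'; omega
      have hval : ∀ x ∈ κ, d.getD x z = d'.getD x z := List.map_inj_left.1 h₁
      have : c = c' := by
        rcases lt_or_ge c (growth κ).2 with hlt | hge
        · have := hval c ((mem_iff_lt_growth hgκ c).2 hlt)
          exact inj hd' (by omega) (by omega) (this.symm.trans h₂)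
        · rcases lt_or_ge c' (growth κ).2 with hlt' | hge'
          · have := hval c' ((mem_iff_lt_growth hgκ c').2 hlt')
            exact inj hd (by omega) (by omega) (h₂.trans this.symm)
          · omega
      rw [this]
  have e := key _ κ κ' rfl hlen.symm hκ hκ' hn.ge hn'.ge h
  subst e
  refine ⟨rfl, List.ext_getElem (hn.trans hn'.symm) fun i hi hi' => ?_⟩
  have := List.map_inj_left.1 h i ((mem_iff_lt_growth hκ i).2 (by omega))
  rwa [List.getD_eq_getElem _ _ hi, List.getD_eq_getElem _ _ hi'] at this

/-! ### Words of transformations, canonical layers and tuples of functions -/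

section

variable {β : Type} (δ : β → ℕ → ℕ → ℕ) (m W : ℕ)

/-- The state that `δ` reaches from `i` when it reads `s` with the diagram `D`. -/
def runFrom : List β → ℕ → List ℕ → ℕ
  | b :: D, i, a :: s => runFrom D (δ b i a) s
  | _, i, _ => i

/-- The function computed by `D` from the state `i`. -/
def valFn (acc : ℕ → Bool) (D : List β) (i : ℕ) {j : ℕ} (s : Fin j → Fin m) : Bool :=
  acc (runFrom δ D i (List.ofFn fun x => (s x : ℕ)))

/-- The diagram `D` labels a path from `q` to `q'`. -/
def IsPath (T : List (ℕ × β × ℕ)) : ℕ → List β → ℕ → Prop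
  | q, [], q' => q = q'
  | q, b :: D, q' => ∃ r, (q, b, r) ∈ T ∧ IsPath T r D q'

/-- The assignment `ρ'` of classes to states after the layer `b` is compatible with the assignment
`ρ` before it and with the canonical layer `κ`; classes that are at least `N` are void. -/
def compatible (N : ℕ) (b : β) (κ : List (List ℕ)) (ρ ρ' : List ℕ) : Bool :=
  (List.range W).all fun i => !decide (ρ.getD i 0 < N) ||
    (List.range m).all fun a => decide (ρ'.getD (δ b i a) 0 = (κ.getD (ρ.getD i 0) []).getD a 0)

/-- All pairs of a state and an assignment. -/
def pairs (n W : ℕ) : List (ℕ × List ℕ) :=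
  (List.range n).flatMap fun q => (allLists (List.range (W + 1)) W).map fun ρ => (q, ρ)

/-- A subset construction: layer and path are guessed, whereas `κ` is determined by the tuple of
functions. Keeping all compatible guesses prevents a function from being counted once for each
diagram that computes it. -/
def nextPairs (T : List (ℕ × β × ℕ)) (P : List (ℕ × List ℕ)) (N : ℕ) (X : List (ℕ × List ℕ))
    (κ : List (List ℕ)) : List (ℕ × List ℕ) :=
  P.filter fun y => X.any fun x => T.any fun t =>
    decide (t.1 = x.1) && (decide (t.2.2 = y.1) && compatible δ m W N t.2.1 κ x.2 y.2)

/-- The canonical layers from `N` states. -/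
def canonicalLayers (N : ℕ) : List (List (List ℕ)) :=
  (allLists (allLists (List.range W) m) N).filter fun κ =>
    -- Distinct rows make the described functions distinct; the growth condition fixes the numbering
    -- of the residuals, of which there may be at most `W`.
    decide κ.Nodup && ((growth κ.flatten).1 && !decide (W < (growth κ.flatten).2))

/-- The number of ways to choose distinct final values for `N` states. -/
def baseCount (acc : ℕ → Bool) (accQ : ℕ → Bool) (N : ℕ) (X : List (ℕ × List ℕ)) : ℕ :=
  -- These are all lists of distinct Booleans.
  ([[], [true], [false], [true, false], [false, true]].filter fun h : List Bool =>
    decide (h.length = N) && X.any fun x => accQ x.1 &&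
      (List.range W).all fun i => !decide (x.2.getD i 0 < N) ||
        decide (h.getD (x.2.getD i 0) false = acc i)).length

/-- The restrictions of the members of `S` to words with a given first letter. -/
def residuals {j : ℕ} (S : Set ((Fin (j + 1) → Fin m) → Bool)) : Set ((Fin j → Fin m) → Bool) :=
  {g | ∃ f ∈ S, ∃ a, g = fun s => f (Fin.cons a s)}

/-- The iterated residuals form sets with at most `W` members. -/
def Narrow : (j : ℕ) → Set ((Fin j → Fin m) → Bool) → Prop
  | 0, _ => True
  | j + 1, S => (residuals m S).ncard ≤ W ∧ Narrow j (residuals m S)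

/-- The tuples of `N` distinct functions that are compatible with a pair in `X`. -/
def tuples (acc accQ : ℕ → Bool) (T : List (ℕ × β × ℕ)) (N : ℕ) (X : List (ℕ × List ℕ)) (j : ℕ) :
    Set (List ((Fin j → Fin m) → Bool)) :=
  -- The assignment need not name every member of `h`, so nothing else would keep the number of
  -- residuals within `W`. For members computed by one diagram this is automatic, by
  -- `narrow_of_valFn`.
  {h | h.length = N ∧ h.Nodup ∧ Narrow m W j {f | f ∈ h} ∧ ∃ x ∈ X, ∃ D q, D.length = j ∧
    IsPath T x.1 D q ∧ accQ q = true ∧ ∀ i < W, x.2.getD i 0 < N →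
      h.getD (x.2.getD i 0) (fun _ => false) = valFn δ m acc D i}

variable {δ m W}

theorem valFn_cons (acc : ℕ → Bool) (b : β) (D : List β) (i : ℕ) {j : ℕ} (a : Fin m)
    (s : Fin j → Fin m) :
    valFn δ m acc (b :: D) i (Fin.cons a s : Fin (j + 1) → Fin m) =
      valFn δ m acc D (δ b i a) s := by
  simp [valFn, runFrom, List.ofFn_succ]

/-- A residual of a function computed by `b :: D` is computed by `D` from one of the `W` states. -/
theorem narrow_of_valFn (hδ : ∀ b i a, i < W → a < m → δ b i a < W) (acc : ℕ → Bool) {j : ℕ}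
    {D : List β} (hD : D.length = j) {S : Set ((Fin j → Fin m) → Bool)}
    (hS : ∀ f ∈ S, ∃ i < W, f = valFn δ m acc D i) : Narrow m W j S := by
  induction j generalizing D with
  | zero => trivial
  | succ j ih =>
    obtain ⟨b, D, rfl⟩ : ∃ b D', D = b :: D' := by
      cases D with
      | nil => simp at hD
      | cons b D => exact ⟨_, _, rfl⟩
    have h : ∀ g ∈ residuals m S, ∃ i < W, g = valFn δ m acc D i := by
      rintro _ ⟨f, hf, a, rfl⟩
      obtain ⟨i, hi, rfl⟩ := hS f hf
      exact ⟨_, hδ b i a hi a.2, funext fun s => valFn_cons _ _ _ _ _ _⟩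
    refine ⟨?_, ih (by simpa using hD) h⟩
    have hsub : residuals m S ⊆ (fun i => valFn δ m acc D i) '' (Finset.range W : Set ℕ) := by
      intro g hg
      obtain ⟨i, hi, rfl⟩ := h g hg
      exact ⟨i, by simpa using hi, rfl⟩
    calc (residuals m S).ncard ≤ _ := Set.ncard_le_ncard hsub ((Finset.finite_toSet _).image _)
      _ ≤ _ := Set.ncard_image_le (Finset.finite_toSet _)
      _ = W := by rw [Set.ncard_coe_finset, Finset.card_range]

/-- The tuple of functions that is described by a canonical layer and the tuple after it. -/
def combine {j : ℕ} (κ : List (List ℕ)) (d : List ((Fin j → Fin m) → Bool)) :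
    List ((Fin (j + 1) → Fin m) → Bool) :=
  κ.map fun r s => d.getD (r.getD (s 0) 0) (fun _ => false) (Fin.tail s)

theorem mem_pairs {n : ℕ} {x : ℕ × List ℕ} :
    x ∈ pairs n W ↔ x.1 < n ∧ x.2.length = W ∧ ∀ c ∈ x.2, c ≤ W := by
  obtain ⟨q, ρ⟩ := x
  simp [pairs, mem_allLists]

theorem mem_canonicalLayers {N : ℕ} {κ : List (List ℕ)} : κ ∈ canonicalLayers m W N ↔
    (κ.length = N ∧ ∀ r ∈ κ, r.length = m ∧ ∀ c ∈ r, c < W) ∧ κ.Nodup ∧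
      (growth κ.flatten).1 = true ∧ (growth κ.flatten).2 ≤ W := by
  simp [canonicalLayers, mem_allLists]

theorem compatible_iff {N : ℕ} {b : β} {κ : List (List ℕ)} {ρ ρ' : List ℕ} :
    compatible δ m W N b κ ρ ρ' = true ↔ ∀ i < W, ρ.getD i 0 < N → ∀ a < m,
      ρ'.getD (δ b i a) 0 = (κ.getD (ρ.getD i 0) []).getD a 0 := by
  simp only [compatible, List.all_eq_true, List.mem_range, Bool.or_eq_true, Bool.not_eq_true',
    decide_eq_false_iff_not, decide_eq_true_eq]
  exact forall₂_congr fun i _ => by rw [← imp_iff_not_or]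

theorem mem_nextPairs {T : List (ℕ × β × ℕ)} {P : List (ℕ × List ℕ)} {N : ℕ}
    {X : List (ℕ × List ℕ)} {κ : List (List ℕ)} {y : ℕ × List ℕ} :
    y ∈ nextPairs δ m W T P N X κ ↔ y ∈ P ∧ ∃ x ∈ X, ∃ b, (x.1, b, y.1) ∈ T ∧
      compatible δ m W N b κ x.2 y.2 = true := by
  simp only [nextPairs, List.mem_filter, List.any_eq_true, Bool.and_eq_true, decide_eq_true_eq]
  refine and_congr_right fun _ => exists_congr fun x => and_congr_right fun _ => ?_
  constructor
  · rintro ⟨⟨p, b, q⟩, ht, rfl, rfl, h⟩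
    exact ⟨b, ht, h⟩
  · rintro ⟨b, ht, h⟩
    exact ⟨_, ht, rfl, rfl, h⟩

/-! ### The bijection and the recurrence -/

section recursion

variable {acc accQ : ℕ → Bool} {T : List (ℕ × β × ℕ)} {n N j : ℕ} {X : List (ℕ × List ℕ)}
  {κ κ' : List (List ℕ)} {d d' : List ((Fin j → Fin m) → Bool)}

theorem getD_injOn {α : Type} {d : List α} (hd : d.Nodup) {z : α} {a b : ℕ} (ha : a < d.length)
    (hb : b < d.length) (hab : d.getD a z = d.getD b z) : a = b := by
  rw [List.getD_eq_getElem _ _ ha, List.getD_eq_getElem _ _ hb] at hab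
  exact (hd.getElem_inj_iff).1 hab

/-- By the growth condition the entries of `κ` are exactly the positions in `d`: each member of `d`
is used, and no default value is. -/
theorem residuals_combine (hκ : ∀ r ∈ κ, r.length = m) (hg : (growth κ.flatten).1 = true)
    (hd : d.length = (growth κ.flatten).2) :
    residuals m {f | f ∈ combine κ d} = {f | f ∈ d} := by
  ext f
  simp only [residuals, combine, Set.mem_ofPred_eq, List.mem_map]
  constructor
  · rintro ⟨_, ⟨r, hr, rfl⟩, a, rfl⟩
    have ha : (a : ℕ) < r.length := by rw [hκ r hr]; exact a.2
    have hlt := (mem_iff_lt_growth hg r[(a : ℕ)]).1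
      (List.mem_flatten.2 ⟨r, hr, List.getElem_mem _⟩)
    simp only [Fin.cons_zero, Fin.tail_cons]
    rw [List.getD_eq_getElem _ _ ha, List.getD_eq_getElem _ _ (by omega)]
    exact List.getElem_mem _
  · intro hf
    obtain ⟨i, hi, rfl⟩ := List.mem_iff_getElem.1 hf
    obtain ⟨r, hr, hir⟩ := List.mem_flatten.1 ((mem_iff_lt_growth hg i).2 (by omega))
    obtain ⟨a, ha, rfl⟩ := List.mem_iff_getElem.1 hir
    refine ⟨_, ⟨r, hr, rfl⟩, ⟨a, by rw [← hκ r hr]; exact ha⟩, funext fun s => ?_⟩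
    simp only [Fin.cons_zero, Fin.tail_cons]
    rw [List.getD_eq_getElem _ _ ha, List.getD_eq_getElem _ _ hi]

/-- Words with first letter `a` test the `a`-th entries of the two rows. -/
theorem row_eq_of_combine {r r' : List ℕ} (hr : r.length = m) (hr' : r'.length = m)
    (h : (fun (s : Fin (j + 1) → Fin m) => d.getD (r.getD (s 0) 0) (fun _ => false) (Fin.tail s)) =
      fun s => d'.getD (r'.getD (s 0) 0) (fun _ => false) (Fin.tail s)) :
    r.map (fun c => d.getD c fun _ => false) = r'.map (fun c => d'.getD c fun _ => false) := by
  refine List.ext_getElem (by simp [hr, hr']) fun a ha ha' => ?_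
  rw [List.length_map] at ha ha'
  funext s
  have := congrFun h (Fin.cons ⟨a, hr ▸ ha⟩ s)
  simp only [Fin.cons_zero, Fin.tail_cons] at this
  rw [List.getD_eq_getElem _ _ ha, List.getD_eq_getElem _ _ ha'] at this
  simpa using this

/-- The residuals of the combined functions, listed row by row, are `κ.flatten` read through `d`.
From this list `eq_of_growth` recovers `κ.flatten` and `d`, and the rows are recovered because all
of them have length `m`. -/
theorem combine_injective (hκ : κ ∈ canonicalLayers m W N) (hκ' : κ' ∈ canonicalLayers m W N)
    (hd : d.Nodup) (hd' : d'.Nodup) (hn : d.length = (growth κ.flatten).2)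
    (hn' : d'.length = (growth κ'.flatten).2) (h : combine κ d = combine κ' d') :
    κ = κ' ∧ d = d' := by
  rw [mem_canonicalLayers] at hκ hκ'
  have hmap : κ.map (fun r => r.map fun c => d.getD c fun _ => false) =
      κ'.map (fun r => r.map fun c => d'.getD c fun _ => false) := by
    refine List.ext_getElem (by simp [hκ.1.1, hκ'.1.1]) fun a ha ha' => ?_
    rw [List.length_map] at ha ha'
    have : (combine κ d)[a]'(by simpa [combine] using ha) =
        (combine κ' d')[a]'(by simpa [combine] using ha') := by simp [h]
    simp only [combine, List.getElem_map] at this ⊢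
    exact row_eq_of_combine (hκ.1.2 _ (List.getElem_mem _)).1 (hκ'.1.2 _ (List.getElem_mem _)).1 this
  have hfl := congrArg List.flatten hmap
  rw [← List.map_flatten, ← List.map_flatten] at hfl
  obtain ⟨h₁, h₂⟩ := eq_of_growth hκ.2.2.1 hκ'.2.2.1 hd hd' hn hn' hfl
  refine ⟨?_, h₂⟩
  have hlen : κ.map List.length = κ'.map List.length := by
    rw [List.map_congr_left fun r hr => (hκ.1.2 r hr).1,
      List.map_congr_left fun r hr => (hκ'.1.2 r hr).1, List.map_const', List.map_const', hκ.1.1,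
      hκ'.1.1]
  exact List.eq_iff_flatten_eq.2 ⟨h₁, hlen⟩

/-- The path for `d` is prolonged by the layer `b` that puts its pair into `nextPairs`. For a named
state `i`, compatibility says that the class of `δ b i a` is the entry of `κ` for the letter `a`, so
the functions agree after each first letter. -/
theorem combine_mem (hδ : ∀ b i a, i < W → a < m → δ b i a < W) (hκ : κ ∈ canonicalLayers m W N)
    (hd : d ∈ tuples δ m W acc accQ T (growth κ.flatten).2
      (nextPairs δ m W T (pairs n W) N X κ) j) :
    combine κ d ∈ tuples δ m W acc accQ T N X (j + 1) := by
  rw [mem_canonicalLayers] at hκ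
  obtain ⟨⟨hlen, hrow⟩, hnd, hg, hN⟩ := hκ
  obtain ⟨hdl, hdn, hnar, y, hy, D, q, hD, hp, hq, hv⟩ := hd
  obtain ⟨_, x, hx, b, hb, hc⟩ := mem_nextPairs.1 hy
  rw [compatible_iff] at hc
  refine ⟨by simp [combine, hlen], ?_, ?_, x, hx, b :: D, q, by simp [hD], ⟨_, hb, hp⟩, hq, ?_⟩
  · refine List.Nodup.map_on (fun r hr r' hr' h => ?_) hnd
    have := row_eq_of_combine (hrow r hr).1 (hrow r' hr').1 h
    refine List.ext_getElem ((hrow r hr).1.trans (hrow r' hr').1.symm) fun a ha ha' => ?_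
    have e : (r.map (fun c => d.getD c fun _ => false))[a]'(by simpa using ha) =
        (r'.map (fun c => d.getD c fun _ => false))[a]'(by simpa using ha') := by simp only [this]
    simp only [List.getElem_map] at e
    refine getD_injOn hdn ?_ ?_ e
    · rw [hdl]
      exact (mem_iff_lt_growth hg _).1 (List.mem_flatten.2 ⟨r, hr, List.getElem_mem _⟩)
    · rw [hdl]
      exact (mem_iff_lt_growth hg _).1 (List.mem_flatten.2 ⟨r', hr', List.getElem_mem _⟩)
  · rw [Narrow, residuals_combine (fun r hr => (hrow r hr).1) hg hdl]
    refine ⟨?_, hnar⟩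
    have : {f | f ∈ d} = (d.toFinset : Set _) := by ext; simp
    rw [this, Set.ncard_coe_finset, List.toFinset_card_of_nodup hdn, hdl]
    exact hN
  · intro i hi hρ
    have hi' : x.2.getD i 0 < κ.length := by rw [hlen]; exact hρ
    have hi'' : x.2.getD i 0 < (combine κ d).length := by simpa [combine] using hi'
    rw [List.getD_eq_getElem _ _ hi'']
    simp only [combine, List.getElem_map]
    funext s
    obtain ⟨a, s, rfl⟩ : ∃ a s', s = Fin.cons a s' := ⟨s 0, Fin.tail s, (Fin.cons_self_tail s).symm⟩
    have h₁ := hc i hi hρ a a.2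
    rw [List.getD_eq_getElem κ _ hi'] at h₁
    rw [valFn_cons]
    simp only [Fin.cons_zero, Fin.tail_cons]
    rw [← h₁, hv _ (hδ b i a hi a.2)]
    -- The entries of `κ` are below the length of `d`, so the class of `δ b i a` is not void.
    rw [h₁]
    have hr := hrow _ (List.getElem_mem hi')
    have ha : (a : ℕ) < (κ[x.2.getD i 0]).length := by rw [hr.1]; exact a.2
    rw [List.getD_eq_getElem _ _ ha]
    exact (mem_iff_lt_growth hg _).1
      (List.mem_flatten.2 ⟨_, List.getElem_mem _, List.getElem_mem _⟩)

theorem getD_idxOf {α : Type} [DecidableEq α] {d : List α} {x z : α} (h : x ∈ d) :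
    d.getD (d.idxOf x) z = x := by
  rw [List.getD_eq_getElem _ _ (List.idxOf_lt_length_of_mem h)]
  exact List.getElem_idxOf _

/-- Here `d` lists the residuals by first occurrence, `κ` consists of their positions, and the new
assignment sends a state to the position of the function that the rest of the diagram computes from
it. -/
theorem exists_combine (hδ : ∀ b i a, i < W → a < m → δ b i a < W) (hT : ∀ t ∈ T, t.2.2 < n)
    {h : List ((Fin (j + 1) → Fin m) → Bool)} (hh : h ∈ tuples δ m W acc accQ T N X (j + 1)) :
    ∃ κ ∈ canonicalLayers m W N, ∃ d ∈ tuples δ m W acc accQ T (growth κ.flatten).2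
      (nextPairs δ m W T (pairs n W) N X κ) j, combine κ d = h := by
  obtain ⟨hlen, hnd, ⟨hcard, hnar⟩, x, hx, D, q, hD, hp, hq, hv⟩ := hh
  obtain ⟨b, D, rfl⟩ : ∃ b D', D = b :: D' := by
    cases D with
    | nil => simp at hD
    | cons b D => exact ⟨_, _, rfl⟩
  obtain ⟨r, hr, hp⟩ := hp
  let res : ((Fin (j + 1) → Fin m) → Bool) → Fin m → (Fin j → Fin m) → Bool :=
    fun f a s => f (Fin.cons a s)
  let L := h.map fun f => (List.finRange m).map (res f)
  let d := firsts L.flatten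
  let κ := L.map (List.map d.idxOf)
  have hmem : ∀ f ∈ h, ∀ a, res f a ∈ d := fun f hf a => mem_firsts.2
    (List.mem_flatten.2 ⟨_, List.mem_map_of_mem hf, List.mem_map_of_mem (List.mem_finRange a)⟩)
  have hg : growth κ.flatten = (true, d.length) := by
    rw [← growth_map_idxOf, List.map_flatten]
  have hset : {f | f ∈ d} = residuals m {f | f ∈ h} := by
    ext f
    simp only [Set.mem_ofPred_eq, d, mem_firsts, L, residuals, List.mem_flatten, List.mem_map]
    constructor
    · rintro ⟨_, ⟨g, hg, rfl⟩, hf⟩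
      obtain ⟨a, _, rfl⟩ := List.mem_map.1 hf
      exact ⟨g, hg, a, rfl⟩
    · rintro ⟨g, hg, a, rfl⟩
      exact ⟨_, ⟨g, hg, rfl⟩, List.mem_map.2 ⟨a, List.mem_finRange a, rfl⟩⟩
  -- Narrowness is what keeps the new list of functions within the range of the automaton.
  have hdW : d.length ≤ W := by
    rw [← hset, show {f | f ∈ d} = (d.toFinset : Set _) by ext; simp, Set.ncard_coe_finset,
      List.toFinset_card_of_nodup (nodup_firsts _)] at hcard
    exact hcard
  have hrow : ∀ f, ((List.finRange m).map (res f)).map d.idxOf =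
      (List.finRange m).map fun a => d.idxOf (res f a) := fun f => by rw [List.map_map]; rfl
  have hget : ∀ f (a : Fin m), (((List.finRange m).map (res f)).map d.idxOf).getD a 0 =
      d.idxOf (res f a) := by
    intro f a
    rw [List.getD_eq_getElem _ _ (by simp)]
    simp
  have hκ : κ ∈ canonicalLayers m W N := by
    rw [mem_canonicalLayers]
    refine ⟨⟨by simp [κ, L, hlen], ?_⟩, ?_, by rw [hg], by rw [hg]; exact hdW⟩
    · simp only [κ, L, List.mem_map]
      rintro _ ⟨_, ⟨f, hf, rfl⟩, rfl⟩
      refine ⟨by simp, fun c hc => ?_⟩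
      rw [hrow f] at hc
      obtain ⟨a, _, rfl⟩ := List.mem_map.1 hc
      exact (List.idxOf_lt_length_of_mem (hmem f hf a)).trans_le hdW
    · simp only [κ, L, List.map_map]
      refine List.Nodup.map_on (fun f hf g hg hfg => ?_) hnd
      funext s
      have h₁ := congrArg (fun l => l.getD (s 0) 0) hfg
      simp only [Function.comp_apply] at h₁
      rw [hget, hget] at h₁
      have h₂ := getD_idxOf (z := fun _ => false) (hmem f hf (s 0))
      rw [h₁, getD_idxOf (hmem g hg (s 0))] at h₂
      have := congrFun h₂ (Fin.tail s)
      simpa [res] using this.symm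
  have hcomb : combine κ d = h := by
    simp only [combine, κ, L, List.map_map]
    conv_rhs => rw [← List.map_id h]
    refine List.map_congr_left fun f hf => ?_
    funext s
    simp only [Function.comp_apply]
    rw [hget, getD_idxOf (hmem f hf (s 0))]
    simp [res]
  refine ⟨κ, hκ, d, ?_, hcomb⟩
  rw [hg]
  -- A function outside `d` gets the index `d.length`, which is void; since `d.length ≤ W`, the
  -- values up to `W` allowed in `pairs` suffice.
  let ρ := (List.range W).map fun i => d.idxOf (valFn δ m acc D i)
  have hρ : ∀ i < W, ρ.getD i 0 = d.idxOf (valFn δ m acc D i) := by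
    intro i hi
    rw [List.getD_eq_getElem _ _ (by simpa [ρ] using hi)]
    simp [ρ]
  refine ⟨rfl, nodup_firsts _, by rw [hset]; exact hnar, (r, ρ), ?_, D, q, by simpa using hD, hp, hq,
    fun i hi hlt => ?_⟩
  · rw [mem_nextPairs, mem_pairs]
    refine ⟨⟨hT _ hr, by simp [ρ], fun c hc => ?_⟩, x, hx, b, hr, ?_⟩
    · obtain ⟨i, _, rfl⟩ := List.mem_map.1 hc
      exact List.idxOf_le_length.trans hdW
    · rw [compatible_iff]
      intro i hi hiN a ha
      have hi' : x.2.getD i 0 < h.length := by rw [hlen]; exact hiN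
      have h₁ := hv i hi hiN
      rw [List.getD_eq_getElem _ _ hi'] at h₁
      have h₂ : κ.getD (x.2.getD i 0) [] =
          ((List.finRange m).map (res h[x.2.getD i 0])).map d.idxOf := by
        rw [List.getD_eq_getElem _ _ (by simpa [κ, L] using hi')]
        simp [κ, L]
      rw [hρ _ (hδ b i a hi ha), h₂, hget _ ⟨a, ha⟩, h₁]
      congr 1
      funext s
      exact (valFn_cons acc b D i ⟨a, ha⟩ s).symm
  · simp only at hlt ⊢
    rw [hρ i hi] at hlt ⊢
    exact getD_idxOf (List.idxOf_lt_length_iff.1 hlt)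

theorem finite_tuples : (tuples δ m W acc accQ T N X j).Finite :=
  (List.finite_length_eq _ N).subset fun _ h => h.1

/-- The tuples of the longer length are the disjoint union, over `κ`, of injective images under
`combine κ` of tuples of the shorter length. -/
theorem ncard_tuples_succ (hδ : ∀ b i a, i < W → a < m → δ b i a < W) (hT : ∀ t ∈ T, t.2.2 < n) :
    (tuples δ m W acc accQ T N X (j + 1)).ncard = ((canonicalLayers m W N).map fun κ =>
      (tuples δ m W acc accQ T (growth κ.flatten).2
        (nextPairs δ m W T (pairs n W) N X κ) j).ncard).sum := by
  have hnd : (canonicalLayers m W N).Nodup :=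
    (nodup_allLists (nodup_allLists List.nodup_range _) _).filter _
  rw [← List.sum_toFinset _ hnd]
  let S : List (List ℕ) → Set (List ((Fin j → Fin m) → Bool)) := fun κ =>
    tuples δ m W acc accQ T (growth κ.flatten).2 (nextPairs δ m W T (pairs n W) N X κ) j
  have hU : tuples δ m W acc accQ T N X (j + 1) =
      ⋃ κ ∈ ((canonicalLayers m W N).toFinset : Set (List (List ℕ))), combine κ '' S κ := by
    ext h
    simp only [Set.mem_iUnion, List.coe_toFinset, Set.mem_image]
    constructor
    · intro hh
      obtain ⟨κ, hκ, d, hd, h⟩ := exists_combine hδ hT hh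
      exact ⟨κ, hκ, d, hd, h⟩
    · rintro ⟨κ, hκ, d, hd, rfl⟩
      exact combine_mem hδ hκ hd
  rw [hU, Set.Finite.ncard_biUnion (Finset.finite_toSet _) (fun κ _ => finite_tuples.image _),
    finsum_mem_coe_finset]
  · refine Finset.sum_congr rfl fun κ hκ => ?_
    rw [List.mem_toFinset] at hκ
    exact Set.InjOn.ncard_image fun d hd d' hd' h =>
      (combine_injective hκ hκ hd.2.1 hd'.2.1 hd.1 hd'.1 h).2
  · intro κ hκ κ' hκ' hne
    rw [List.coe_toFinset] at hκ hκ'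
    rw [Function.onFun, Set.disjoint_left]
    rintro _ ⟨d, hd, rfl⟩ ⟨d', hd', h⟩
    exact hne (combine_injective hκ hκ' hd.2.1 hd'.2.1 hd.1 hd'.1 h.symm).1

/-- Functions of no variables are Booleans and the path is empty, so a state of the automaton in `X`
must itself be accepting. -/
theorem ncard_tuples_zero : (tuples δ m W acc accQ T N X 0).ncard = baseCount W acc accQ N X := by
  let ev : List ((Fin 0 → Fin m) → Bool) → List Bool := List.map fun f => f Fin.elim0
  have hinj : Function.Injective fun f : (Fin 0 → Fin m) → Bool => f Fin.elim0 := by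
    intro f g h
    funext s
    rw [Subsingleton.elim s Fin.elim0]
    exact h
  have hsurj : ∀ g : List Bool, ev (g.map fun b _ => b) = g := fun g =>
    List.map_map.trans (List.map_id g)
  have hev : Function.Injective ev := List.map_injective_iff.2 hinj
  rw [← Set.ncard_image_of_injective _ hev, baseCount, ← List.toFinset_card_of_nodup
    (List.Nodup.filter _ (by decide)), ← Set.ncard_coe_finset]
  congr 1
  ext g
  simp only [Set.mem_image, List.coe_toFinset, List.mem_filter, Set.mem_ofPred_eq,
    Bool.and_eq_true, decide_eq_true_eq, List.any_eq_true, List.all_eq_true, List.mem_range,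
    Bool.or_eq_true, Bool.not_eq_true', decide_eq_false_iff_not]
  have hget : ∀ (h : List ((Fin 0 → Fin m) → Bool)) i D i', h.getD i (fun _ => false) =
      valFn δ m acc D i' ↔ (ev h).getD i false = acc (runFrom δ D i' []) := by
    intro h i D i'
    rw [← hinj.eq_iff]
    have : (ev h).getD i false = h.getD i (fun _ => false) Fin.elim0 := by
      simp only [ev, List.getD_eq_getElem?_getD, List.getElem?_map]
      cases h[i]? <;> rfl
    rw [this]
    rfl
  constructor
  · rintro ⟨h, ⟨hN, hnd, _, x, hx, D, q, hD, hp, hq, hv⟩, rfl⟩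
    rw [List.length_eq_zero_iff] at hD
    subst hD
    obtain rfl : x.1 = q := hp
    refine ⟨?_, by simp [ev, hN], x, hx, hq, fun i hi => ?_⟩
    · have hnd' : (ev h).Nodup := hnd.map hinj
      have hl := hnd'.length_le_card
      rw [Fintype.card_bool] at hl
      generalize ev h = g at hnd' hl
      rcases g with _ | ⟨a, _ | ⟨b, _ | ⟨c, g⟩⟩⟩
      · simp
      · cases a <;> simp
      · cases a <;> cases b <;> simp_all
      · simp at hl
    · by_cases hlt : x.2.getD i 0 < N
      · exact Or.inr ((hget _ _ _ _).1 (hv i hi hlt))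
      · exact Or.inl hlt
  · rintro ⟨hg, hN, x, hx, hq, hv⟩
    refine ⟨g.map fun b _ => b, ⟨by simpa using hN, ?_, trivial, x, hx, [], x.1, rfl, rfl, hq,
      fun i hi hlt => (hget _ _ _ _).2 ?_⟩, hsurj g⟩
    · refine List.Nodup.map (fun a b h => congrFun h Fin.elim0) ?_
      exact (by decide : ∀ g ∈ [[], [true], [false], [true, false], [false, true]], g.Nodup) g hg
    · rw [hsurj]
      exact (hv i hi).resolve_left (not_not_intro hlt)

end recursion

/-! ### The counting automaton and the powers of its matrix -/

variable (δ m W)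

/-- The states of the counting automaton. -/
def countStates (P : List (ℕ × List ℕ)) : List (ℕ × List (ℕ × List ℕ)) :=
  (List.range (W + 1)).flatMap fun N => P.sublists'.map fun X => (N, X)

/-- The transitions of the counting automaton, as adjacency lists. -/
def adjacency (T : List (ℕ × β × ℕ)) (P : List (ℕ × List ℕ)) : List (List ℕ) :=
  (countStates W P).map fun st => (canonicalLayers m W st.1).map fun κ =>
    (countStates W P).idxOf ((growth κ.flatten).2, nextPairs δ m W T P st.1 st.2 κ)

def baseVector (acc accQ : ℕ → Bool) (P : List (ℕ × List ℕ)) : List ℕ :=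
  (countStates W P).map fun st => baseCount W acc accQ st.1 st.2

/-- The index of the initial state of the counting automaton. -/
def startIndex (i₀ : ℕ) (start : ℕ → Bool) (P : List (ℕ × List ℕ)) : ℕ :=
  (countStates W P).idxOf (1, P.filter fun x => start x.1 && decide (x.2.getD i₀ 0 = 0))

/-- The product of the matrix with the given adjacency lists and a vector. -/
def mulVec (G : List (List ℕ)) (v : List ℕ) : List ℕ :=
  G.map fun r => (r.map fun i => v.getD i 0).sum

variable {δ m W} {acc accQ : ℕ → Bool} {T : List (ℕ × β × ℕ)} {n : ℕ}

theorem mem_countStates {P : List (ℕ × List ℕ)} {st : ℕ × List (ℕ × List ℕ)} :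
    st ∈ countStates W P ↔ st.1 ≤ W ∧ st.2.Sublist P := by
  obtain ⟨N, X⟩ := st
  simp [countStates]

/-- The recurrence as a matrix product. A row has one entry for each `κ`, so a target reached by
several `κ` is listed, and counted, several times. -/
theorem iterate_mulVec (hδ : ∀ b i a, i < W → a < m → δ b i a < W) (hT : ∀ t ∈ T, t.2.2 < n)
    (k : ℕ) : (mulVec (adjacency δ m W T (pairs n W)))^[k] (baseVector W acc accQ (pairs n W)) =
      (countStates W (pairs n W)).map fun st =>
        (tuples δ m W acc accQ T st.1 st.2 k).ncard := by
  induction k with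
  | zero => simp [baseVector, ncard_tuples_zero]
  | succ k ih =>
    rw [Function.iterate_succ_apply', ih, mulVec, adjacency, List.map_map]
    refine List.map_congr_left fun st hst => ?_
    rw [ncard_tuples_succ hδ hT, Function.comp_apply, List.map_map]
    congr 1
    refine List.map_congr_left fun κ hκ => ?_
    have hmem : ((growth κ.flatten).2, nextPairs δ m W T (pairs n W) st.1 st.2 κ) ∈
        countStates W (pairs n W) :=
      mem_countStates.2 ⟨(mem_canonicalLayers.1 hκ).2.2.2, List.filter_sublist⟩
    rw [Function.comp_apply, List.getD_eq_getElem _ _ (by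
      rw [List.length_map]; exact List.idxOf_lt_length_of_mem hmem)]
    simp

/-- The initial state describes lists `[f]` whose only member is named by `i₀`, which forces `f` to
be the function computed from `i₀`. All other values of the assignment are free, so some pair in the
set is correct for each diagram. -/
theorem getD_iterate_mulVec (hδ : ∀ b i a, i < W → a < m → δ b i a < W)
    (hT : ∀ t ∈ T, t.2.2 < n) {start : ℕ → Bool} (hs : ∀ q, start q = true → q < n) {i₀ : ℕ}
    (hi₀ : i₀ < W) (k : ℕ) :
    ((mulVec (adjacency δ m W T (pairs n W)))^[k] (baseVector W acc accQ (pairs n W))).getD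
      (startIndex W i₀ start (pairs n W)) 0 = Set.ncard {f : (Fin k → Fin m) → Bool |
        ∃ p D q, start p = true ∧ D.length = k ∧ IsPath T p D q ∧ accQ q = true ∧
          f = valFn δ m acc D i₀} := by
  have hmem : (1, (pairs n W).filter fun x => start x.1 && decide (x.2.getD i₀ 0 = 0)) ∈
      countStates W (pairs n W) := mem_countStates.2 ⟨by dsimp only; omega, List.filter_sublist⟩
  rw [iterate_mulVec hδ hT, startIndex, List.getD_eq_getElem _ _ (by
    rw [List.length_map]; exact List.idxOf_lt_length_of_mem hmem)]
  simp only [List.getElem_map, List.getElem_idxOf]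
  rw [← Set.ncard_image_of_injective (f := fun f : (Fin k → Fin m) → Bool => [f]) _ (fun f g h => by simpa using h)]
  refine congrArg Set.ncard (Set.ext fun h => ?_)
  simp only [tuples, Set.mem_ofPred_eq, Set.mem_image, List.mem_filter, Bool.and_eq_true,
    decide_eq_true_eq]
  constructor
  · rintro ⟨hl, _, _, x, ⟨_, hx, h0⟩, D, q, hD, hp, hq, hv⟩
    obtain ⟨f, rfl⟩ := List.length_eq_one_iff.1 hl
    refine ⟨f, ⟨x.1, D, q, hx, hD, hp, hq, ?_⟩, rfl⟩
    have := hv i₀ hi₀ (by omega)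
    rwa [h0] at this
  · rintro ⟨f, ⟨p, D, q, hp, hD, hpath, hq, rfl⟩, rfl⟩
    -- States that compute the same function as `i₀` get the class 0, all others 1, which is void
    -- because the list has length 1.
    let ρ := (List.range W).map fun i => [(valFn δ m acc D i₀ : (Fin k → Fin m) → Bool)].idxOf
      (valFn δ m acc D i)
    have hρ : ∀ i < W, ρ.getD i 0 = [(valFn δ m acc D i₀ : (Fin k → Fin m) → Bool)].idxOf
      (valFn δ m acc D i) := by
      intro i hi
      rw [List.getD_eq_getElem _ _ (by simpa [ρ] using hi)]
      simp [ρ]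
    refine ⟨rfl, by simp, narrow_of_valFn hδ acc hD ?_, (p, ρ), ⟨?_, hp, ?_⟩, D, q, hD, hpath, hq,
      fun i hi hlt => ?_⟩
    · simp only [List.mem_singleton, Set.mem_ofPred_eq]
      rintro _ rfl
      exact ⟨i₀, hi₀, rfl⟩
    · rw [mem_pairs]
      refine ⟨hs p hp, by simp [ρ], fun c hc => ?_⟩
      obtain ⟨i, _, rfl⟩ := List.mem_map.1 hc
      exact List.idxOf_le_length.trans (by simp; omega)
    · rw [hρ i₀ hi₀]
      simp
    · simp only at hlt ⊢
      rw [hρ i hi] at hlt ⊢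
      exact getD_idxOf (List.idxOf_lt_length_iff.1 (by simpa using hlt))

end

/-! ### The counting automaton is computable -/

section

variable {α β γ : Type} [Enc α] [Enc β] [Enc γ]

namespace PolyB

variable {B : α → ℕ}

theorem lift {f : α → β} (hf : PolyB B f) :
    PolyB (fun p : α × γ => B p.1) fun p => f p.1 :=
  hf.comp' id.fst (PolyBd.of_le fun p => by simp)

/-- The number of lists is exponential, so `B` must dominate it. The summand 1 in the base makes the
power monotone in the exponent even if `l` is empty. -/
theorem allLists {l : α → List β} {n : α → ℕ} (hl : PolyB B l) (hn : PolyB B n)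
    (hb : PolyBd (fun a => B a + sz a) fun a => ((l a).length + 1) ^ n a) :
    PolyB B fun a => allLists (l a) (n a) := by
  have key : ∀ (l : List β) n, (List.replicate n ()).foldl
      (fun L _ => l.flatMap fun x => L.map fun t => x :: t) [[]] = _root_.allLists l n := by
    intro l n
    induction n with
    | zero => rfl
    | succ n ih => rw [List.replicate_succ', List.foldl_append, ih]; rfl
  have hsz : ∀ (l : List β) n, sz (_root_.allLists l n) ≤
      l.length ^ n * (n * (sz l + 1) + 1 + 1) + 1 := by
    intro l n
    rw [← length_allLists]
    refine sz_le_of_forall fun t ht => ?_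
    obtain ⟨h₁, h₂⟩ := mem_allLists.1 ht
    rw [← h₁]
    exact sz_le_of_forall fun x hx => (sz_lt_of_mem (h₂ x hx)).le
  refine (foldl (g := fun a L (_ : Unit) => (l a).flatMap fun x => L.map fun t => x :: t)
    (s₀ := fun _ => [[]])
    (fun a => ((l a).length + 1) ^ n a * (sz (n a) * (sz (l a) + 1) + 1 + 1) + 1) hn.units (const _)
    ?_ (((hb.mul (((hn.bd.mul (hl.bd.add (PolyBd.const _ 1))).add (PolyBd.const _ 1)).add
      (PolyBd.const _ 1))).add (PolyBd.const _ 1))) fun a l₁ h => ?_).congr_enc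
    fun a => by rw [key]
  · exact hl.lift.flatMap (id.fst.snd.fst.map (id.fst.snd.cons id.snd))
  · have h₁ : l₁ = List.replicate l₁.length () := by rw [List.eq_replicate_iff]; simp
    have h₂ := h.length_le
    rw [List.length_replicate] at h₂
    rw [h₁, key]
    have h₃ : (l a).length ^ l₁.length ≤ ((l a).length + 1) ^ n a :=
      (Nat.pow_le_pow_left (Nat.le_succ _) _).trans (Nat.pow_le_pow_right (Nat.succ_pos _) h₂)
    have h₄ : l₁.length ≤ sz (n a) := by rw [sz_nat]; omega
    exact (hsz _ _).trans (Nat.add_le_add_right (Nat.mul_le_mul h₃ (Nat.add_le_add_right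
      (Nat.add_le_add_right (Nat.mul_le_mul_right _ h₄) 1) 1)) 1)

theorem sublists' {l : α → List β} (hl : PolyB B l)
    (hb : PolyBd (fun a => B a + sz a) fun a => 2 ^ (l a).length) :
    PolyB B fun a => (l a).sublists' := by
  have key : ∀ l : List β, l.foldr (fun x L => L ++ L.map fun t => x :: t) [[]] = l.sublists' := by
    intro l
    induction l with
    | nil => rfl
    | cons x l ih => rw [List.foldr_cons, ih, List.sublists'_cons]
  have hsub : ∀ {l l' : List β}, l.Sublist l' → sz l ≤ sz l' := by
    intro l l' h
    induction h with
    | slnil => exact le_rfl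
    | cons _ _ ih => rw [sz_cons]; omega
    | cons_cons _ _ ih => rw [sz_cons, sz_cons]; omega
  have hsz : ∀ l : List β, sz l.sublists' ≤ 2 ^ l.length * (sz l + 1) + 1 := by
    intro l
    rw [← List.length_sublists']
    exact sz_le_of_forall fun t ht => hsub (List.mem_sublists'.1 ht)
  refine (foldr (g := fun _ x (L : List (List β)) => L ++ L.map fun t => x :: t) (s₀ := fun _ => [[]])
    (fun a => 2 ^ (l a).length * (sz (l a) + 1) + 1) hl (const _)
    (id.snd.snd.append (id.snd.snd.map (id.fst.snd.fst.cons id.snd)))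
    ((hb.mul (hl.bd.add (PolyBd.const _ 1))).add (PolyBd.const _ 1)) fun a l₁ h => ?_).congr_enc
    fun a => by rw [key]
  rw [key]
  refine (hsz _).trans ?_
  have h₁ := sz_le_of_suffix h
  have h₂ := h.length_le
  gcongr
  omega

end PolyB

/-! ### Binary digits and growth in relative polynomial time -/

/-- The number with the given binary digits, least significant digit first. -/
def ofBits (l : List Bool) : ℕ := l.foldr (fun b n => n + n + if b = true then 1 else 0) 0

theorem ofBits_bits (n : ℕ) : ofBits n.bits = n := by
  induction n using Nat.binaryRec' with
  | zero => rfl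
  | bit b n h ih =>
    rw [Nat.bits_append_bit n b h, ofBits, List.foldr_cons, ← ofBits, ih, Nat.bit_val]
    cases b <;> simp <;> omega

/-- The number with the given binary digits, but at most `c`. -/
def ofBitsCap (c : ℕ) (l : List Bool) : ℕ :=
  l.foldr (fun b n => if decide (c < n + n + if b = true then 1 else 0) = true then c else
    n + n + if b = true then 1 else 0) 0

/-- Cutting off at each doubling has the same effect as cutting off once at the end. -/
theorem ofBitsCap_eq (c : ℕ) (l : List Bool) : ofBitsCap c l = min c (ofBits l) := by
  induction l with
  | nil => simp [ofBits, ofBitsCap]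
  | cons b l ih =>
    have h : ofBits (b :: l) = ofBits l + ofBits l + if b = true then 1 else 0 := rfl
    rw [ofBitsCap, List.foldr_cons, ← ofBitsCap, ih, h]
    simp only [decide_eq_true_eq]
    split_ifs <;> omega

namespace PolyB

variable {B : α → ℕ}

theorem ofBits {l : α → List Bool} (hl : PolyB B l)
    (hb : PolyBd (fun a => B a + sz a) fun a => ofBits (l a)) : PolyB B fun a => ofBits (l a) := by
  refine foldr (g := fun _ b n => n + n + if b = true then 1 else 0) (s₀ := fun _ => 0)
    (fun a => 2 * _root_.ofBits (l a) + 1) hl (const 0)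
    ((id.snd.snd.add id.snd.snd).add (ite id.snd.fst (const 1) (const 0)))
    (((PolyBd.const _ 2).mul hb).add (PolyBd.const _ 1)) fun a l₁ h => ?_
  have : ∀ l₁ l₂ : List Bool, _root_.ofBits l₂ ≤ _root_.ofBits (l₁ ++ l₂) := by
    intro l₁ l₂
    induction l₁ with
    | nil => exact le_rfl
    | cons b l ih =>
      rw [List.cons_append, _root_.ofBits, _root_.ofBits, List.foldr_cons, ← _root_.ofBits,
        ← _root_.ofBits]
      omega
  obtain ⟨l₂, h⟩ := h
  have h₂ := this l₂ l₁
  rw [h] at h₂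
  rw [sz_nat]
  change 2 * _root_.ofBits l₁ + 1 ≤ _
  omega

/-- In contrast to `ofBits`, no bound on the value is required. The state numbers in transitions are
read in this way, because a program in `PolyB` must obey its bound on malformed inputs too. -/
theorem ofBitsCap {c : α → ℕ} {l : α → List Bool} (hc : PolyB B c) (hl : PolyB B l) :
    PolyB B fun a => ofBitsCap (c a) (l a) := by
  have h : PolyB (fun p : α × Bool × ℕ => B p.1) fun p =>
      p.2.2 + p.2.2 + if p.2.1 = true then 1 else 0 :=
    (id.snd.snd.add id.snd.snd).add (ite id.snd.fst (const 1) (const 0))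
  refine foldr (g := fun a b n => if decide (c a < n + n + if b = true then 1 else 0) = true then c a
    else n + n + if b = true then 1 else 0) (s₀ := fun _ => 0)
    (fun a => sz (c a)) hl (const 0) (ite (hc.lift.lt h) hc.lift h) hc.bd fun a l₁ _ => ?_
  change sz (_root_.ofBitsCap (c a) l₁) ≤ _
  rw [ofBitsCap_eq, sz_nat, sz_nat]
  omega

theorem nodup [DecidableEq β] [PolyEq β] {l : α → List β} (hl : PolyB B l) :
    PolyB B fun a => decide (l a).Nodup := by
  have key : ∀ l : List β, l.foldr (fun x (s : Bool × List β) =>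
      (s.1 && !decide (x ∈ s.2), x :: s.2)) (true, []) = (decide l.Nodup, l) := by
    intro l
    induction l with
    | nil => simp
    | cons x l ih =>
      rw [List.foldr_cons, ih]
      simp only [Prod.mk.injEq, and_true, List.nodup_cons]
      rw [Bool.eq_iff_iff]
      simp [and_comm]
  have h : PolyB (fun p : α × β × Bool × List β => B p.1) fun p => decide (p.2.1 ∈ p.2.2.2) :=
    id.snd.snd.snd.contains id.snd.fst
  refine ((foldr (g := fun _ x (s : Bool × List β) => (s.1 && !decide (x ∈ s.2), x :: s.2))
    (s₀ := fun _ => (true, [])) (fun a => 4 + sz (l a)) hl (const _)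
    ((id.snd.snd.fst.and h.not).pair (id.snd.fst.cons id.snd.snd.snd))
    ((PolyBd.const _ 4).add hl.bd) fun a l₁ hs => ?_).fst).congr_enc fun a => by rw [key]
  rw [key, sz_pair]
  have := sz_bool_le (decide l₁.Nodup)
  have := sz_le_of_suffix hs
  omega

theorem growth {l : α → List ℕ} (hl : PolyB B l) : PolyB B fun a => growth (l a) := by
  have h : PolyB (fun p : α × (Bool × ℕ) × ℕ => B p.1) fun p => p.2.1.2 := id.snd.fst.snd
  refine foldl (g := fun _ (s : Bool × ℕ) c =>
    (s.1 && !decide (s.2 < c), if decide (c < s.2) = true then s.2 else s.2 + 1))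
    (s₀ := fun _ => (true, 0)) (fun a => 5 + 2 * sz (l a)) hl (const _)
    ((id.snd.fst.fst.and (h.lt id.snd.snd).not).pair (ite (id.snd.snd.lt h) h (h.add (const 1))))
    ((PolyBd.const _ 5).add ((PolyBd.const _ 2).mul hl.bd)) fun a l₁ hp => ?_
  have hle : (_root_.growth l₁).2 ≤ l₁.length := by
    induction l₁ using List.reverseRecOn with
    | nil => exact le_rfl
    | append_singleton l c ih =>
      have := ih ((List.prefix_append _ _).trans hp)
      rw [growth_append_singleton, List.length_append, List.length_singleton]
      dsimp only
      split <;> omega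
  change sz (_root_.growth l₁) ≤ _
  rw [sz_prod, sz_nat]
  have := sz_bool_le (_root_.growth l₁).1
  have := hp.length_le
  have := length_lt_sz (l a)
  omega

end PolyB

end

/-! ### The action of coded layers on coded sets -/

/-- The successor of the set `S` under the letter `a` in a layer with binary code `b`. -/
def layerNext (m w : ℕ) (b : List Bool) (S : List Bool) (a : ℕ) : List Bool :=
  -- Offsets in the code of a layer: the transitions begin at `w + w`, behind the two frontiers;
  -- then come the initial set, the final set and the two flags, the final flag being the last bit.
  (List.range w).map fun q =>
    ((List.range w).any fun p =>
      (S.getD p false || b.getD (w + w + w * (m * w) + p) false) &&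
        b.getD (w + w + (p * (m * w) + (a * w + q))) false) &&
    (!b.getD (w + w + w * (m * w) + w + w + 1) false ||
      b.getD (w + w + w * (m * w) + w + q) false)

/-- The same on the indices of the sets in a list of all sets. -/
def stepIndex (m w : ℕ) (ss : List (List Bool)) (b : List Bool) (i a : ℕ) : ℕ :=
  ss.idxOf (layerNext m w b (ss.getD i []) a)

def nonemptyIndex (ss : List (List Bool)) (i : ℕ) : Bool := (ss.getD i []).any fun b => b

namespace PolyB

variable {α : Type} [Enc α] {B : α → ℕ}

theorem layerNext {m w a : α → ℕ} {b S : α → List Bool} (hm : PolyB B m) (hw : PolyB B w)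
    (hb : PolyB B b) (hS : PolyB B S) (ha : PolyB B a) :
    PolyB B fun x => layerNext (m x) (w x) (b x) (S x) (a x) := by
  have ho : PolyB B fun x => w x + w x + w x * (m x * w x) := (hw.add hw).add (hw.mul (hm.mul hw))
  refine hw.range.map (f := fun x q =>
    ((List.range (w x)).any fun p =>
      ((S x).getD p false || (b x).getD (w x + w x + w x * (m x * w x) + p) false) &&
        (b x).getD (w x + w x + (p * (m x * w x) + (a x * w x + q))) false) &&
    (!(b x).getD (w x + w x + w x * (m x * w x) + w x + w x + 1) false ||
      (b x).getD (w x + w x + w x * (m x * w x) + w x + q) false)) ?_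
  refine (hw.lift.range.any (f := fun y p =>
      ((S y.1).getD p false || (b y.1).getD (w y.1 + w y.1 + w y.1 * (m y.1 * w y.1) + p) false) &&
        (b y.1).getD (w y.1 + w y.1 + (p * (m y.1 * w y.1) + (a y.1 * w y.1 + y.2))) false) ?_).and ?_
  · exact ((hS.lift.lift.getD id.snd (const _)).or
      (hb.lift.lift.getD (ho.lift.lift.add id.snd) (const _))).and
      (hb.lift.lift.getD ((hw.add hw).lift.lift.add ((id.snd.mul (hm.mul hw).lift.lift).add
        ((ha.mul hw).lift.lift.add id.fst.snd))) (const _))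
  · exact (hb.lift.getD (((ho.add hw).add hw).add (const 1)).lift (const _)).not.or
      (hb.lift.getD ((ho.add hw).lift.add id.snd) (const _))

theorem stepIndex {m w i a : α → ℕ} {ss : α → List (List Bool)} {b : α → List Bool}
    (hm : PolyB B m) (hw : PolyB B w) (hs : PolyB B ss) (hb : PolyB B b) (hi : PolyB B i)
    (ha : PolyB B a) : PolyB B fun x => stepIndex (m x) (w x) (ss x) (b x) (i x) (a x) :=
  hs.idxOf (hm.layerNext hw hb (hs.getD hi (const _)) ha)

theorem nonemptyIndex {i : α → ℕ} {ss : α → List (List Bool)} (hs : PolyB B ss) (hi : PolyB B i) :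
    PolyB B fun x => nonemptyIndex (ss x) (i x) :=
  (hs.getD hi (const _)).any id.snd

end PolyB

/-! ### Estimates for the size of the counting automaton -/

/-- A bound on the size of the counting automaton. -/
def blowup (m w n : ℕ) : ℕ := 2 ^ ((n + 1) * 2 ^ (2 * ((m + 1) * (w + 1) * 2 ^ w)))

theorem two_pow_le_blowup {m w n e : ℕ} (h : e ≤ 2 * ((m + 1) * (w + 1) * 2 ^ w)) :
    2 ^ e ≤ blowup m w n :=
  Nat.pow_le_pow_right (by omega) ((h.trans Nat.lt_two_pow_self.le).trans
    (Nat.le_mul_of_pos_left _ (Nat.succ_pos _)))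

/-- The factor `n + 1` in `blowup` is needed here: with `n` in its place the bound would collapse to
1 for an automaton without states. -/
theorem params_le_blowup (m w n : ℕ) : m ≤ blowup m w n ∧ w ≤ blowup m w n ∧ n ≤ blowup m w n := by
  have hW : 1 ≤ 2 ^ w := Nat.one_le_two_pow
  have h₁ : (m + 1) * (w + 1) * 1 ≤ (m + 1) * (w + 1) * 2 ^ w := Nat.mul_le_mul_left _ hW
  have h₂ : m + 1 ≤ (m + 1) * (w + 1) := Nat.le_mul_of_pos_right _ (by omega)
  have h₃ : w + 1 ≤ (m + 1) * (w + 1) := Nat.le_mul_of_pos_left _ (by omega)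
  refine ⟨Nat.lt_two_pow_self.le.trans (two_pow_le_blowup (by omega)),
    Nat.lt_two_pow_self.le.trans (two_pow_le_blowup (by omega)),
    Nat.lt_two_pow_self.le.trans (Nat.pow_le_pow_right (by omega) ?_)⟩
  exact (Nat.le_succ n).trans (Nat.le_mul_of_pos_right _ (by positivity))

theorem three_pow_le_blowup (m w n : ℕ) : 3 ^ w ≤ blowup m w n := by
  calc 3 ^ w ≤ 4 ^ w := Nat.pow_le_pow_left (by omega) _
    _ = 2 ^ (2 * w) := by rw [pow_mul]; rfl
    _ ≤ _ := two_pow_le_blowup ?_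
  have hW : 1 ≤ 2 ^ w := Nat.one_le_two_pow
  have h₁ : (m + 1) * (w + 1) * 1 ≤ (m + 1) * (w + 1) * 2 ^ w := Nat.mul_le_mul_left _ hW
  have h₃ : w + 1 ≤ (m + 1) * (w + 1) := Nat.le_mul_of_pos_left _ (by omega)
  omega

theorem add_two_pow_le (m w : ℕ) :
    (2 ^ w + 2) ^ 2 ^ w ≤ 2 ^ (2 * ((m + 1) * (w + 1) * 2 ^ w)) := by
  have h₁ : 2 ^ w + 2 ≤ 2 ^ (2 * (w + 1)) := by
    have hW : 1 ≤ 2 ^ w := Nat.one_le_two_pow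
    have : 2 ^ (2 * (w + 1)) = 2 ^ w * 2 ^ w * 4 := by rw [two_mul, pow_add, pow_succ]; ring
    nlinarith
  calc (2 ^ w + 2) ^ 2 ^ w ≤ (2 ^ (2 * (w + 1))) ^ 2 ^ w := Nat.pow_le_pow_left h₁ _
    _ = 2 ^ (2 * (1 * (w + 1) * 2 ^ w)) := by rw [← pow_mul]; ring_nf
    _ ≤ _ := Nat.pow_le_pow_right (by omega) (by gcongr; omega)

/-- For the assignments, lists of length `2 ^ w` over `2 ^ w + 1` classes; one more unit in the base
comes from `PolyB.allLists`. -/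
theorem assignments_le_blowup (m w n : ℕ) : (2 ^ w + 2) ^ 2 ^ w ≤ blowup m w n :=
  ((add_two_pow_le m w).trans Nat.lt_two_pow_self.le).trans
    (Nat.pow_le_pow_right (by omega) (Nat.le_mul_of_pos_left _ (Nat.succ_pos _)))

/-- For the sublists of `pairs`. This is the only estimate in which the exponent depends on `n`. -/
theorem subsets_le_blowup (m w n : ℕ) : 2 ^ (n * (2 ^ w + 1) ^ 2 ^ w) ≤ blowup m w n :=
  Nat.pow_le_pow_right (by omega) (Nat.mul_le_mul (Nat.le_succ n)
    ((Nat.pow_le_pow_left (Nat.le_succ _) _).trans (add_two_pow_le m w)))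

/-- For the tables with at most `2 ^ w` rows, each one of `(2 ^ w) ^ m` rows. -/
theorem layers_le_blowup (m w n : ℕ) : ((2 ^ w) ^ m + 1) ^ 2 ^ w ≤ blowup m w n := by
  have h₁ : (2 ^ w) ^ m + 1 ≤ 2 ^ (w * m + 1) := by
    rw [← pow_mul, pow_succ]
    have : 1 ≤ 2 ^ (w * m) := Nat.one_le_two_pow
    omega
  calc ((2 ^ w) ^ m + 1) ^ 2 ^ w ≤ (2 ^ (w * m + 1)) ^ 2 ^ w := Nat.pow_le_pow_left h₁ _
    _ = 2 ^ ((w * m + 1) * 2 ^ w) := by rw [← pow_mul]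
    _ ≤ _ := two_pow_le_blowup ?_
  have : w * m + 1 ≤ (m + 1) * (w + 1) := by nlinarith
  have := Nat.mul_le_mul_right (2 ^ w) this
  omega

theorem rows_le_blowup (m w n : ℕ) : (2 ^ w + 1) ^ m ≤ blowup m w n := by
  have h₁ : 2 ^ w + 1 ≤ 2 ^ (w + 1) := by
    rw [pow_succ]
    have : 1 ≤ 2 ^ w := Nat.one_le_two_pow
    omega
  calc (2 ^ w + 1) ^ m ≤ (2 ^ (w + 1)) ^ m := Nat.pow_le_pow_left h₁ _
    _ = 2 ^ ((w + 1) * m) := by rw [← pow_mul]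
    _ ≤ _ := two_pow_le_blowup ?_
  have hW : 1 ≤ 2 ^ w := Nat.one_le_two_pow
  have h₁ : (m + 1) * (w + 1) * 1 ≤ (m + 1) * (w + 1) * 2 ^ w := Nat.mul_le_mul_left _ hW
  have : (w + 1) * m ≤ (m + 1) * (w + 1) := by nlinarith
  omega

section

variable {α β γ : Type} [Enc α] [Enc β] [Enc γ] {B : α → ℕ}

namespace PolyB

theorem sum {l : α → List ℕ} (hl : PolyB B l) : PolyB B fun a => (l a).sum :=
  (hl.flatMap (f := fun _ n => List.replicate n ()) id.snd.units).length.congr_enc fun a => by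
    simp

variable {m w n N : α → ℕ} {ss : α → List (List Bool)} {b : α → List Bool}
  {T : α → List (ℕ × List Bool × ℕ)} {P X : α → List (ℕ × List ℕ)} {κ : α → List (List ℕ)}
  {ρ ρ' : α → List ℕ}

theorem compatible (hm : PolyB B m) (hw : PolyB B w) (hs : PolyB B ss) (hN : PolyB B N)
    (hb : PolyB B b) (hκ : PolyB B κ) (hρ : PolyB B ρ) (hρ' : PolyB B ρ') :
    PolyB B fun x => compatible (_root_.stepIndex (m x) (w x) (ss x)) (m x) (ss x).length (N x) (b x) (κ x)
      (ρ x) (ρ' x) := by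
  refine hs.length.range.all (f := fun x i => !decide ((ρ x).getD i 0 < N x) ||
    (List.range (m x)).all fun a => decide ((ρ' x).getD (_root_.stepIndex (m x) (w x) (ss x) (b x) i a) 0 =
      ((κ x).getD ((ρ x).getD i 0) []).getD a 0)) ?_
  have h := hρ.lift.getD id.snd (const 0)
  refine (h.lt hN.lift).not.or (hm.lift.range.all (f := fun y a =>
    decide ((ρ' y.1).getD (_root_.stepIndex (m y.1) (w y.1) (ss y.1) (b y.1) y.2 a) 0 =
      ((κ y.1).getD ((ρ y.1).getD y.2 0) []).getD a 0)) ?_)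
  exact (hρ'.lift.lift.getD (hm.lift.lift.stepIndex hw.lift.lift hs.lift.lift hb.lift.lift
    id.fst.snd id.snd) (const 0)).eq_nat ((hκ.lift.lift.getD h.lift (const _)).getD id.snd (const _))

theorem nextPairs (hm : PolyB B m) (hw : PolyB B w) (hs : PolyB B ss) (hN : PolyB B N)
    (hT : PolyB B T) (hP : PolyB B P) (hX : PolyB B X) (hκ : PolyB B κ) :
    PolyB B fun x => nextPairs (_root_.stepIndex (m x) (w x) (ss x)) (m x) (ss x).length (T x) (P x) (N x)
      (X x) (κ x) := by
  refine hP.filter (f := fun x y => (X x).any fun x' => (T x).any fun t =>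
    decide (t.1 = x'.1) && (decide (t.2.2 = y.1) && _root_.compatible (_root_.stepIndex (m x) (w x) (ss x))
      (m x) (ss x).length (N x) t.2.1 (κ x) x'.2 y.2)) ?_
  refine hX.lift.any (f := fun (x : α × ℕ × List ℕ) (x' : ℕ × List ℕ) => (T x.1).any fun t =>
    decide (t.1 = x'.1) && (decide (t.2.2 = x.2.1) && _root_.compatible
      (_root_.stepIndex (m x.1) (w x.1) (ss x.1)) (m x.1) (ss x.1).length (N x.1) t.2.1 (κ x.1) x'.2 x.2.2)) ?_
  refine hT.lift.lift.any (f := fun (x : (α × ℕ × List ℕ) × ℕ × List ℕ) (t : ℕ × List Bool × ℕ) =>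
    decide (t.1 = x.2.1) && (decide (t.2.2 = x.1.2.1) && _root_.compatible
      (_root_.stepIndex (m x.1.1) (w x.1.1) (ss x.1.1)) (m x.1.1) (ss x.1.1).length (N x.1.1) t.2.1
        (κ x.1.1) x.2.2 x.1.2.2)) ?_
  exact (id.snd.fst.eq_nat id.fst.snd.fst).and ((id.snd.snd.snd.eq_nat id.fst.fst.snd.fst).and
    (hm.lift.lift.lift.compatible hw.lift.lift.lift hs.lift.lift.lift hN.lift.lift.lift
      id.snd.snd.fst hκ.lift.lift.lift id.fst.snd.snd id.fst.fst.snd.snd))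

theorem baseCount {accept : α → List Bool} (hs : PolyB B ss) (hacc : PolyB B accept) (hN : PolyB B N)
    (hX : PolyB B X) : PolyB B fun x => baseCount (ss x).length (_root_.nonemptyIndex (ss x))
      (fun q => (accept x).getD q false) (N x) (X x) := by
  refine ((const [[], [true], [false], [true, false], [false, true]]).filter
    (f := fun x (h : List Bool) => decide (h.length = N x) && (X x).any fun y =>
      (accept x).getD y.1 false && (List.range (ss x).length).all fun i =>
        !decide (y.2.getD i 0 < N x) ||
          decide (h.getD (y.2.getD i 0) false = _root_.nonemptyIndex (ss x) i)) ?_).length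
  refine (id.snd.length.eq_nat hN.lift).and (hX.lift.any (f := fun (x : α × List Bool) (y : ℕ × List ℕ) =>
    (accept x.1).getD y.1 false && (List.range (ss x.1).length).all fun i =>
        !decide (y.2.getD i 0 < N x.1) ||
          decide (x.2.getD (y.2.getD i 0) false = _root_.nonemptyIndex (ss x.1) i)) ?_)
  refine (hacc.lift.lift.getD id.snd.fst (const _)).and (hs.lift.lift.length.range.all
    (f := fun (x : (α × List Bool) × ℕ × List ℕ) i => !decide (x.2.2.getD i 0 < N x.1.1) ||
          decide (x.1.2.getD (x.2.2.getD i 0) false = _root_.nonemptyIndex (ss x.1.1) i)) ?_)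
  have h : PolyB (fun p : ((α × List Bool) × ℕ × List ℕ) × ℕ => B p.1.1.1)
      fun p => p.1.2.2.getD p.2 0 := id.fst.snd.snd.getD id.snd (const 0)
  exact (h.lt hN.lift.lift.lift).not.or ((id.fst.fst.snd.getD h (const _)).eq
    (hs.lift.lift.lift.nonemptyIndex id.snd))

theorem canonicalLayers (hm : PolyB B m) (hs : PolyB B ss) (hN : PolyB B N)
    (h₁ : PolyBd (fun a => B a + sz a) fun a => ((ss a).length + 1) ^ m a)
    (h₂ : PolyBd (fun a => B a + sz a) fun a => ((ss a).length ^ m a + 1) ^ N a) :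
    PolyB B fun x => canonicalLayers (m x) (ss x).length (N x) := by
  refine ((hs.length.range.allLists hm (h₁.mono fun a => by rw [List.length_range])).allLists hN
    (h₂.mono fun a => by rw [length_allLists, List.length_range])).filter (f := fun x κ =>
      decide κ.Nodup && ((_root_.growth κ.flatten).1 && !decide ((ss x).length < (_root_.growth κ.flatten).2))) ?_
  have := (growth (B := fun p : α × List (List ℕ) => B p.1) id.snd.flatten)
  exact id.snd.nodup.and (this.fst.and (hs.lift.length.lt this.snd).not)

end PolyB

end

/-! ### From the input to the counting automaton -/

/-- Group the members of a list in pairs. -/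
def groupPairs {β : Type} (l : List β) : List (β × β) :=
  -- The state is the element that waits for its partner. A last element without partner is lost,
  -- which disposes of the empty string behind the final mark.
  (mapAcc (fun (s : List β) x => if s.isEmpty = true then ([x], []) else ([], [(s.headD x, x)]))
    [] l).2.flatten

theorem groupPairs_cons_cons {β : Type} (x y : β) (l : List β) :
    groupPairs (x :: y :: l) = (x, y) :: groupPairs l := rfl

theorem PolyB.groupPairs {α β : Type} [Enc α] [Enc β] {B : α → ℕ} {l : α → List β}
    (hl : PolyB B l) : PolyB B fun a => groupPairs (l a) := by
  refine PolyB.flatten (PolyB.snd (PolyB.mapAcc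
    (g := fun _ (s : List β) x => if s.isEmpty = true then ([x], []) else ([], [(s.headD x, x)]))
    (s₀ := fun _ => []) (fun a => sz (l a) + 1) hl (const _)
    (ite id.snd.fst.isEmpty ((id.snd.snd.cons (const [])).pair (const [])) ((const []).pair
      (((id.snd.fst.headD id.snd.snd).pair id.snd.snd).cons (const []))))
    (hl.bd.add (PolyBd.const _ 1)) fun a l₁ h => ?_))
  induction l₁ using List.reverseRecOn with
  | nil => exact Nat.le_add_left _ _
  | append_singleton l₁ x _ =>
    have hx : x ∈ l a := h.subset (by simp)
    have := sz_lt_of_mem hx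
    rw [mapAcc_append_singleton]
    dsimp only
    split
    · simp; omega
    · simp

section

variable (segs : List (List Bool))

/-- The size of the alphabet, the width and the number of states. -/
def sizes : ℕ × ℕ × ℕ :=
  (ofBits (segs.getD 0 []), ofBits (segs.getD 1 []), ofBits (segs.getD 2 []))

/-- The part of the input after the numbers. -/
def vectors : List Bool := segs.getD 4 []

def starts : List Bool := (vectors segs).take (sizes segs).2.2

def accepts : List Bool := ((vectors segs).drop (sizes segs).2.2).take (sizes segs).2.2

def codeLength (m w : ℕ) : ℕ := w + w + w * (m * w) + w + w + 2

/-- The marks leave source states alternating with strings made of a layer and a target state; a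
layer has a fixed length and needs no mark. The first source state follows the two characteristic
vectors without a mark, so it is the rest of that string. -/
def transitions : List (ℕ × List Bool × ℕ) :=
  (groupPairs (((vectors segs).drop ((sizes segs).2.2 + (sizes segs).2.2)) :: segs.drop 5)).map
    fun t => (ofBitsCap (sizes segs).2.2 t.1, t.2.take (codeLength (sizes segs).1 (sizes segs).2.1),
      ofBitsCap (sizes segs).2.2 (t.2.drop (codeLength (sizes segs).1 (sizes segs).2.1)))

def subsets : List (List Bool) := allLists [false, true] (sizes segs).2.1

/-- The adjacency lists of the counting automaton, the vector of the numbers of functions of no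
variables, and the index of the initial state. -/
def countData : (List (List ℕ) × List ℕ) × ℕ :=
  ((adjacency (stepIndex (sizes segs).1 (sizes segs).2.1 (subsets segs)) (sizes segs).1
      (subsets segs).length (transitions segs) (pairs (sizes segs).2.2 (subsets segs).length),
    baseVector (subsets segs).length (nonemptyIndex (subsets segs))
      (fun q => (accepts segs).getD q false) (pairs (sizes segs).2.2 (subsets segs).length)),
    startIndex (subsets segs).length ((subsets segs).idxOf (List.replicate (sizes segs).2.1 false))
      (fun q => (starts segs).getD q false) (pairs (sizes segs).2.2 (subsets segs).length))

def sizeBound : ℕ := blowup (sizes segs).1 (sizes segs).2.1 (sizes segs).2.2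

end

theorem length_subsets (segs : List (List Bool)) : (subsets segs).length = 2 ^ (sizes segs).2.1 := by
  rw [subsets, length_allLists]
  rfl

theorem polyB_sizes : PolyB sizeBound sizes := by
  have h (i : ℕ) : PolyB sizeBound fun segs : List (List Bool) => segs.getD i [] :=
    PolyB.id.getD (PolyB.const i) (PolyB.const [])
  exact (PolyB.ofBits (h 0) (PolyBd.of_le fun _ => (params_le_blowup _ _ _).1.trans
    (Nat.le_add_right _ _))).pair ((PolyB.ofBits (h 1) (PolyBd.of_le fun _ =>
      (params_le_blowup _ _ _).2.1.trans (Nat.le_add_right _ _))).pair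
      (PolyB.ofBits (h 2) (PolyBd.of_le fun _ => (params_le_blowup _ _ _).2.2.trans
        (Nat.le_add_right _ _))))

theorem polyB_subsets : PolyB sizeBound subsets :=
  (PolyB.const _).allLists polyB_sizes.snd.fst (PolyBd.of_le fun _ =>
    (three_pow_le_blowup _ _ _).trans (Nat.le_add_right _ _))

theorem polyB_vectors : PolyB sizeBound vectors := PolyB.id.getD (PolyB.const 4) (PolyB.const [])

theorem polyB_starts : PolyB sizeBound starts := polyB_vectors.take polyB_sizes.snd.snd

theorem polyB_accepts : PolyB sizeBound accepts :=
  (polyB_vectors.drop polyB_sizes.snd.snd).take polyB_sizes.snd.snd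

theorem polyB_transitions : PolyB sizeBound transitions := by
  have hm := polyB_sizes.fst
  have hw := polyB_sizes.snd.fst
  have hn := polyB_sizes.snd.snd
  have hc : PolyB sizeBound fun segs => codeLength (sizes segs).1 (sizes segs).2.1 :=
    (((((hw.add hw).add (hw.mul (hm.mul hw))).add hw).add hw).add (PolyB.const 2))
  exact PolyB.map (f := fun segs t => (ofBitsCap (sizes segs).2.2 t.1,
      t.2.take (codeLength (sizes segs).1 (sizes segs).2.1),
      ofBitsCap (sizes segs).2.2 (t.2.drop (codeLength (sizes segs).1 (sizes segs).2.1))))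
    (PolyB.groupPairs ((polyB_vectors.drop (hn.add hn)).cons (PolyB.id.drop (PolyB.const 5))))
    ((hn.lift.ofBitsCap PolyB.id.snd.fst).pair ((PolyB.id.snd.snd.take hc.lift).pair
      (hn.lift.ofBitsCap (PolyB.id.snd.snd.drop hc.lift))))

theorem polyB_pairs :
    PolyB sizeBound fun segs => pairs (sizes segs).2.2 (subsets segs).length := by
  have hW := polyB_subsets.length
  refine PolyB.flatMap (f := fun segs q => (allLists (List.range ((subsets segs).length + 1))
    (subsets segs).length).map fun ρ => (q, ρ)) polyB_sizes.snd.snd.range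
    ((((hW.add (PolyB.const 1)).range.allLists hW (PolyBd.of_le fun _ => ?_)).lift).map
      (PolyB.id.fst.snd.pair PolyB.id.snd))
  rw [List.length_range, length_subsets]
  exact (assignments_le_blowup _ _ _).trans (Nat.le_add_right _ _)

theorem length_pairs (n W : ℕ) : (pairs n W).length = n * (W + 1) ^ W := by
  simp [pairs, length_allLists]

theorem polyB_countStates : PolyB sizeBound fun segs =>
    countStates (subsets segs).length (pairs (sizes segs).2.2 (subsets segs).length) := by
  refine PolyB.flatMap (f := fun segs N => (pairs (sizes segs).2.2 (subsets segs).length).sublists'.map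
    fun X => (N, X)) (polyB_subsets.length.add (PolyB.const 1)).range
    ((polyB_pairs.sublists' (PolyBd.of_le fun _ => ?_)).lift.map (PolyB.id.fst.snd.pair PolyB.id.snd))
  rw [length_pairs, length_subsets]
  exact (subsets_le_blowup _ _ _).trans (Nat.le_add_right _ _)

/-- `PolyB.map` asks for a bound at every number `N`, and for `N` beyond `W` the number of canonical
layers would exceed it; hence the cut-off. -/
theorem polyB_layerTable : PolyB sizeBound fun segs => (List.range ((subsets segs).length + 1)).map
    fun N => canonicalLayers (sizes segs).1 (subsets segs).length
      (if decide (N < (subsets segs).length) = true then N else (subsets segs).length) := by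
  have hW := polyB_subsets.length
  refine (hW.add (PolyB.const 1)).range.map (f := fun segs N =>
    canonicalLayers (sizes segs).1 (subsets segs).length
      (if decide (N < (subsets segs).length) = true then N else (subsets segs).length))
    (polyB_sizes.fst.lift.canonicalLayers polyB_subsets.lift
      (PolyB.ite (PolyB.id.snd.lt hW.lift) PolyB.id.snd hW.lift) (PolyBd.of_le fun p => ?_)
      (PolyBd.of_le fun p => ?_))
  · rw [length_subsets]
    exact (rows_le_blowup _ _ _).trans (Nat.le_add_right _ _)
  · refine (Nat.pow_le_pow_right (Nat.succ_pos _) (?_ : _ ≤ (subsets p.1).length)).trans ?_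
    · simp only [decide_eq_true_eq]
      split <;> omega
    · rw [length_subsets]
      exact (layers_le_blowup _ _ _).trans (Nat.le_add_right _ _)

theorem polyB_adjacency : PolyB sizeBound fun segs =>
    adjacency (stepIndex (sizes segs).1 (sizes segs).2.1 (subsets segs)) (sizes segs).1
      (subsets segs).length (transitions segs) (pairs (sizes segs).2.2 (subsets segs).length) := by
  have hm := polyB_sizes.fst
  have hw := polyB_sizes.snd.fst
  refine PolyB.congr_enc (f := fun segs => (countStates (subsets segs).length
    (pairs (sizes segs).2.2 (subsets segs).length)).map fun st =>
    (((List.range ((subsets segs).length + 1)).map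
      fun N => canonicalLayers (sizes segs).1 (subsets segs).length
        (if decide (N < (subsets segs).length) = true then N else (subsets segs).length)).getD
          st.1 []).map fun κ =>
      (countStates (subsets segs).length (pairs (sizes segs).2.2 (subsets segs).length)).idxOf
        ((growth κ.flatten).2, nextPairs (stepIndex (sizes segs).1 (sizes segs).2.1 (subsets segs))
          (sizes segs).1 (subsets segs).length (transitions segs)
          (pairs (sizes segs).2.2 (subsets segs).length) st.1 st.2 κ)) ?_ fun segs => ?_
  · refine polyB_countStates.map ((polyB_layerTable.lift.getD PolyB.id.snd.fst (PolyB.const [])).map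
      (polyB_countStates.lift.lift.idxOf ((PolyB.growth PolyB.id.snd.flatten).snd.pair
        (hm.lift.lift.nextPairs hw.lift.lift polyB_subsets.lift.lift PolyB.id.fst.snd.fst
          polyB_transitions.lift.lift polyB_pairs.lift.lift PolyB.id.fst.snd.snd PolyB.id.snd))))
  -- The first component of a state is at most `W`, so the cut-off in the table has no effect.
  · refine congrArg enc (List.map_congr_left fun st hst => ?_)
    have h := (mem_countStates.1 hst).1
    refine congrArg (List.map _) ?_
    rw [List.getD_eq_getElem _ _ (by simpa using Nat.lt_succ_of_le h), List.getElem_map,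
      List.getElem_range]
    refine congrArg (canonicalLayers _ _) ?_
    simp only [decide_eq_true_eq]
    split <;> omega

theorem polyB_baseVector : PolyB sizeBound fun segs =>
    baseVector (subsets segs).length (nonemptyIndex (subsets segs))
      (fun q => (accepts segs).getD q false) (pairs (sizes segs).2.2 (subsets segs).length) := by
  have h := polyB_subsets.lift.baseCount (polyB_accepts.lift (γ := ℕ × List (ℕ × List ℕ)))
    PolyB.id.snd.fst PolyB.id.snd.snd
  exact polyB_countStates.map h

theorem polyB_startIndex : PolyB sizeBound fun segs =>
    startIndex (subsets segs).length ((subsets segs).idxOf (List.replicate (sizes segs).2.1 false))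
      (fun q => (starts segs).getD q false) (pairs (sizes segs).2.2 (subsets segs).length) := by
  have hw := polyB_sizes.snd.fst
  have hi : PolyB sizeBound fun segs : List (List Bool) =>
      (subsets segs).idxOf (List.replicate (sizes segs).2.1 false) :=
    polyB_subsets.idxOf (hw.replicate (PolyB.const false))
  refine polyB_countStates.idxOf ((PolyB.const 1).pair (polyB_pairs.filter (f := fun segs x =>
    (starts segs).getD x.1 false &&
      decide (x.2.getD ((subsets segs).idxOf (List.replicate (sizes segs).2.1 false)) 0 = 0)) ?_))
  exact (polyB_starts.lift.getD PolyB.id.snd.fst (PolyB.const false)).and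
    ((PolyB.id.snd.snd.getD hi.lift (PolyB.const 0)).eq_nat (PolyB.const 0))

theorem polyB_countData : PolyB sizeBound countData :=
  (polyB_adjacency.pair polyB_baseVector).pair polyB_startIndex

/-! ### Multiplication with a matrix, column by column in binary -/

theorem mapAcc_append {β γ σ : Type} (g : σ → β → σ × γ) (s : σ) (l l' : List β) :
    mapAcc g s (l ++ l') = ((mapAcc g (mapAcc g s l).1 l').1,
      (mapAcc g s l).2 ++ (mapAcc g (mapAcc g s l).1 l').2) := by
  induction l generalizing s with
  | nil => rfl
  | cons x l ih => simp [mapAcc, ih]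

theorem getD_map_range {γ : Type} (f : ℕ → γ) {n i : ℕ} (h : i < n) (d : γ) :
    ((List.range n).map f).getD i d = f i := by
  simp [List.getD_eq_getElem?_getD, h]

/-- The sum of a carry and the entries of a column that belong to a row. -/
def total (G : List (List ℕ)) (c : List ℕ) (col : List Bool) (i : ℕ) : ℕ :=
  c.getD i 0 + ((G.getD i []).filter fun j => col.getD j false).length

/-- The carries and the digits of the next column of the product. -/
def columnStep (s : List (List ℕ) × List ℕ) (col : List Bool) :
    (List (List ℕ) × List ℕ) × List Bool :=
  ((s.1, (List.range s.1.length).map fun i => total s.1 s.2 col i / 2),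
    (List.range s.1.length).map fun i => decide (total s.1 s.2 col i % 2 = 1))

/-- The number whose digits are the entries with index `j` of the columns. -/
def columnValue (cols : List (List Bool)) (j : ℕ) : ℕ := ofBits (cols.map fun col => col.getD j false)

theorem columnValue_cons (col : List Bool) (cols : List (List Bool)) (j : ℕ) :
    columnValue (col :: cols) j =
      2 * columnValue cols j + if col.getD j false = true then 1 else 0 := by
  rw [two_mul]
  rfl

theorem mapAcc_columnStep_fst (s : List (List ℕ) × List ℕ) (cols : List (List Bool)) :
    (mapAcc columnStep s cols).1.1 = s.1 := by
  induction cols generalizing s with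
  | nil => rfl
  | cons col cols ih => exact ih _

theorem sum_columnValue_cons (r : List ℕ) (col : List Bool) (cols : List (List Bool)) :
    (r.map (columnValue (col :: cols))).sum =
      2 * (r.map (columnValue cols)).sum + (r.filter fun j => col.getD j false).length := by
  induction r with
  | nil => rfl
  | cons j r ih =>
    rw [List.map_cons, List.sum_cons, ih, List.map_cons, List.sum_cons, columnValue_cons,
      List.filter_cons]
    split <;> simp <;> ring

/-- The invariant of addition with carry in one row: the digits written, together with the remaining
carry at its weight, represent the initial carry plus the sum. Each column splits its total into
quotient and remainder modulo 2. -/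
theorem columnValue_mapAcc (G : List (List ℕ)) (c : List ℕ) (cols : List (List Bool)) {i : ℕ}
    (hi : i < G.length) :
    columnValue (mapAcc columnStep (G, c) cols).2 i +
      2 ^ cols.length * (mapAcc columnStep (G, c) cols).1.2.getD i 0 =
    c.getD i 0 + ((G.getD i []).map (columnValue cols)).sum := by
  induction cols generalizing c with
  | nil =>
    have : ∀ l : List ℕ, (l.map (columnValue [])).sum = 0 := by
      intro l
      induction l with
      | nil => rfl
      | cons x l ih => rw [List.map_cons, List.sum_cons, ih]; rfl
    rw [this]
    simp [mapAcc, columnValue, ofBits]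
  | cons col cols ih =>
    have h := ih ((List.range G.length).map fun i => total G c col i / 2)
    rw [getD_map_range _ hi] at h
    have hd : (columnStep (G, c) col).2.getD i false = decide (total G c col i % 2 = 1) :=
      getD_map_range _ hi _
    rw [mapAcc, sum_columnValue_cons, columnValue_cons, hd]
    simp only [columnStep, List.length_cons, pow_succ, decide_eq_true_eq] at h ⊢
    have h₂ : total G c col i =
      c.getD i 0 + ((G.getD i []).filter fun j => col.getD j false).length := rfl
    have h₃ : (if total G c col i % 2 = 1 then 1 else 0) = total G c col i % 2 := by
      split <;> omega
    rw [h₃, mul_comm (2 ^ cols.length) 2, mul_assoc]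
    omega

theorem getD_carry_eq_zero {s : List (List ℕ) × List ℕ} {col : List Bool} {i : ℕ}
    (hi : s.1.length ≤ i) : (columnStep s col).1.2.getD i 0 = 0 := by
  simp [columnStep, List.getD_eq_getElem?_getD, hi]

/-- A column contributes at most `M` to a row, and `(M + M) / 2 ≤ M`. -/
theorem carry_le {M : ℕ} {G : List (List ℕ)} (hG : ∀ r ∈ G, r.length ≤ M) (c : List ℕ)
    (hc : ∀ i, c.getD i 0 ≤ M) (cols : List (List Bool)) (i : ℕ) :
    (mapAcc columnStep (G, c) cols).1.2.getD i 0 ≤ M := by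
  induction cols generalizing c with
  | nil => exact hc i
  | cons col cols ih =>
    refine ih _ fun i => ?_
    rcases lt_or_ge i G.length with hi | hi
    · rw [getD_map_range _ hi]
      have h₁ := List.length_filter_le (fun j => col.getD j false) (G.getD i [])
      have h₂ := hG (G.getD i []) (by rw [List.getD_eq_getElem _ _ hi]; exact List.getElem_mem _)
      have h₃ := hc i
      dsimp only [total]
      omega
    · exact (getD_carry_eq_zero (s := (G, c)) hi).le.trans (Nat.zero_le _)

/-- An empty column contributes nothing and halves the carry. -/
theorem carry_eq_zero {L : ℕ} {G : List (List ℕ)} (c : List ℕ) (hc : ∀ i, c.getD i 0 < 2 ^ L)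
    (i : ℕ) : (mapAcc columnStep (G, c) (List.replicate L [])).1.2.getD i 0 = 0 := by
  induction L generalizing c with
  | zero => exact Nat.lt_one_iff.1 (hc i)
  | succ L ih =>
    rw [List.replicate_succ]
    refine ih _ fun i => ?_
    rcases lt_or_ge i G.length with hi | hi
    · rw [getD_map_range _ hi]
      have h₃ := hc i
      rw [pow_succ] at h₃
      simp only [total, List.getD_nil, List.filter_false, List.length_nil]
      omega
    · exact (getD_carry_eq_zero (s := (G, c)) (col := []) hi).trans_lt (by positivity)

/-- Multiply the matrix with the adjacency lists `G` with the vector with the given digits and add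
the vector `c`. -/
def mulColumns (G : List (List ℕ)) (L : ℕ) (c : List ℕ) (cols : List (List Bool)) : List (List Bool) :=
  (mapAcc columnStep (G, c) (cols ++ List.replicate L [])).2

theorem length_mulColumns (G : List (List ℕ)) (L : ℕ) (c : List ℕ) (cols : List (List Bool)) :
    (mulColumns G L c cols).length = cols.length + L := by
  simp [mulColumns, length_mapAcc]

theorem length_of_mem_mulColumns {G : List (List ℕ)} {L : ℕ} {c : List ℕ} {cols : List (List Bool)}
    {col : List Bool} (h : col ∈ mulColumns G L c cols) : col.length = G.length := by
  have key : ∀ (l : List (List Bool)) (c : List ℕ), col ∈ (mapAcc columnStep (G, c) l).2 →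
      col.length = G.length := by
    intro l
    induction l with
    | nil => intro c h; cases h
    | cons x l ih =>
      intro c h
      rcases List.mem_cons.1 h with rfl | h
      · simp [columnStep]
      · exact ih _ h
  exact key _ _ h

theorem columnValue_eq_zero {cols : List (List Bool)} {n i : ℕ} (h : ∀ col ∈ cols, col.length = n)
    (hi : n ≤ i) : columnValue cols i = 0 := by
  induction cols with
  | nil => rfl
  | cons col cols ih =>
    rw [columnValue_cons, ih fun x hx => h x (by simp [hx])]
    have := h col (by simp)
    simp [List.getD_eq_getElem?_getD, this, hi]

theorem columnValue_append_replicate (cols : List (List Bool)) (L i : ℕ) :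
    columnValue (cols ++ List.replicate L []) i = columnValue cols i := by
  induction cols with
  | nil =>
    induction L with
    | zero => rfl
    | succ L ih =>
      rw [List.nil_append] at ih ⊢
      rw [List.replicate_succ, columnValue_cons, ih]
      rfl
  | cons col cols ih => rw [List.cons_append, columnValue_cons, ih, columnValue_cons]

/-- The carry after the given columns is at most `L < 2 ^ L`, so the `L` empty columns appended in
`mulColumns` flush it completely. -/
theorem columnValue_mulColumns {L : ℕ} {G : List (List ℕ)} (hG : ∀ r ∈ G, r.length ≤ L) (c : List ℕ)
    (hc : ∀ i, c.getD i 0 ≤ L) (cols : List (List Bool)) {i : ℕ} (hi : i < G.length) :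
    columnValue (mulColumns G L c cols) i =
      c.getD i 0 + ((G.getD i []).map (columnValue cols)).sum := by
  have h := columnValue_mapAcc G c (cols ++ List.replicate L []) hi
  have h₂ : (mapAcc columnStep (G, c) (cols ++ List.replicate L [])).1.2.getD i 0 = 0 := by
    rw [mapAcc_append]
    have e : (mapAcc columnStep (G, c) cols).1 = (G, (mapAcc columnStep (G, c) cols).1.2) :=
      Prod.ext (mapAcc_columnStep_fst _ _) rfl
    rw [e]
    exact carry_eq_zero _ (fun i => (carry_le hG c hc cols i).trans_lt Nat.lt_two_pow_self) i
  rw [h₂, mul_zero, add_zero] at h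
  rw [mulColumns, h, funext (columnValue_append_replicate cols L)]

/-- The iteration starts from the product with no columns and with carry `v`, which merely writes
`v` in binary. -/
theorem columnValue_iterate_mulColumns {L : ℕ} {G : List (List ℕ)} (hG : ∀ r ∈ G, r.length ≤ L)
    (v : List ℕ) (hv : ∀ i, v.getD i 0 ≤ L) (hl : v.length = G.length) (k i : ℕ) :
    columnValue ((mulColumns G L [])^[k] (mulColumns G L v [])) i = ((mulVec G)^[k] v).getD i 0 := by
  induction k generalizing i with
  | zero =>
    rw [Function.iterate_zero, id, Function.iterate_zero, id]
    rcases lt_or_ge i G.length with hi | hi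
    · rw [columnValue_mulColumns hG v hv _ hi]
      have : ∀ l : List ℕ, (l.map (columnValue [])).sum = 0 := by
        intro l
        induction l with
        | nil => rfl
        | cons x l ih => rw [List.map_cons, List.sum_cons, ih]; rfl
      rw [this, add_zero]
    · rw [columnValue_eq_zero (fun _ => length_of_mem_mulColumns) hi]
      simp [List.getD_eq_getElem?_getD, hl, hi]
  | succ k ih =>
    rw [Function.iterate_succ_apply', Function.iterate_succ_apply']
    rcases lt_or_ge i G.length with hi | hi
    · rw [columnValue_mulColumns hG [] (by simp) _ hi, mulVec,
        List.getD_eq_getElem (List.map _ G) _ (by simpa using hi),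
        List.getElem_map, List.getD_eq_getElem _ _ hi, List.getD_nil, zero_add]
      exact congrArg List.sum (List.map_congr_left fun j _ => ih j)
    · rw [columnValue_eq_zero (fun _ => length_of_mem_mulColumns) hi]
      simp [mulVec, List.getD_eq_getElem?_getD, hi]

theorem length_iterate_mulColumns (G : List (List ℕ)) (L : ℕ) (cols : List (List Bool)) (k : ℕ) :
    ((mulColumns G L [])^[k] cols).length = cols.length + k * L := by
  induction k with
  | zero => simp
  | succ k ih => rw [Function.iterate_succ_apply', length_mulColumns, ih]; ring

theorem length_of_mem_iterate_mulColumns {G : List (List ℕ)} {L : ℕ} {cols : List (List Bool)}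
    (h : ∀ col ∈ cols, col.length = G.length) (k : ℕ) :
    ∀ col ∈ (mulColumns G L [])^[k] cols, col.length = G.length := by
  cases k with
  | zero => exact h
  | succ k =>
    rw [Function.iterate_succ_apply']
    exact fun _ => length_of_mem_mulColumns

/-! ### Binary counters -/

/-- Subtract one. -/
def decrement (l : List Bool) : List Bool :=
  (mapAcc (fun (s : Bool) b => (s && !b, if s = true then !b else b)) true l).2

theorem length_decrement (l : List Bool) : (decrement l).length = l.length := length_mapAcc _ _ _

theorem ofBits_cons (b : Bool) (l : List Bool) :
    ofBits (b :: l) = 2 * ofBits l + if b = true then 1 else 0 := by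
  rw [two_mul]
  rfl

/-- At zero the borrow runs through and turns all digits into ones; hence the second alternative. -/
theorem ofBits_decrement (l : List Bool) : ofBits (decrement l) = ofBits l - 1 ∨ ofBits l = 0 := by
  have h₀ : ∀ l : List Bool,
      (mapAcc (fun (s : Bool) b => (s && !b, if s = true then !b else b)) false l).2 = l := by
    intro l
    induction l with
    | nil => rfl
    | cons b l ih => rw [mapAcc]; simpa using ih
  induction l with
  | nil => exact Or.inr rfl
  | cons b l ih =>
    cases b with
    | false =>
      have e : decrement (false :: l) = true :: decrement l := rfl
      rw [e, ofBits_cons, ofBits_cons]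
      simp
      omega
    | true =>
      have e : decrement (true :: l) = false :: l := congrArg (List.cons false) (h₀ l)
      rw [e, ofBits_cons, ofBits_cons]
      simp

theorem any_eq_decide (l : List Bool) : (l.any fun b => b) = decide (0 < ofBits l) := by
  induction l with
  | nil => rfl
  | cons b l ih =>
    rw [List.any_cons, ih, ofBits_cons, Bool.eq_iff_iff]
    cases b <;> simp

theorem any_iterate_decrement (l : List Bool) (i : ℕ) (hi : i ≤ ofBits l) :
    ofBits (decrement^[i] l) = ofBits l - i := by
  induction i with
  | zero => rfl
  | succ i ih =>
    rw [Function.iterate_succ_apply']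
    have := ih (by omega)
    rcases ofBits_decrement (decrement^[i] l) with h | h <;> omega

theorem ofBits_append_false (l : List Bool) : ofBits (l ++ [false]) = ofBits l := by
  induction l with
  | nil => rfl
  | cons b l ih => rw [List.cons_append, ofBits_cons, ih, ofBits_cons]

theorem bits_ofBits_append_true (l : List Bool) :
    Nat.bits (ofBits (l ++ [true])) = l ++ [true] ∧ ofBits (l ++ [true]) ≠ 0 := by
  induction l with
  | nil => simp [ofBits]
  | cons b l ih =>
    have e : ofBits (b :: (l ++ [true])) = Nat.bit b (ofBits (l ++ [true])) := by
      rw [ofBits_cons, Nat.bit_val]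
      cases b <;> rfl
    rw [List.cons_append, e, Nat.bits_append_bit _ _ fun h => absurd h ih.2, ih.1]
    refine ⟨rfl, fun h => ih.2 ?_⟩
    rw [Nat.bit_val] at h
    omega

/-- Removal of leading zeros. -/
theorem reverse_dropWhile_eq_bits (l : List Bool) :
    (l.dropWhile fun b => !b).reverse = Nat.bits (ofBits l.reverse) := by
  induction l with
  | nil => simp [ofBits]
  | cons b l ih =>
    cases b with
    | false =>
      rw [List.reverse_cons, ofBits_append_false, ← ih]
      rfl
    | true =>
      rw [List.reverse_cons, (bits_ofBits_append_true _).1]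
      simp

/-! ### The running time of the iteration -/

namespace Prog

/-- Append two lists, in linear time. -/
def append : Prog := .pop 0 ;; moveTo 1 ;; .pop 1 ;; moveFrom 1

end Prog

section

variable {α β γ : Type} [Enc α] [Enc β] [Enc γ]

/-- The code of a list ends with the leaf for the empty list, and replacing this leaf by another
list appends it. This gives an append in linear time, which the general fold does not provide. -/
theorem code_enc_list (l : List β) : ∃ c : List (Option Bool), (∀ y ∈ c, y ≠ none) ∧
    (enc l).code = c ++ [some false] ∧
    ∀ l' : List β, (enc (l ++ l')).code = c ++ (enc l').code := by
  induction l with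
  | nil => exact ⟨[], by simp, rfl, fun _ => rfl⟩
  | cons x l ih =>
    obtain ⟨c, h₀, h₁, h₂⟩ := ih
    refine ⟨some true :: ((enc x).code ++ c), ?_, ?_, fun l' => ?_⟩
    · intro y hy
      rcases List.mem_cons.1 hy with rfl | hy
      · simp
      · exact (List.mem_append.1 hy).elim V.ne_none_of_mem_code (h₀ y)
    · rw [enc_cons, V.code, h₁]
      simp
    · rw [List.cons_append, enc_cons, V.code, h₂]
      simp

theorem Computes.append (l l' : List β) :
    Computes Prog.append (enc (l, l')) (enc (l ++ l')) (10 * sz l + 8) := fun v r s u => by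
  obtain ⟨c, h₀, h₁, h₂⟩ := code_enc_list l
  have h₃ : sz l = c.length + 1 := by rw [sz, V.size, h₁]; simp
  have h₄ := Run.pour (some (some false)) (k := 1) (p := .put 0)
    (fun d l => ⟨d ++ ((enc l').code ++ r), l, u, []⟩)
    (fun _ _ => rfl) (fun _ _ _ => rfl) (fun _ _ _ => Run.put _ _ _) c.reverse [] s
    (fun y hy => h₀ y (List.mem_reverse.1 hy))
  have h₅ := Run.moveTo_one (some (some true)) (enc l) ((enc l').code ++ r) s u
  have e : (enc l).code.reverse = some false :: c.reverse := by rw [h₁]; simp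
  rw [e] at h₅
  rw [List.reverse_reverse, List.length_reverse, List.append_nil] at h₄
  rw [enc_pair, code_cons_append, h₂, List.append_assoc]
  refine ⟨_, ((Run.pop _ _ _).seq (h₅.seq ((Run.pop _ _ _).seq h₄))).mono ?_⟩
  rw [size_enc]
  omega

namespace Computes

variable {K : ℕ}

theorem fst' {a : α} {b : β} (h : sz (a, b) ≤ K) :
    Computes Prog.fstP (enc (a, b)) (enc a) (20 * K + 20) :=
  (Computes.fst _ _).mono (by rw [sz_pair] at h; simp only [size_enc]; omega)

theorem snd' {a : α} {b : β} (h : sz (a, b) ≤ K) :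
    Computes Prog.sndP (enc (a, b)) (enc b) (20 * K + 20) :=
  (Computes.snd _ _).mono (by rw [sz_pair] at h; simp only [size_enc]; omega)

theorem pair' {p q : Prog} {a : α} {b : β} {c : γ} {T₁ T₂ : ℕ} (hp : Computes p (enc a) (enc b) T₁)
    (hq : Computes q (enc a) (enc c) T₂) (ha : sz a ≤ K) (hc : sz c ≤ K) :
    Computes (Prog.pair p q) (enc a) (enc (b, c)) (T₁ + T₂ + 37 * K + 25) :=
  (Computes.pair hp hq).mono (by simp only [size_enc]; omega)

end Computes

theorem PolyB.divTwo {B : α → ℕ} {f : α → ℕ} (hf : PolyB B f) :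
    PolyB B fun a => (decide (f a % 2 = 1), f a / 2) := by
  have key : ∀ n, (List.replicate n ()).foldl
      (fun (s : Bool × ℕ) _ => (!s.1, if s.1 = true then s.2 + 1 else s.2)) (false, 0) =
      (decide (n % 2 = 1), n / 2) := by
    intro n
    induction n with
    | zero => rfl
    | succ n ih =>
      rw [List.replicate_succ', List.foldl_append, ih]
      rcases Nat.mod_two_eq_zero_or_one n with h | h <;>
        simp [h, Nat.add_mod, Prod.ext_iff] <;> omega
  refine (foldl (g := fun _ (s : Bool × ℕ) (_ : Unit) => (!s.1, if s.1 = true then s.2 + 1 else s.2))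
    (s₀ := fun _ => (false, 0)) (fun a => sz (f a) + 4) hf.units (const _)
    (id.snd.fst.fst.not.pair (ite id.snd.fst.fst (id.snd.fst.snd.add (const 1)) id.snd.fst.snd))
    (hf.bd.add (PolyBd.const _ 4)) fun a l₁ h => ?_).congr_enc fun a => by rw [key]
  have h₁ : l₁ = List.replicate l₁.length () := by rw [List.eq_replicate_iff]; simp
  have h₂ := h.length_le
  rw [List.length_replicate] at h₂
  rw [h₁, key, sz_pair, PolyB.sz_nat, PolyB.sz_nat]
  have := PolyB.sz_bool_le (decide (l₁.length % 2 = 1))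
  omega

theorem polyT_columnStep :
    PolyT fun p : (List (List ℕ) × List ℕ) × List Bool => columnStep p.1 p.2 := by
  have ht : PolyT fun p : ((List (List ℕ) × List ℕ) × List Bool) × ℕ =>
      total p.1.1.1 p.1.1.2 p.1.2 p.2 :=
    (PolyB.id.fst.fst.snd.getD PolyB.id.snd (PolyB.const 0)).add
      ((PolyB.id.fst.fst.fst.getD PolyB.id.snd (PolyB.const [])).filter
        (f := fun (p : ((List (List ℕ) × List ℕ) × List Bool) × ℕ) j => p.1.2.getD j false)
        (PolyB.id.fst.fst.snd.getD PolyB.id.snd (PolyB.const false))).length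
  have hr : PolyT fun p : (List (List ℕ) × List ℕ) × List Bool => List.range p.1.1.length :=
    PolyB.id.fst.fst.length.range
  exact (PolyB.id.fst.fst.pair (hr.map ht.divTwo.snd)).pair (hr.map ht.divTwo.fst)

/-- Both are lists of leaves, so the unary number `L` serves as a list of `L` empty columns without
any computation. -/
theorem enc_replicate_nil (L : ℕ) : enc (List.replicate L ([] : List Bool)) = enc L := by
  rw [PolyB.enc_nat]
  induction L with
  | zero => rfl
  | succ L ih => rw [List.replicate_succ, List.replicate_succ, enc_cons, ih]; rfl

theorem sz_columns_le {cols : List (List Bool)} {n : ℕ} (h : ∀ col ∈ cols, col.length ≤ n) :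
    sz cols ≤ cols.length * (4 * n + 2) + 1 := by
  refine (PolyB.sz_le_of_forall (M := 4 * n + 1) fun col hc => ?_)
  refine (PolyB.sz_le_of_forall (M := 3) fun b _ => PolyB.sz_bool_le b).trans ?_
  have := h col hc
  omega

theorem sz_numbers_le {c : List ℕ} {n L : ℕ} (h : ∀ i, c.getD i 0 ≤ L) (hn : c.length ≤ n) :
    sz c ≤ n * (2 * L + 2) + 1 := by
  refine (PolyB.sz_le_of_forall (M := 2 * L + 1) fun x hx => ?_).trans
    (Nat.add_le_add_right (Nat.mul_le_mul_right _ hn) 1)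
  obtain ⟨i, hi, rfl⟩ := List.getElem_of_mem hx
  have := h i
  rw [List.getD_eq_getElem _ _ hi] at this
  rw [PolyB.sz_nat]
  omega

theorem length_carry_le (G : List (List ℕ)) (cols : List (List Bool)) (c : List ℕ)
    (hc : c.length ≤ G.length) :
    (mapAcc columnStep (G, c) cols).1.2.length ≤ G.length := by
  induction cols generalizing c with
  | nil => exact hc
  | cons col cols ih => exact ih _ (by simp)

/-- The multiplication takes time that is linear in the number of columns. -/
theorem exists_mulColumns : ∃ (p : Prog) (E : List (List ℕ) × ℕ → ℕ),
    PolyBd (fun x => sz x.1 + x.2) E ∧ ∀ (G : List (List ℕ)) (L : ℕ) (cols : List (List Bool)),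
      (∀ r ∈ G, r.length ≤ L) → (∀ col ∈ cols, col.length = G.length) →
      Computes p (enc ((G, L), cols)) (enc ((G, L), mulColumns G L [] cols))
        ((cols.length + L + 1) * E (G, L)) := by
  obtain ⟨p, T, hp, ⟨c₁, hT⟩, ⟨c₂, hs⟩⟩ := polyT_columnStep
  -- `Z` bounds the matrix and the carries together with one column, and `M` a single step. Neither
  -- involves the number of columns, which enters only through the factor `N`.
  let Z : List (List ℕ) × ℕ → ℕ := fun x => (sz x.1 + x.2 + 2) * (2 * (sz x.1 + x.2) + 10)
  let M : List (List ℕ) × ℕ → ℕ := fun x => (Z x + 2) ^ c₁ + (Z x + 2) ^ c₂ + Z x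
  have hX : PolyBd (fun x : List (List ℕ) × ℕ => sz x.1 + x.2) fun x => sz x.1 + x.2 :=
    PolyBd.self _
  have hZ : PolyBd (fun x => sz x.1 + x.2) Z :=
    (hX.add (PolyBd.const _ 2)).mul (((PolyBd.const _ 2).mul hX).add (PolyBd.const _ 10))
  have hM : PolyBd (fun x => sz x.1 + x.2) M :=
    (((hZ.add (PolyBd.const _ 2)).pow c₁).add ((hZ.add (PolyBd.const _ 2)).pow c₂)).add hZ
  refine ⟨Prog.pair Prog.fstP (Prog.pair (Prog.pair (Prog.fstP ;; Prog.fstP) Prog.nilP)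
      (Prog.pair Prog.sndP (Prog.fstP ;; Prog.sndP) ;; Prog.append) ;; Prog.mapAcc p ;; Prog.sndP),
    fun x => 1000 * Z x + (21 * M x + 30) + 1000, ((((PolyBd.const _ 1000).mul hZ).add
      (((PolyBd.const _ 21).mul hM).add (PolyBd.const _ 30))).add (PolyBd.const _ 1000)),
    fun G L cols hG hcols => ?_⟩
  set N := cols.length + L + 1
  set z := Z (G, L)
  have hz : z = (sz G + L + 2) * (2 * (sz G + L) + 10) := rfl
  have hG₁ := PolyB.length_lt_sz G
  have hcol : ∀ l : List (List Bool), (∀ col ∈ l, col.length ≤ G.length) →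
      l.length ≤ cols.length + L → sz l ≤ N * z := by
    intro l h hl
    refine (sz_columns_le h).trans ?_
    have h₁ : l.length * (4 * G.length + 2) ≤ (cols.length + L) * (4 * G.length + 2) :=
      Nat.mul_le_mul_right _ hl
    have h₂ : 4 * G.length + 2 ≤ z := by rw [hz]; nlinarith
    have h₃ := Nat.mul_le_mul_left (cols.length + L) h₂
    have : N * z = (cols.length + L) * z + z := by simp only [N]; ring
    omega
  have hGL : sz (G, L) + 10 ≤ z := by
    rw [sz_pair, PolyB.sz_nat, hz]
    nlinarith
  have hzN : z ≤ N * z := Nat.le_mul_of_pos_left _ (by simp [N])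
  have hcols' : ∀ col ∈ cols ++ List.replicate L [], col.length ≤ G.length := by
    intro col h
    rcases List.mem_append.1 h with h | h
    · exact (hcols col h).le
    · rw [List.eq_of_mem_replicate h]; exact Nat.zero_le _
  have hst : ∀ l : List (List Bool), sz (mapAcc columnStep (G, []) l).1 + 3 ≤ z - 4 * G.length - 2 := by
    intro l
    have h₁ := sz_numbers_le (n := G.length) (carry_le hG [] (by simp) l)
      (length_carry_le G l [] (by simp))
    rw [sz_prod, mapAcc_columnStep_fst]
    have : G.length * (2 * L + 2) + sz G + 10 + 4 * G.length + 2 ≤ z := by rw [hz]; nlinarith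
    dsimp only
    omega
  have h₁ : sz cols ≤ N * z := hcol _ (fun col h => (hcols col h).le) (by omega)
  have h₂ : sz (cols ++ List.replicate L []) ≤ N * z := hcol _ hcols' (by simp)
  have h₃ : sz (mulColumns G L [] cols) ≤ N * z :=
    hcol _ (fun col h => (length_of_mem_mulColumns h).le) (length_mulColumns _ _ _ _).le
  have h₄ : sz (mapAcc columnStep (G, []) (cols ++ List.replicate L [])) ≤ 2 * (N * z) := by
    have := hst (cols ++ List.replicate L [])
    rw [sz_prod]
    change _ + sz (mulColumns G L [] cols) + 1 ≤ _
    omega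
  have h₅ : sz ((G, L), cols) ≤ 2 * (N * z) := by rw [sz_pair]; omega
  have h₆ : sz (List.replicate L ([] : List Bool)) ≤ N * z := by
    rw [sz, enc_replicate_nil]
    change sz L ≤ _
    rw [sz_pair] at hGL
    omega
  have e₁ : Computes (Prog.pair (Prog.fstP ;; Prog.fstP) Prog.nilP) (enc ((G, L), cols))
      (enc (G, ([] : List ℕ))) (200 * (N * z) + 100) :=
    (Computes.pair' ((Computes.fst' h₅).seq (Computes.fst' (K := N * z) (by omega)))
      (Computes.nil (enc ((G, L), cols))) h₅ (by rw [sz_nil]; omega)).mono (by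
        rw [size_enc]
        omega)
  have e₂ : Computes (Prog.pair Prog.sndP (Prog.fstP ;; Prog.sndP) ;; Prog.append)
      (enc ((G, L), cols)) (enc (cols ++ List.replicate L [])) (240 * (N * z) + 120) := by
    have h : Computes (Prog.fstP ;; Prog.sndP) (enc ((G, L), cols))
        (enc (List.replicate L ([] : List Bool)))
        (20 * (2 * (N * z)) + 20 + (20 * (N * z) + 20)) := by
      rw [enc_replicate_nil]
      exact (Computes.fst' h₅).seq (Computes.snd' (K := N * z) (by omega))
    exact ((Computes.pair' (Computes.snd' h₅) h h₅ (by omega)).seq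
      (Computes.append _ _)).mono (by omega)
  have e₃ : Computes (Prog.mapAcc p) (enc ((G, ([] : List ℕ)), cols ++ List.replicate L []))
      (enc (mapAcc columnStep (G, []) (cols ++ List.replicate L []))) (N * (21 * M (G, L) + 30)) := by
    have hle : z ≤ M (G, L) := Nat.le_add_left _ _
    refine (Computes.mapAcc (M := M (G, L)) (G, ([] : List ℕ)) (cols ++ List.replicate L [])
      ((by have := hst []; simp only [mapAcc] at this; omega : sz (G, ([] : List ℕ)) ≤ z).trans hle)
      fun l₁ x l₂ hl => ?_).mono (by simp [N])
    have hx : sz ((mapAcc columnStep (G, []) l₁).1, x) ≤ z := by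
      have h₁ := hst l₁
      have h₂ : sz x ≤ 4 * G.length + 1 := (PolyB.sz_le_of_forall (M := 3) fun b _ => PolyB.sz_bool_le b).trans (by
        have := hcols' x (by rw [hl]; simp)
        omega)
      rw [sz_pair]
      omega
    constructor
    · refine (hp ((mapAcc columnStep (G, []) l₁).1, x)).mono ((hT _).trans ?_)
      refine (Nat.pow_le_pow_left (?_ : _ ≤ z + 2) _).trans ((Nat.le_add_right _ _).trans
        (Nat.le_add_right _ _))
      exact Nat.add_le_add_right ((zero_add _).trans_le hx) 2
    · refine (hs ((mapAcc columnStep (G, []) l₁).1, x)).trans ?_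
      refine (Nat.pow_le_pow_left (?_ : _ ≤ z + 2) _).trans ((Nat.le_add_left _ _).trans
        (Nat.le_add_right _ _))
      exact Nat.add_le_add_right ((zero_add _).trans_le hx) 2
  refine (Computes.pair' (K := 2 * (N * z)) (Computes.fst' h₅) ((e₁.pair' e₂ h₅ (by omega)).seq
    (e₃.seq (Computes.snd' h₄))) h₅ (h₃.trans (by omega))).mono ?_
  have : N * (1000 * z + (21 * M (G, L) + 30) + 1000) =
    1000 * (N * z) + N * (21 * M (G, L) + 30) + 1000 * N := by ring
  have : 1 ≤ N := by simp [N]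
  change _ ≤ N * (1000 * z + (21 * M (G, L) + 30) + 1000)
  omega

end

theorem polyT_decrement : PolyT decrement :=
  PolyB.snd (PolyB.mapAcc (g := fun _ (s : Bool) b => (s && !b, if s = true then !b else b))
    (s₀ := fun _ => true) (fun _ => 3) PolyB.id (PolyB.const _)
    ((PolyB.id.snd.fst.and PolyB.id.snd.snd.not).pair
      (PolyB.ite PolyB.id.snd.fst PolyB.id.snd.snd.not PolyB.id.snd.snd))
    (PolyBd.const _ 3) fun _ _ _ => PolyB.sz_bool_le _)

theorem length_iterate_decrement (l : List Bool) (i : ℕ) : (decrement^[i] l).length = l.length := by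
  induction i with
  | zero => rfl
  | succ i ih => rw [Function.iterate_succ_apply', length_decrement, ih]

theorem sz_bools_le (l : List Bool) : sz l ≤ 4 * l.length + 1 :=
  (PolyB.sz_le_of_forall (M := 3) fun b _ => PolyB.sz_bool_le b).trans (by omega)

theorem mapAcc_const {β γ σ : Type} (f : σ → β → γ) (s : σ) (l : List β) :
    mapAcc (fun s x => (s, f s x)) s l = (s, l.map (f s)) := by
  induction l with
  | nil => rfl
  | cons x l ih => rw [mapAcc, ih, List.map_cons]

/-- Iterated multiplication, where the number of iterations is given in binary. -/
theorem exists_iteration : ∃ (p : Prog) (D : List Bool → ℕ) (E : (List (List ℕ) × ℕ) × ℕ → ℕ),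
    PolyBd (fun kb => sz kb) D ∧ PolyBd (fun x => sz x.1.1 + x.1.2 + x.2) E ∧
    ∀ (kb : List Bool) (G : List (List ℕ)) (L : ℕ) (cols : List (List Bool)) (i : ℕ),
      (∀ r ∈ G, r.length ≤ L) → (∀ col ∈ cols, col.length = G.length) →
      Computes p (enc (kb, ((G, L), cols), i))
        (enc (((mulColumns G L [])^[ofBits kb] cols).map fun col => col.getD i false))
        ((ofBits kb + 1) * (D kb + (ofBits kb + 1) * ((cols.length + 1) * E ((G, L), i)))) := by
  obtain ⟨pd, Td, hd, ⟨cd, hTd⟩, -⟩ := polyT_decrement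
  obtain ⟨pa, Ta, ha, ⟨ca, hTa⟩, -⟩ :
    PolyT fun l : List Bool => l.any fun b => b := PolyB.id.any PolyB.id.snd
  -- The index is returned with the digit because it is the state of the final pass that extracts
  -- one entry.
  obtain ⟨pg, Tg, hg, ⟨cg, hTg⟩, ⟨cs, hsg⟩⟩ :
    PolyT fun p : ℕ × List Bool => (p.1, p.2.getD p.1 false) :=
      PolyB.id.fst.pair (PolyB.id.snd.getD PolyB.id.fst (PolyB.const false))
  obtain ⟨pm, E₁, hE₁, hm⟩ := exists_mulColumns
  have h₀ : PolyBd (fun x : (List (List ℕ) × ℕ) × ℕ => sz x.1.1 + x.1.2 + x.2)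
      fun x => sz x.1.1 + x.1.2 + x.2 := PolyBd.self _
  have hE₂ : PolyBd (fun x : (List (List ℕ) × ℕ) × ℕ => sz x.1.1 + x.1.2 + x.2) fun x => E₁ x.1 :=
    (hE₁.comp Prod.fst).trans (PolyBd.of_le fun x => Nat.le_add_right _ _)
  let R : (List (List ℕ) × ℕ) × ℕ → ℕ := fun x => sz x.1.1 + x.1.2 + x.2 + 2
  have hR : PolyBd (fun x => sz x.1.1 + x.1.2 + x.2) R := h₀.add (PolyBd.const _ 2)
  let M₂ : (List (List ℕ) × ℕ) × ℕ → ℕ := fun x => (10 * R x + 2) ^ cg + (10 * R x + 2) ^ cs + 10 * R x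
  have hR' : PolyBd (fun x => sz x.1.1 + x.1.2 + x.2) fun x => 10 * R x := (PolyBd.const _ 10).mul hR
  have hM₂ : PolyBd (fun x => sz x.1.1 + x.1.2 + x.2) M₂ :=
    (((hR'.add (PolyBd.const _ 2)).pow cg).add ((hR'.add (PolyBd.const _ 2)).pow cs)).add hR'
  let F : (List (List ℕ) × ℕ) × ℕ → ℕ := fun x =>
    19 * (1000 * R x + E₁ x.1) + 2000 * R x + (21 * M₂ x + 30)
  have hF : PolyBd (fun x => sz x.1.1 + x.1.2 + x.2) F :=
    (((PolyBd.const _ 19).mul (((PolyBd.const _ 1000).mul hR).add hE₂)).add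
      ((PolyBd.const _ 2000).mul hR)).add (((PolyBd.const _ 21).mul hM₂).add (PolyBd.const _ 30))
  have hs : PolyBd (fun kb : List Bool => sz kb) fun kb => 4 * sz kb :=
    (PolyBd.const _ 4).mul (PolyBd.self _)
  refine ⟨Prog.whileLoop (Prog.fstP ;; pa) (Prog.pair (Prog.fstP ;; pd) (Prog.sndP ;; Prog.first pm)) ;;
      Prog.sndP ;; Prog.pair Prog.sndP (Prog.fstP ;; Prog.sndP) ;; Prog.mapAcc pg ;; Prog.sndP,
    fun kb => 19 * (100 * (4 * sz kb) + (4 * sz kb + 2) ^ ca + (4 * sz kb + 2) ^ cd + 100) + 50 +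
      200 * (4 * sz kb) + 200,
    fun x => R x * F x, ?_, hR.mul hF, fun kb G L cols i hG hcols => ?_⟩
  · exact (((((PolyBd.const _ 19).mul (((((PolyBd.const _ 100).mul hs).add
      ((hs.add (PolyBd.const _ 2)).pow ca)).add ((hs.add (PolyBd.const _ 2)).pow cd)).add
      (PolyBd.const _ 100))).add (PolyBd.const _ 50)).add ((PolyBd.const _ 200).mul hs)).add
      (PolyBd.const _ 200))
  set k := ofBits kb
  set r := R ((G, L), i)
  have hr : r = sz G + L + i + 2 := rfl
  set N := cols.length
  -- `Q` exceeds the number of columns at any time, `K` bounds the state of the loop, and `M` bounds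
  -- each test and each round.
  set Q := (k + 1) * ((N + 1) * r) with hQ
  set e₁ := E₁ (G, L)
  set m₂ := M₂ ((G, L), i)
  set s := 4 * sz kb
  set K := s + Q * (10 * r)
  set M := 100 * K + (s + 2) ^ ca + (s + 2) ^ cd + Q * e₁ + 100 with hM
  have hG₁ := PolyB.length_lt_sz G
  have hN : ∀ j ≤ k, N + j * L + 1 ≤ Q := by
    intro j hj
    have h₁ : j * L ≤ k * r := Nat.mul_le_mul hj (by omega)
    have h₂ : k * r ≤ k * ((N + 1) * r) := Nat.mul_le_mul_left _ (Nat.le_mul_of_pos_left _ (by omega))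
    have h₃ : N + 1 ≤ (N + 1) * r := Nat.le_mul_of_pos_right _ (by omega)
    have h₄ : Q = k * ((N + 1) * r) + (N + 1) * r := by rw [hQ]; ring
    omega
  have hQr : ∀ a, a + 1 ≤ Q → a * (4 * G.length + 2) + 1 + (sz G + 2 * L + 2 * i + 7) ≤ Q * (10 * r) := by
    intro a ha
    have h₁ : a * (4 * G.length + 2) ≤ a * (10 * r) := Nat.mul_le_mul_left _ (by omega)
    have h₂ : (a + 1) * (10 * r) ≤ Q * (10 * r) := Nat.mul_le_mul_right _ ha
    have h₃ : (a + 1) * (10 * r) = a * (10 * r) + 10 * r := by ring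
    omega
  have hd₁ : ∀ j, sz (decrement^[j] kb) ≤ s := by
    intro j
    have h₁ := sz_bools_le (decrement^[j] kb)
    have h₂ := PolyB.length_lt_sz kb
    rw [length_iterate_decrement] at h₁
    omega
  have hlen : ∀ j, ((mulColumns G L [])^[j] cols).length = N + j * L := fun j =>
    length_iterate_mulColumns G L cols j
  have hc₁ : ∀ j ≤ k, sz ((mulColumns G L [])^[j] cols) + (sz G + 2 * L + 2 * i + 7) ≤ Q * (10 * r) := by
    intro j hj
    have h₁ := sz_columns_le (cols := (mulColumns G L [])^[j] cols) (n := G.length) fun col h =>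
      (length_of_mem_iterate_mulColumns hcols j col h).le
    have h₂ := hQr (N + j * L) (hN j hj)
    rw [hlen] at h₁
    omega
  have hin : ∀ j ≤ k, sz (((G, L), (mulColumns G L [])^[j] cols), i) + 1 ≤ Q * (10 * r) := by
    intro j hj
    have := hc₁ j hj
    rw [sz_pair, sz_pair, sz_pair, PolyB.sz_nat, PolyB.sz_nat]
    omega
  have hstate : ∀ j ≤ k, sz (decrement^[j] kb, ((G, L), (mulColumns G L [])^[j] cols), i) ≤ K := by
    intro j hj
    have := hin j hj
    have := hd₁ j
    rw [sz_pair]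
    omega
  -- After `j` rounds the counter has been decremented and the columns have been multiplied `j`
  -- times; the loop runs while some digit of the counter is nonzero.
  have hloop := Computes.whileLoop (c := Prog.fstP ;; pa)
    (p := Prog.pair (Prog.fstP ;; pd) (Prog.sndP ;; Prog.first pm)) (j := k) (M := M)
    (t := fun j => (decrement^[j] kb).any fun b => b)
    (x := fun j => enc (decrement^[j] kb, ((G, L), (mulColumns G L [])^[j] cols), i))
    (fun j hj => by
      refine ((Computes.fst' (hstate j hj)).seq (ha _)).mono ?_
      have h := hTa (decrement^[j] kb)
      have h₂ := Nat.pow_le_pow_left (Nat.add_le_add_right ((zero_add _).trans_le (hd₁ j)) 2) ca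
      have := h.trans h₂
      omega)
    (fun j hj => by
      have h₁ := hTd (decrement^[j] kb)
      have h₂ := Nat.pow_le_pow_left (Nat.add_le_add_right ((zero_add _).trans_le (hd₁ j)) 2) cd
      have h₃ := h₁.trans h₂
      have h₄ := hm G L ((mulColumns G L [])^[j] cols) hG (length_of_mem_iterate_mulColumns hcols j)
      rw [hlen, ← Function.iterate_succ_apply' (mulColumns G L [])] at h₄
      have h₅ : (N + j * L + L + 1) * e₁ ≤ Q * e₁ := Nat.mul_le_mul_right _ (by
        have := hN (j + 1) hj
        rw [add_mul] at this
        omega)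
      have h₆ := hin (j + 1) hj
      change Computes _ _ _ ((N + j * L + L + 1) * e₁) at h₄
      have h₈ := hd (decrement^[j] kb)
      rw [← Function.iterate_succ_apply' decrement] at h₈
      exact (((Computes.fst' (hstate j hj.le)).seq h₈).pair'
        ((Computes.snd' (hstate j hj.le)).seq (h₄.first (enc i))) (hstate j hj.le)
        ((Nat.le_succ _).trans (h₆.trans (Nat.le_add_left _ _)))).mono (by omega))
    (fun j hj => (hstate j hj).trans (by omega))
    (fun j hj => by
      rw [any_eq_decide, any_iterate_decrement kb j hj.le]
      exact decide_eq_true (by omega))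
    (by
      rw [any_eq_decide, any_iterate_decrement kb k le_rfl]
      exact decide_eq_false (by omega))
  have hk := hstate k le_rfl
  set cols' := (mulColumns G L [])^[k] cols
  have hin' : sz (((G, L), cols'), i) ≤ K := by
    have : sz (((G, L), cols'), i) + 1 ≤ Q * (10 * r) := hin k le_rfl
    omega
  have hmap : Computes (Prog.mapAcc pg) (enc (i, cols'))
      (enc (i, cols'.map fun col => col.getD i false)) (Q * (21 * m₂ + 30)) := by
    have hx : ∀ x ∈ cols', sz (i, x) ≤ 10 * r := by
      intro x hx
      have h₁ := sz_bools_le x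
      rw [length_of_mem_iterate_mulColumns hcols k x hx] at h₁
      rw [sz_pair, PolyB.sz_nat]
      omega
    have := Computes.mapAcc (p := pg) (g := fun i (col : List Bool) => (i, col.getD i false)) (M := m₂)
      i cols' (by
        rw [PolyB.sz_nat]
        have : 10 * r ≤ m₂ := Nat.le_add_left _ _
        omega) (fun l₁ x l₂ hl => by
      rw [mapAcc_const (fun i (col : List Bool) => col.getD i false)]
      have h₂ := hx x (by rw [hl]; simp)
      exact ⟨(hg (i, x)).mono ((hTg _).trans ((Nat.pow_le_pow_left (Nat.add_le_add_right
        ((zero_add _).trans_le h₂) 2) _).trans ((Nat.le_add_right _ _).trans (Nat.le_add_right _ _)))),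
        (hsg (i, x)).trans ((Nat.pow_le_pow_left (Nat.add_le_add_right
        ((zero_add _).trans_le h₂) 2) _).trans ((Nat.le_add_left _ _).trans (Nat.le_add_right _ _)))⟩)
    rw [mapAcc_const (fun i (col : List Bool) => col.getD i false)] at this
    refine this.mono (Nat.mul_le_mul_right _ ?_)
    rw [hlen]
    exact hN k le_rfl
  have hc' : sz cols' + (sz G + 2 * L + 2 * i + 7) ≤ Q * (10 * r) := hc₁ k le_rfl
  have hout : sz (i, cols'.map fun col => col.getD i false) ≤ K := by
    have h₁ := sz_bools_le (cols'.map fun col => col.getD i false)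
    rw [List.length_map, hlen] at h₁
    rw [sz_pair, PolyB.sz_nat]
    have h₇ : 4 * (N + k * L) ≤ Q * (4 * r) := by
      have := Nat.mul_le_mul (hN k le_rfl) (by omega : 4 ≤ 4 * r)
      omega
    have h₈ : 4 * r ≤ Q * (4 * r) := Nat.le_mul_of_pos_left _ (by have := hN k le_rfl; omega)
    have h₉ : Q * (10 * r) = Q * (4 * r) + Q * (4 * r) + Q * (2 * r) := by ring
    omega
  have h₁ : sz ((G, L), cols') ≤ K := by rw [sz_pair] at hin'; omega
  have h₂ : sz cols' ≤ K := by omega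
  refine (hloop.seq ((Computes.snd' hk).seq (((Computes.snd' hin').pair'
    ((Computes.fst' hin').seq (Computes.snd' h₁)) hin' h₂).seq
    (hmap.seq (Computes.snd' hout))))).mono ?_
  have h₃ : (k + 1) * ((N + 1) * (r * F ((G, L), i))) = Q * F ((G, L), i) := by rw [hQ]; ring
  have h₄ : F ((G, L), i) = 19 * (1000 * r + e₁) + 2000 * r + (21 * m₂ + 30) := rfl
  change _ ≤ (k + 1) * (19 * (100 * s + (s + 2) ^ ca + (s + 2) ^ cd + 100) + 50 + 200 * s + 200 +
    (k + 1) * ((N + 1) * (r * F ((G, L), i))))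
  have hK : K = s + Q * (10 * r) := rfl
  have h₅ : Q * (19 * (1000 * r + e₁) + 2000 * r + (21 * m₂ + 30)) =
    1900 * (Q * (10 * r)) + 19 * (Q * e₁) + 200 * (Q * (10 * r)) + Q * (21 * m₂ + 30) := by ring
  -- The extraction at the end takes place once but may be charged to each of the `k + 1` rounds.
  have h₆ : (k + 1) * (19 * M + 50) + (200 * K + 200 + Q * (21 * m₂ + 30)) ≤
      (k + 1) * ((19 * M + 50) + (200 * K + 200 + Q * (21 * m₂ + 30))) := by
    rw [mul_add (k + 1) (19 * M + 50)]
    exact Nat.add_le_add_left (Nat.le_mul_of_pos_left _ (Nat.succ_pos k)) _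
  rw [h₃, h₄, h₅]
  clear_value r Q e₁ m₂ s K M k
  refine (?_ : _ ≤ _).trans (h₆.trans (Nat.mul_le_mul_left _ ?_))
  · omega
  · omega

/-! ### Input and output -/

/-- A symbol of the input: whether it is the mark `#`, and otherwise its value. -/
def symbolPair : Option Bool → Bool × Bool
  | none => (true, false)
  | some b => (false, b)

/-- The strings between the marks. -/
def splitMarks (l : List (Bool × Bool)) : List (List Bool) :=
  l.foldr (fun s acc => if s.1 = true then [] :: acc else (s.2 :: acc.headD []) :: acc.tail) [[]]

theorem splitMarks_ne_nil (l : List (Bool × Bool)) : splitMarks l ≠ [] := by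
  cases l with
  | nil => simp [splitMarks]
  | cons s l =>
    rw [splitMarks, List.foldr_cons]
    split <;> simp

theorem splitMarks_some_cons (b : Bool) (l : List (Option Bool)) :
    splitMarks ((some b :: l).map symbolPair) =
      (b :: (splitMarks (l.map symbolPair)).headD []) :: (splitMarks (l.map symbolPair)).tail := rfl

theorem splitMarks_none_cons (l : List (Option Bool)) :
    splitMarks ((none :: l).map symbolPair) = [] :: splitMarks (l.map symbolPair) := rfl

theorem splitMarks_append (t : List Bool) (l : List (Option Bool)) :
    splitMarks ((t.map some ++ l).map symbolPair) =
      (t ++ (splitMarks (l.map symbolPair)).headD []) :: (splitMarks (l.map symbolPair)).tail := by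
  induction t with
  | nil =>
    have := splitMarks_ne_nil (l.map symbolPair)
    revert this
    simp only [List.map_nil, List.nil_append]
    cases splitMarks (l.map symbolPair) <;> simp
  | cons b t ih =>
    rw [List.map_cons, List.cons_append, splitMarks_some_cons, ih]
    rfl

theorem splitMarks_append_none (t : List Bool) (l : List (Option Bool)) :
    splitMarks ((t.map some ++ none :: l).map symbolPair) = t :: splitMarks (l.map symbolPair) := by
  rw [splitMarks_append, splitMarks_none_cons, List.headD_cons, List.append_nil, List.tail_cons]

theorem sz_splitMarks_le (l : List (Bool × Bool)) : sz (splitMarks l) ≤ 4 * l.length + 3 := by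
  induction l with
  | nil => decide
  | cons s l ih =>
    have hne := splitMarks_ne_nil l
    rw [splitMarks, List.foldr_cons, ← splitMarks]
    have := PolyB.sz_bool_le s.2
    split
    · rw [sz_cons, sz_nil, List.length_cons]
      omega
    · obtain ⟨t, r, h⟩ := List.exists_cons_of_ne_nil hne
      rw [h] at ih ⊢
      rw [sz_cons, sz_cons, List.headD_cons, List.tail_cons, List.length_cons]
      rw [sz_cons] at ih
      omega

theorem polyT_splitMarks : PolyT splitMarks :=
  PolyB.foldr (g := fun _ (s : Bool × Bool) (acc : List (List Bool)) =>
    if s.1 = true then [] :: acc else (s.2 :: acc.headD []) :: acc.tail) (s₀ := fun _ => [[]])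
    (fun l => 4 * sz l + 3) PolyB.id (PolyB.const _)
    (PolyB.ite PolyB.id.snd.fst.fst ((PolyB.const []).cons PolyB.id.snd.snd)
      ((PolyB.id.snd.fst.snd.cons (PolyB.id.snd.snd.headD (PolyB.const []))).cons PolyB.id.snd.snd.tail))
    (((PolyBd.const _ 4).mul (PolyBd.of_le fun l => Nat.le_add_left _ _)).add (PolyBd.const _ 3))
    fun l l₁ h => (sz_splitMarks_le l₁).trans (by
      have := h.length_le
      have := PolyB.length_lt_sz l
      omega)

namespace Prog

/-- Push a string onto the main stack. -/
def pushAll : List (Option Bool) → Prog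
  | [] => .skip
  | y :: c => pushAll c ;; .push 0 y

def isMark (v : Option (Option Bool)) : Bool := v == some none

def isZero (v : Option (Option Bool)) : Bool := v == some (some false)

/-- Turn the input string into a tree. -/
def readInput : Prog :=
  -- The input is first turned around on stack 1, so that the list can be built from its last
  -- symbol.
  .pop 0 ;; .loop Option.isSome (.put 1 ;; .pop 0) ;; .push 0 (some false) ;; .pop 1 ;;
  .loop Option.isSome (.ite isMark (pushAll (enc (symbolPair none)).code)
    (.ite isOne (pushAll (enc (symbolPair (some true))).code)
      (pushAll (enc (symbolPair (some false))).code)) ;; .push 0 (some true) ;; .pop 1)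

/-- Write the digits in a tree onto the first auxiliary stack, without leading zeros. -/
def writeOutput : Prog :=
  -- Moving the digits leaves the most significant one on top, where zeros are removed. The removing
  -- loop pops one symbol too many: either the stack was empty or the symbol is a one, which is
  -- pushed back.
  .pop 0 ;; .loop isOne (.pop 0 ;; .ite isOne (.pop 0 ;; .pop 0 ;; .push 1 (some true))
    (.push 1 (some false)) ;; .pop 0) ;; .pop 1 ;; .loop isZero (.pop 1 ;; .skip) ;;
  .ite isOne (.push 1 (some true)) .skip

end Prog

namespace Run

open Prog

theorem pushAll (c : List (Option Bool)) (v r s u) :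
    Run (pushAll c) v ⟨r, s, u, []⟩ v ⟨c ++ r, s, u, []⟩ (c.length + 1) := by
  induction c with
  | nil => exact Run.skip _ _
  | cons y c ih => exact ih.seq (Run.push _ _ _ _)

theorem readInput_move (l r : List (Option Bool)) :
    Run (.loop Option.isSome (.put 1 ;; .pop 0)) l.head? ⟨l.tail, r, [], []⟩ none
      ⟨[], l.reverse ++ r, [], []⟩ (3 * l.length + 1) := by
  induction l generalizing r with
  | nil => exact Run.loop_false rfl
  | cons y l ih =>
    have := Run.loop_true (c := Option.isSome) (v := some y) rfl
      ((Run.put 1 y ⟨l, r, [], []⟩).seq (Run.pop 0 (some y) ⟨l, y :: r, [], []⟩)) (ih (y :: r))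
    rw [List.reverse_cons, List.append_assoc]
    exact this.mono (by simp only [List.length_cons]; omega)

theorem readInput_loop (l l' : List (Option Bool)) :
    ∃ v, Run (.loop Option.isSome (.ite isMark (Prog.pushAll (enc (symbolPair none)).code)
      (.ite isOne (Prog.pushAll (enc (symbolPair (some true))).code)
        (Prog.pushAll (enc (symbolPair (some false))).code)) ;; .push 0 (some true) ;; .pop 1)) l.head?
      ⟨(enc (l'.map symbolPair)).code, l.tail, [], []⟩ v
      ⟨(enc ((l.reverse ++ l').map symbolPair)).code, [], [], []⟩ (12 * l.length + 1) := by
  induction l generalizing l' with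
  | nil => exact ⟨_, Run.loop_false rfl⟩
  | cons y l ih =>
    obtain ⟨v, h⟩ := ih (y :: l')
    have hy : Run (.ite isMark (Prog.pushAll (enc (symbolPair none)).code)
        (.ite isOne (Prog.pushAll (enc (symbolPair (some true))).code)
          (Prog.pushAll (enc (symbolPair (some false))).code))) (some y)
        ⟨(enc (l'.map symbolPair)).code, l, [], []⟩ (some y)
        ⟨(enc (symbolPair y)).code ++ (enc (l'.map symbolPair)).code, l, [], []⟩ 8 := by
      rcases y with _ | _ | _
      · exact (Run.ite_true rfl (Run.pushAll _ _ _ _ _)).mono (by decide)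
      · exact (Run.ite_false rfl (Run.ite_false rfl (Run.pushAll _ _ _ _ _))).mono (by decide)
      · exact (Run.ite_false rfl (Run.ite_true rfl (Run.pushAll _ _ _ _ _))).mono (by decide)
    rw [List.reverse_cons, List.append_assoc]
    refine ⟨v, (Run.loop_true rfl (hy.seq ((Run.push _ _ _ _).seq (Run.pop _ _ _))) h).mono ?_⟩
    simp only [List.length_cons]
    omega

theorem readInput (l : List (Option Bool)) :
    ∃ v, Run readInput none ⟨l, [], [], []⟩ v ⟨(enc (l.map symbolPair)).code, [], [], []⟩
      (15 * l.length + 6) := by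
  obtain ⟨v, h⟩ := readInput_loop l.reverse []
  rw [List.reverse_reverse, List.append_nil] at h
  have h₁ := readInput_move l []
  rw [List.append_nil] at h₁
  refine ⟨v, ((Run.pop _ _ _).seq (h₁.seq ((Run.push _ _ _ _).seq ((Run.pop _ _ _).seq h)))).mono ?_⟩
  rw [List.length_reverse]
  omega

theorem writeOutput_move (l r : List Bool) :
    ∃ v, Run (.loop isOne (.pop 0 ;; .ite isOne (.pop 0 ;; .pop 0 ;; .push 1 (some true))
      (.push 1 (some false)) ;; .pop 0)) (enc l).code.head? ⟨(enc l).code.tail, r.map some, [], []⟩ v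
      ⟨[], (l.reverse ++ r).map some, [], []⟩ (10 * l.length + 1) := by
  induction l generalizing r with
  | nil => exact ⟨_, Run.loop_false rfl⟩
  | cons b l ih =>
    obtain ⟨v, h⟩ := ih (b :: r)
    rw [List.reverse_cons, List.append_assoc]
    have hb : ∃ v, Run (.pop 0 ;; .ite isOne (.pop 0 ;; .pop 0 ;; .push 1 (some true))
      (.push 1 (some false))) (some (some true)) ⟨(enc b).code ++ (enc l).code, r.map some, [], []⟩ v
      ⟨(enc l).code, (b :: r).map some, [], []⟩ 6 := by
      cases b with
      | false =>
        exact ⟨_, ((Run.pop _ _ _).seq (Run.ite_false rfl (Run.push _ _ _ _))).mono (by omega)⟩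
      | true =>
        exact ⟨_, ((Run.pop _ _ _).seq (Run.ite_true rfl ((Run.pop _ _ _).seq ((Run.pop _ _ _).seq
          (Run.push _ _ _ _))))).mono (by omega)⟩
    -- The body of the loop associates to the right, so the run for one digit is taken apart and
    -- regrouped with the final pop.
    obtain ⟨v₁, t, ht, hb⟩ := hb
    cases hb with
    | seq h₁ h₂ =>
      refine ⟨v, (Run.loop_true rfl (Run.seq ⟨_, le_rfl, h₁⟩ (Run.seq ⟨_, le_rfl, h₂⟩
        (Run.pop _ _ _))) h).mono ?_⟩
      simp only [List.length_cons]
      omega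

theorem writeOutput_strip (l : List Bool) :
    Run (.loop isZero (.pop 1 ;; .skip)) (l.map some).head? ⟨[], (l.map some).tail, [], []⟩
      ((l.dropWhile fun b => !b).map some).head?
      ⟨[], ((l.dropWhile fun b => !b).map some).tail, [], []⟩ (3 * l.length + 1) := by
  induction l with
  | nil => exact Run.loop_false rfl
  | cons b l ih =>
    cases b with
    | true => exact (Run.loop_false rfl).mono (by omega)
    | false =>
      refine (Run.loop_true rfl ((Run.pop _ _ _).seq (Run.skip _ _)) ih).mono ?_
      simp only [List.length_cons]
      omega

theorem writeOutput (l : List Bool) (v) : ∃ v', Run writeOutput v ⟨(enc l).code, [], [], []⟩ v'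
    ⟨[], (Nat.bits (ofBits l)).reverse.map some, [], []⟩ (13 * l.length + 6) := by
  have h₀ := reverse_dropWhile_eq_bits l.reverse
  rw [List.reverse_reverse] at h₀
  rw [← h₀, List.reverse_reverse]
  obtain ⟨v₁, h₁⟩ := writeOutput_move l []
  rw [List.append_nil] at h₁
  have h₂ := writeOutput_strip l.reverse
  have h₃ : ∃ v', Run (.ite isOne (.push 1 (some true)) .skip)
      ((l.reverse.dropWhile fun b => !b).map some).head?
      ⟨[], ((l.reverse.dropWhile fun b => !b).map some).tail, [], []⟩ v'
      ⟨[], (l.reverse.dropWhile fun b => !b).map some, [], []⟩ 2 := by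
    have hd : ∀ r : List Bool, r.dropWhile (fun b => !b) = [] ∨
        ∃ r', r.dropWhile (fun b => !b) = true :: r' := by
      intro r
      induction r with
      | nil => exact Or.inl rfl
      | cons b r ih =>
        cases b with
        | true => exact Or.inr ⟨r, rfl⟩
        | false => exact ih
    rcases hd l.reverse with h | ⟨r', h⟩ <;> rw [h]
    · exact ⟨_, Run.ite_false rfl (Run.skip _ _)⟩
    · exact ⟨_, Run.ite_true rfl (Run.push _ _ _ _)⟩
  obtain ⟨v₃, h₃⟩ := h₃
  refine ⟨v₃, ((Run.pop _ _ _).seq (h₁.seq ((Run.pop _ _ _).seq (h₂.seq h₃)))).mono ?_⟩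
  rw [List.length_reverse]
  omega

end Run

/-! ### The program -/

/-- A bound for the carries. -/
def carryBound (x : List (List ℕ) × List ℕ) : ℕ := x.1.flatten.length + x.2.sum

theorem length_le_carryBound (x : List (List ℕ) × List ℕ) : ∀ r ∈ x.1, r.length ≤ carryBound x :=
  fun _ hr => (List.Sublist.length_le (List.sublist_flatten_of_mem hr)).trans (Nat.le_add_right _ _)

theorem getD_le_carryBound (x : List (List ℕ) × List ℕ) (i : ℕ) : x.2.getD i 0 ≤ carryBound x := by
  rcases lt_or_ge i x.2.length with hi | hi
  · rw [List.getD_eq_getElem _ _ hi]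
    exact (List.single_le_sum (by simp) _ (List.getElem_mem hi)).trans (Nat.le_add_left _ _)
  · simp [List.getD_eq_getElem?_getD, hi]

/-- The data for the iteration. -/
def initData (x : (List (List ℕ) × List ℕ) × ℕ) :
    ((List (List ℕ) × ℕ) × List (List Bool)) × ℕ :=
  (((x.1.1, carryBound x.1), mulColumns x.1.1 (carryBound x.1) x.1.2 []), x.2)

theorem polyT_initData : PolyT initData := by
  have hL : PolyT carryBound := PolyB.id.fst.flatten.length.add PolyB.id.snd.sum
  have hm : PolyT fun x : List (List ℕ) × List ℕ => mulColumns x.1 (carryBound x) x.2 [] := by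
    have hz : PolyT fun x : List (List ℕ) × List ℕ => List.replicate (carryBound x) ([] : List Bool) :=
      hL.congr_enc fun x => enc_replicate_nil _
    have hG : PolyBd (fun x : List (List ℕ) × List ℕ => 0 + sz x) fun x => sz x :=
      PolyBd.of_le fun x => by omega
    have hL₁ : PolyBd (fun x : List (List ℕ) × List ℕ => 0 + sz x) carryBound :=
      hL.bd.mono fun x => by rw [PolyB.sz_nat]; omega
    refine (PolyB.snd (f := fun x : List (List ℕ) × List ℕ =>
      mapAcc columnStep (x.1, x.2) (List.replicate (carryBound x) [])) ?_).congr_enc fun x => by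
        rw [mulColumns, List.nil_append]
    refine PolyB.mapAcc (g := fun _ => columnStep) (s₀ := fun x => (x.1, x.2))
      (l := fun x => List.replicate (carryBound x) []) (fun x => sz x + (sz x * (2 * carryBound x + 2) + 1) + 1) hz PolyB.id
      (polyT_columnStep.comp PolyB.id.snd)
      ((hG.add ((hG.mul (((PolyBd.const _ 2).mul hL₁).add (PolyBd.const _ 2))).add
        (PolyBd.const _ 1))).add (PolyBd.const _ 1)) fun x l₁ _ => ?_
    have hlen : ∀ (l : List (List Bool)) (c : List ℕ), c.length ≤ sz x →
        (mapAcc columnStep (x.1, c) l).1.2.length ≤ sz x := by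
      intro l
      induction l with
      | nil => exact fun c h => h
      | cons col l ih =>
        intro c _
        refine ih _ ?_
        have := PolyB.length_lt_sz x.1
        rw [List.length_map, List.length_range, sz_prod]
        dsimp only
        omega
    have h₁ := sz_numbers_le (n := sz x) (carry_le (length_le_carryBound x) x.2 (getD_le_carryBound x) l₁)
      (hlen l₁ x.2 (by have := PolyB.length_lt_sz x.2; rw [sz_prod]; omega))
    rw [sz_prod, mapAcc_columnStep_fst]
    have h₂ : sz x.1 ≤ sz x := by rw [sz_prod]; omega
    exact Nat.add_le_add_right (Nat.add_le_add h₂ h₁) 1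
  exact ((PolyB.id.fst.fst.pair (hL.comp PolyB.id.fst)).pair (hm.comp PolyB.id.fst)).pair PolyB.id.snd

theorem length_countData (segs : List (List Bool)) :
    (countData segs).1.2.length = (countData segs).1.1.length := by
  simp [countData, adjacency, baseVector]

/-- The result for the number with digits `kb` and the remaining input `segs`. -/
def result (kb : List Bool) (segs : List (List Bool)) : ℕ :=
  ((mulVec (countData segs).1.1)^[ofBits kb] (countData segs).1.2).getD (countData segs).2 0

/-- Collects the phases: `t₁` for splitting the input, `t₂` for constructing the counting automaton,
`d` for the counter in one round, `e` for one column. Splitting depends on both `P`, the digits of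
`k`, and `A`, the rest of the input; only the iteration depends on the value of `k`. -/
theorem time_le {k P A t₁ t₂ d e L c₁ c₂ c₃ : ℕ} (hP₁ : 2 ≤ P) (hA₁ : 2 ≤ A)
    (hT₁ : t₁ ≤ (P * A) ^ (3 * c₁)) (hd : d ≤ P ^ (3 * c₃))
    (hu : t₂ + (L + 1) * e + (13 * L + 20) ≤ A ^ (3 * c₂)) :
    450 * (P * A) + t₁ + ((k + 1) * (d + (k + 1) * ((L + 1) * e)) + t₂ + 13 * (L + k * L) + 20) ≤
      (k + 1) * (P ^ (7 + 3 * c₁ + 3 * c₂ + 3 * c₃ + 1) + (k + 1)) *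
        A ^ (7 + 3 * c₁ + 3 * c₂ + 3 * c₃ + 1) := by
  have hPA : 4 ≤ P * A := Nat.mul_le_mul hP₁ hA₁
  have hlin : 450 * (P * A) ≤ (P * A) ^ 6 := by
    have := Nat.pow_le_pow_left hPA 5
    calc 450 * (P * A) ≤ 4 ^ 5 * (P * A) := Nat.mul_le_mul_right _ (by norm_num)
      _ ≤ (P * A) ^ 5 * (P * A) := Nat.mul_le_mul_right _ this
      _ = (P * A) ^ 6 := by ring
  generalize hu' : A ^ (3 * c₂) = u at hu
  have hPA' : (P * A) ^ 6 + (P * A) ^ (3 * c₁) ≤ P ^ (7 + 3 * c₁) * A ^ (7 + 3 * c₁) := by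
    rw [← mul_pow]
    have h₁ : (P * A) ^ 6 ≤ (P * A) ^ (6 + 3 * c₁) := Nat.pow_le_pow_right (by omega) (by omega)
    have h₂ : (P * A) ^ (3 * c₁) ≤ (P * A) ^ (6 + 3 * c₁) := Nat.pow_le_pow_right (by omega) (by omega)
    have h₃ : (P * A) ^ (6 + 3 * c₁) * 2 ≤ (P * A) ^ (6 + 3 * c₁) * (P * A) :=
      Nat.mul_le_mul_left _ (by omega)
    calc _ ≤ (P * A) ^ (6 + 3 * c₁) * (P * A) := by omega
      _ = _ := by ring
  have h₁ : (k + 1) * (d + (k + 1) * ((L + 1) * e)) + t₂ + 13 * (L + k * L) + 20 ≤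
      (k + 1) * (P ^ (3 * c₃) + (k + 1) * u) := by
    have h₂ : (k + 1) * ((L + 1) * e) + (t₂ + 13 * L + 20) ≤ (k + 1) * u := by
      have := Nat.mul_le_mul_left (k + 1) hu
      have h₃ : (k + 1) * (t₂ + (L + 1) * e + (13 * L + 20)) =
        (k + 1) * ((L + 1) * e) + (k + 1) * (t₂ + 13 * L + 20) := by ring
      have h₄ : t₂ + 13 * L + 20 ≤ (k + 1) * (t₂ + 13 * L + 20) :=
        Nat.le_mul_of_pos_left _ (Nat.succ_pos k)
      omega
    have h₃ := Nat.mul_le_mul_left (k + 1) (Nat.add_le_add hd h₂)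
    have h₄ : (k + 1) * (d + ((k + 1) * ((L + 1) * e) + (t₂ + 13 * L + 20))) =
      (k + 1) * (d + (k + 1) * ((L + 1) * e)) + t₂ + 13 * (L + k * L) + 20 + k * (t₂ + 20) := by ring
    omega
  have h₂ : (P * A) ^ 6 + (P * A) ^ (3 * c₁) + (k + 1) * (P ^ (3 * c₃) + (k + 1) * u) ≤
      (k + 1) * (P ^ (7 + 3 * c₁ + 3 * c₂ + 3 * c₃ + 1) + (k + 1)) *
        A ^ (7 + 3 * c₁ + 3 * c₂ + 3 * c₃ + 1) := by
    set C := 7 + 3 * c₁ + 3 * c₂ + 3 * c₃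
    have g₁ : P ^ (7 + 3 * c₁) * A ^ (7 + 3 * c₁) ≤ P ^ C * A ^ C :=
      Nat.mul_le_mul (Nat.pow_le_pow_right (by omega) (by omega))
        (Nat.pow_le_pow_right (by omega) (by omega))
    have g₂ : P ^ (3 * c₃) ≤ P ^ C * A ^ C :=
      (Nat.pow_le_pow_right (by omega) (by omega)).trans (Nat.le_mul_of_pos_right _ (by positivity))
    have g₃ : u ≤ A ^ (C + 1) := hu' ▸ Nat.pow_le_pow_right (by omega) (by omega)
    have g₄ : 2 * (P ^ C * A ^ C) ≤ P ^ (C + 1) * A ^ (C + 1) := by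
      have := Nat.mul_le_mul_right (P ^ C * A ^ C) (by omega : 2 ≤ P * A)
      calc _ ≤ _ := this
        _ = _ := by ring
    have g₅ := Nat.mul_le_mul_left (k + 1) (Nat.mul_le_mul_left (k + 1) g₃)
    have g₆ := Nat.mul_le_mul_left (k + 1) g₂
    have g₇ : P ^ C * A ^ C ≤ (k + 1) * (P ^ C * A ^ C) := Nat.le_mul_of_pos_left _ (Nat.succ_pos k)
    have g₈ := Nat.mul_le_mul_left (k + 1) g₄
    calc _ ≤ P ^ C * A ^ C + (k + 1) * (P ^ (3 * c₃) + (k + 1) * u) :=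
          Nat.add_le_add_right (hPA'.trans g₁) _
      _ = P ^ C * A ^ C + ((k + 1) * P ^ (3 * c₃) + (k + 1) * ((k + 1) * u)) := by ring
      _ ≤ (k + 1) * (2 * (P ^ C * A ^ C)) + (k + 1) * ((k + 1) * A ^ (C + 1)) := by
          rw [mul_left_comm (k + 1) 2]
          omega
      _ ≤ (k + 1) * (P ^ (C + 1) * A ^ (C + 1)) + (k + 1) * ((k + 1) * A ^ (C + 1)) :=
          Nat.add_le_add_right g₈ _
      _ = _ := by ring
  omega

/-- The bound separates the value of `k`, which enters quadratically, from its digits. For this the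
digits are split off first, and the construction works on the remaining input only, under
`Prog.second`. -/
theorem exists_program : ∃ (p : Prog) (c : ℕ), ∀ (kb : List Bool) (l : List (Option Bool)),
    ∃ v, Run p none ⟨kb.map some ++ none :: l, [], [], []⟩ v
      ⟨[], (Nat.bits (result kb (splitMarks (l.map symbolPair)))).reverse.map some, [], []⟩
      ((ofBits kb + 1) * ((kb.length + 2) ^ c + (ofBits kb + 1)) *
        (sizeBound (splitMarks (l.map symbolPair)) + l.length + 2) ^ c) := by
  obtain ⟨p₁, T₁, h₁, ⟨c₁, hT₁⟩, -⟩ := polyT_splitMarks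
  obtain ⟨p₂, T₂, h₂, hT₂, hs₂⟩ := polyT_initData.comp polyB_countData
  obtain ⟨p₃, D, E, hD, hE, h₃⟩ := exists_iteration
  have hE₂ : PolyBd (fun segs => sizeBound segs + sz segs) fun segs =>
      E ((initData (countData segs)).1.1, (initData (countData segs)).2) :=
    (hE.comp fun segs => ((initData (countData segs)).1.1, (initData (countData segs)).2)).trans
      (hs₂.mono fun segs => by
        rw [sz_prod, sz_prod, sz_prod, PolyB.sz_nat, PolyB.sz_nat]
        dsimp only
        omega)
  have hL : PolyBd (fun segs => sizeBound segs + sz segs) fun segs => carryBound (countData segs).1 :=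
    hs₂.mono fun segs => by
      rw [sz_prod, sz_prod, sz_prod, PolyB.sz_nat]
      change carryBound _ ≤ _ + (2 * carryBound _ + 1) + 1 + _ + 1 + _ + 1
      omega
  obtain ⟨c₂, hc₂⟩ := (hT₂.add ((hL.add (PolyBd.const _ 1)).mul hE₂)).add
    (((PolyBd.const _ 13).mul hL).add (PolyBd.const _ 20))
  obtain ⟨c₃, hc₃⟩ := hD
  refine ⟨Prog.readInput ;; p₁ ;; Prog.pair Prog.fstP Prog.sndP ;; Prog.second p₂ ;; p₃ ;;
    Prog.writeOutput, 7 + 3 * c₁ + 3 * c₂ + 3 * c₃ + 1, fun kb l => ?_⟩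
  set segs := splitMarks (l.map symbolPair) with hsegs
  have hsplit : splitMarks ((kb.map some ++ none :: l).map symbolPair) = kb :: segs :=
    splitMarks_append_none kb l
  obtain ⟨v₀, r₀⟩ := Run.readInput (kb.map some ++ none :: l)
  have r₁ := h₁ ((kb.map some ++ none :: l).map symbolPair)
  rw [hsplit] at r₁
  have hkl : sz (kb, segs) ≤ 4 * (kb.length + 1 + l.length) + 3 := by
    have := sz_splitMarks_le ((kb.map some ++ none :: l).map symbolPair)
    rw [hsplit] at this
    simp only [List.length_map, List.length_append, List.length_cons] at this
    rw [sz_cons] at this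
    rw [sz_pair]
    omega
  have r₂ : Computes (Prog.pair Prog.fstP Prog.sndP) (enc (kb :: segs)) (enc (kb, segs)) _ :=
    Computes.pair' (Computes.fst' (b := segs) hkl) (Computes.snd' (a := kb) hkl) hkl
      ((by rw [sz_pair]; omega : sz segs ≤ sz (kb, segs)).trans hkl)
  have r₃ := (h₂ segs).second (enc kb)
  have hG := length_le_carryBound (countData segs).1
  have r₄ := h₃ kb (countData segs).1.1 (carryBound (countData segs).1)
    (mulColumns (countData segs).1.1 (carryBound (countData segs).1) (countData segs).1.2 [])
    (countData segs).2 hG (fun _ => length_of_mem_mulColumns)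
  have hlen := length_iterate_mulColumns (countData segs).1.1 (carryBound (countData segs).1)
    (mulColumns (countData segs).1.1 (carryBound (countData segs).1) (countData segs).1.2 []) (ofBits kb)
  have hval := columnValue_iterate_mulColumns hG (countData segs).1.2 (getD_le_carryBound (countData segs).1)
    (length_countData segs) (ofBits kb) (countData segs).2
  rw [length_mulColumns, List.length_nil, zero_add] at r₄ hlen
  obtain ⟨v₁, r₁⟩ := r₁ v₀ [] [] []
  obtain ⟨v₂, r₂⟩ := r₂ v₁ [] [] []
  obtain ⟨v₃, r₃⟩ := r₃ v₂ [] [] []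
  obtain ⟨v₄, r₄⟩ := r₄ v₃ [] [] []
  rw [List.append_nil] at r₁ r₂ r₃ r₄
  rw [List.append_nil] at r₁ r₂ r₃ r₄
  obtain ⟨v₅, r₅⟩ := Run.writeOutput (((mulColumns (countData segs).1.1 (carryBound (countData segs).1) [])^[ofBits kb]
    (mulColumns (countData segs).1.1 (carryBound (countData segs).1) (countData segs).1.2 [])).map
      fun col => col.getD (countData segs).2 false) v₄
  rw [← columnValue, hval, List.length_map, hlen] at r₅
  refine ⟨v₅, (r₀.seq (r₁.seq (r₂.seq (r₃.seq (r₄.seq r₅))))).mono ?_⟩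
  have b₁ : T₁ ((kb.map some ++ none :: l).map symbolPair) ≤
      (6 * (kb.length + 1 + l.length) + 3) ^ c₁ := by
    refine (hT₁ _).trans (Nat.pow_le_pow_left ?_ _)
    have := PolyB.sz_le_of_forall (l := (kb.map some ++ none :: l).map symbolPair) (M := 5) fun x hx => by
      obtain ⟨y, -, rfl⟩ := List.mem_map.1 hx
      rcases y with _ | _ | _ <;> decide
    simp only [List.length_map, List.length_append, List.length_cons] at this
    dsimp only
    omega
  have b₂ : sz segs ≤ 4 * l.length + 3 := (sz_splitMarks_le _).trans (by simp)
  have b₃ := hc₂ segs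
  have b₄ := hc₃ kb
  have b₅ := sz_bools_le kb
  change T₂ segs + (carryBound (countData segs).1 + 1) *
    E (((countData segs).1.1, carryBound (countData segs).1), (countData segs).2) +
    (13 * carryBound (countData segs).1 + 20) ≤ (sizeBound segs + sz segs + 2) ^ c₂ at b₃
  have b₆ : 1 ≤ sizeBound segs := Nat.one_le_two_pow
  simp only [List.length_map, List.length_append, List.length_cons, size_enc]
  generalize E (((countData segs).1.1, carryBound (countData segs).1), (countData segs).2) = e at *
  generalize carryBound (countData segs).1 = L at *
  generalize T₁ ((kb.map some ++ none :: l).map symbolPair) = t₁ at *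
  generalize T₂ segs = t₂ at *
  generalize D kb = d at *
  generalize ofBits kb = k at *
  set P := kb.length + 2 with hP
  set A := sizeBound segs + l.length + 2 with hA
  have hP₁ : 2 ≤ P := by omega
  have hA₁ : 2 ≤ A := by omega
  have hPA : 4 ≤ P * A := Nat.mul_le_mul hP₁ hA₁
  have hl : kb.length + 1 + l.length ≤ P * A := by nlinarith
  -- Trades the constant 4 in the base for the factor 3 in the exponent.
  have cube : ∀ x : ℕ, 2 ≤ x → 4 * x ≤ x ^ 3 := fun x hx => by
    have := Nat.mul_le_mul hx hx
    calc 4 * x ≤ x * x * x := Nat.mul_le_mul_right _ this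
      _ = x ^ 3 := by ring
  have hT₁' : t₁ ≤ (P * A) ^ (3 * c₁) := by
    rw [pow_mul]
    refine b₁.trans (Nat.pow_le_pow_left ?_ _)
    have := Nat.mul_le_mul hPA hPA
    calc 6 * (kb.length + 1 + l.length) + 3 ≤ 4 * 4 * (P * A) := by omega
      _ ≤ P * A * (P * A) * (P * A) := Nat.mul_le_mul_right _ this
      _ = (P * A) ^ 3 := by ring
  have hd : d ≤ P ^ (3 * c₃) := by
    rw [pow_mul]
    exact b₄.trans (Nat.pow_le_pow_left ((by omega : sz kb + 2 ≤ 4 * P).trans (cube P hP₁)) _)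
  have hu : t₂ + (L + 1) * e + (13 * L + 20) ≤ A ^ (3 * c₂) := by
    rw [pow_mul]
    exact b₃.trans (Nat.pow_le_pow_left
      ((by omega : sizeBound segs + sz segs + 2 ≤ 4 * A).trans (cube A hA₁)) _)
  refine (?_ : _ ≤ _).trans (time_le (k := k) hP₁ hA₁ hT₁' hd hu)
  omega

/-! ### The layers of a diagram as transition functions on sets of states -/

section

variable {A : Type} {w : ℕ}

/-- The states that are reached from `S` or an initial state when the letter `a` is read, and that
are final if the layer is the last one. -/
def Layer.next (L : Layer A w) (S : Set (Fin w)) (a : A) : Set (Fin w) :=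
  {q | (∃ p, (p ∈ S ∨ p ∈ L.init) ∧ (p, a, q) ∈ L.trans) ∧ (L.finalFlag = false ∨ q ∈ L.final)}

theorem Layer.mem_next {L : Layer A w} {S : Set (Fin w)} {a : A} {q : Fin w} : q ∈ L.next S a ↔
    (∃ p, (p ∈ S ∨ p ∈ L.init) ∧ (p, a, q) ∈ L.trans) ∧ (L.finalFlag = false ∨ q ∈ L.final) :=
  Iff.rfl

def runLayers : List (Layer A w) → Set (Fin w) → List A → Set (Fin w)
  | L :: D, S, a :: s => runLayers D (L.next S a) s
  | _, S, _ => S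

/-- Generalized to a set `S` in front of the first layer, so that the induction can pass to the
tail. Later layers have no initial states, so adjoining them changes nothing, and the restriction to
final states takes effect in the last layer only. -/
theorem runLayers_nonempty_iff (D : List (Layer A w)) (L : Layer A w) (S : Set (Fin w)) (s : List A)
    (hs : s.length = (L :: D).length) (hi : ∀ L' ∈ D, L'.initFlag = false)
    (hl : ∀ L' ∈ (L :: D).getLast?, L'.finalFlag = true)
    (hf : ∀ L' ∈ (L :: D).dropLast, L'.finalFlag = false) :
    (runLayers (L :: D) S s).Nonempty ↔ ∃ tr : List (Fin w × A × Fin w),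
      tr.map (fun t => t.2.1) = s ∧ List.Forall₂ (fun t L => t ∈ L.trans) tr (L :: D) ∧
      tr.IsChain (fun t t' => t'.1 = t.2.2) ∧ (∀ t ∈ tr.head?, t.1 ∈ S ∨ t.1 ∈ L.init) ∧
      (∀ t ∈ tr.getLast?, ∀ L' ∈ (L :: D).getLast?, t.2.2 ∈ L'.final) := by
  induction D generalizing L S s with
  | nil =>
    obtain ⟨a, rfl⟩ := List.length_eq_one_iff.1 hs
    have hL : L.finalFlag = true := hl L rfl
    constructor
    · rintro ⟨q, ⟨p, hp, hpq⟩, hq⟩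
      rw [hL] at hq
      refine ⟨[(p, a, q)], rfl, .cons hpq .nil, List.isChain_singleton _, ?_, ?_⟩
      · rintro t ht
        cases ht
        exact hp
      · rintro t ht L' hL'
        cases ht
        cases hL'
        exact hq.resolve_left (by simp)
    · rintro ⟨tr, h₁, h₂, -, h₄, h₅⟩
      cases h₂ with
      | @cons t _ tr _ ht htr =>
        cases htr
        obtain ⟨p, b, q⟩ := t
        simp only [List.map_cons, List.map_nil, List.cons.injEq, and_true] at h₁
        subst h₁
        exact ⟨q, ⟨p, h₄ _ rfl, ht⟩, Or.inr (h₅ _ rfl _ rfl)⟩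
  | cons L₁ D ih =>
    obtain ⟨a, s, rfl⟩ := List.exists_cons_of_length_eq_add_one hs
    have hL : L.finalFlag = false := hf L (by simp)
    have hL₁ : L₁.init = ∅ := L₁.init_eq_empty (hi L₁ (by simp))
    have h := ih L₁ (L.next S a) s (by simpa using hs) (fun L' h => hi L' (by simp [h]))
      (fun L' h => hl L' (by rwa [List.getLast?_cons_cons]))
      (fun L' h => hf L' (by rw [List.dropLast_cons_of_ne_nil (by simp)]; exact List.mem_cons_of_mem _ h))
    change (runLayers (L₁ :: D) (L.next S a) s).Nonempty ↔ _
    rw [h]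
    constructor
    · rintro ⟨tr, h₁, h₂, h₃, h₄, h₅⟩
      cases h₂ with
      | @cons t _ tr _ ht htr =>
        obtain ⟨p, hp, hpt⟩ := ((h₄ t rfl).resolve_right (by rw [hL₁]; exact fun h => h)).1
        refine ⟨(p, a, t.1) :: t :: tr, by rw [List.map_cons, h₁], .cons hpt (.cons ht htr),
          List.isChain_cons_cons.2 ⟨rfl, h₃⟩, ?_, ?_⟩
        · intro t' ht'
          cases ht'
          exact hp
        · rw [List.getLast?_cons_cons, List.getLast?_cons_cons]
          exact h₅
    · rintro ⟨tr, h₁, h₂, h₃, h₄, h₅⟩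
      cases h₂ with
      | @cons t₀ _ tr _ ht₀ htr =>
        cases htr with
        | @cons t _ tr _ ht htr =>
          obtain ⟨hc, hch⟩ := List.isChain_cons_cons.1 h₃
          obtain ⟨p, b, q⟩ := t₀
          rw [List.map_cons, List.cons.injEq] at h₁
          obtain ⟨rfl, h₁⟩ := h₁
          refine ⟨t :: tr, h₁, .cons ht htr, hch, ?_, ?_⟩
          · intro t' ht'
            cases ht'
            exact Or.inl ⟨⟨p, h₄ _ rfl, by rw [hc]; exact ht₀⟩, Or.inl hL⟩
          · rw [List.getLast?_cons_cons, List.getLast?_cons_cons] at h₅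
            exact h₅

/-- Acceptance as nonemptiness of the set of reached states. -/
theorem oddAccepts_iff {D : List (Layer A w)} (hD : IsODD D) {s : List A} (hs : s.length = D.length) :
    ODDAccepts D s ↔ (runLayers D ∅ s).Nonempty := by
  obtain ⟨h₀, -, -, hi, hl, hf⟩ := hD
  obtain ⟨L, D, rfl⟩ := List.exists_cons_of_ne_nil h₀
  rw [runLayers_nonempty_iff D L ∅ s hs hi hl hf]
  simp [ODDAccepts]

/-! ### Layers as bit vectors -/

-- These are `setCode` and `layerCode` without the wrapper `some`: the codes contain no mark and
-- reach the program as plain bit vectors.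
open Classical in
noncomputable def setBits {n : ℕ} (S : Set (Fin n)) : List Bool :=
  (List.finRange n).map fun i => decide (i ∈ S)

open Classical in
noncomputable def layerBits {m : ℕ} (eA : A ≃ Fin m) (L : Layer A w) : List Bool :=
  setBits L.left ++ setBits L.right ++
  ((List.finRange w).flatMap fun p => (List.finRange m).flatMap fun a =>
    (List.finRange w).map fun q => decide ((p, eA.symm a, q) ∈ L.trans)) ++
  setBits L.init ++ setBits L.final ++ [L.initFlag, L.finalFlag]

theorem setCode_eq {n : ℕ} (S : Set (Fin n)) : setCode S = (setBits S).map some := by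
  simp [setCode, setBits]

theorem layerCode_eq {m : ℕ} (eA : A ≃ Fin m) (L : Layer A w) :
    layerCode eA L = (layerBits eA L).map some := by
  simp [layerCode, layerBits, setCode_eq, List.map_flatMap, Function.comp_def]

theorem length_setBits {n : ℕ} (S : Set (Fin n)) : (setBits S).length = n := by simp [setBits]

open Classical in
theorem getD_setBits {n : ℕ} (S : Set (Fin n)) (i : Fin n) :
    (setBits S).getD i false = decide (i ∈ S) := by
  simp [setBits, List.getD_eq_getElem?_getD]

theorem length_flatMap_of_forall {α β : Type} {l : List α} {f : α → List β} {c : ℕ}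
    (h : ∀ x ∈ l, (f x).length = c) : (l.flatMap f).length = l.length * c := by
  induction l with
  | nil => simp
  | cons x l ih =>
    rw [List.flatMap_cons, List.length_append, h x (by simp), ih fun y hy => h y (by simp [hy]),
      List.length_cons]
    ring

/-- Addressing in a concatenation of blocks of equal length; used twice, it locates a transition in
the code of a layer. -/
theorem getD_flatMap {α β : Type} {l : List α} {f : α → List β} {c : ℕ}
    (h : ∀ x ∈ l, (f x).length = c) {i j : ℕ} (hi : i < l.length) (hj : j < c) (d : β) :
    (l.flatMap f).getD (i * c + j) d = (f l[i]).getD j d := by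
  induction l generalizing i with
  | nil => simp at hi
  | cons x l ih =>
    have hx := h x (by simp)
    rw [List.flatMap_cons]
    cases i with
    | zero => rw [zero_mul, zero_add, List.getD_append _ _ _ _ (by omega)]; rfl
    | succ i =>
      rw [List.getD_append_right _ _ _ _ (by rw [hx]; nlinarith), hx,
        show (i + 1) * c + j - c = i * c + j by rw [add_mul]; omega]
      exact ih (fun y hy => h y (by simp [hy])) (by simpa using hi)

section

variable {m : ℕ} (eA : A ≃ Fin m) (L : Layer A w)

open Classical in
theorem length_transBits : ((List.finRange w).flatMap fun p => (List.finRange m).flatMap fun a =>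
    (List.finRange w).map fun q => decide ((p, eA.symm a, q) ∈ L.trans)).length = w * (m * w) := by
  rw [length_flatMap_of_forall (c := m * w), List.length_finRange]
  intro p _
  rw [length_flatMap_of_forall (c := w), List.length_finRange]
  simp

theorem length_layerBits : (layerBits eA L).length = codeLength m w := by
  rw [layerBits]
  simp only [List.length_append, length_setBits, length_transBits]
  rfl

open Classical in
theorem getD_layerBits_trans (p q : Fin w) (a : Fin m) :
    (layerBits eA L).getD (w + w + (p * (m * w) + (a * w + q))) false =
      decide ((p, eA.symm a, q) ∈ L.trans) := by
  have h₁ : (a : ℕ) * w + q < m * w := by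
    have := Nat.mul_le_mul_right w (show (a : ℕ) + 1 ≤ m from a.2)
    rw [add_mul] at this
    omega
  have h₂ : (p : ℕ) * (m * w) + (a * w + q) < w * (m * w) := by
    have := Nat.mul_le_mul_right (m * w) (show (p : ℕ) + 1 ≤ w from p.2)
    rw [add_mul] at this
    omega
  rw [layerBits, List.append_assoc, List.append_assoc, List.append_assoc,
    List.getD_append_right _ _ _ _ (by simp only [List.length_append, length_setBits]; omega),
    List.getD_append _ _ _ _ (by
      simp only [List.length_append, length_setBits, length_transBits]
      omega)]
  simp only [List.length_append, length_setBits, Nat.add_sub_cancel_left]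
  rw [getD_flatMap (c := m * w) (fun p _ => by
    rw [length_flatMap_of_forall (c := w), List.length_finRange]
    simp) (by simp) h₁, getD_flatMap (c := w) (by simp) (by simp) q.2]
  simp [List.getD_eq_getElem?_getD]

open Classical in
theorem getD_layerBits_init (p : Fin w) :
    (layerBits eA L).getD (w + w + w * (m * w) + p) false = decide (p ∈ L.init) := by
  rw [layerBits, List.append_assoc, List.append_assoc,
    List.getD_append_right _ _ _ _ (by
      simp only [List.length_append, length_setBits, length_transBits]; omega),
    List.getD_append _ _ _ _ (by
      simp only [List.length_append, length_setBits, length_transBits]; omega)]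
  simp only [List.length_append, length_setBits, length_transBits, Nat.add_sub_cancel_left]
  exact getD_setBits _ _

open Classical in
theorem getD_layerBits_final (q : Fin w) :
    (layerBits eA L).getD (w + w + w * (m * w) + w + q) false = decide (q ∈ L.final) := by
  rw [layerBits, List.append_assoc,
    List.getD_append_right _ _ _ _ (by
      simp only [List.length_append, length_setBits, length_transBits]; omega),
    List.getD_append _ _ _ _ (by
      simp only [List.length_append, length_setBits, length_transBits]; omega)]
  simp only [List.length_append, length_setBits, length_transBits, Nat.add_sub_cancel_left]
  exact getD_setBits _ _

theorem getD_layerBits_finalFlag :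
    (layerBits eA L).getD (w + w + w * (m * w) + w + w + 1) false = L.finalFlag := by
  rw [layerBits, List.getD_append_right _ _ _ _ (by
      simp only [List.length_append, length_setBits, length_transBits]; omega)]
  simp only [List.length_append, length_setBits, length_transBits, Nat.add_sub_cancel_left]
  rfl

open Classical in
theorem layerNext_setBits (S : Set (Fin w)) (a : Fin m) :
    layerNext m w (layerBits eA L) (setBits S) a = setBits (L.next S (eA.symm a)) := by
  refine List.ext_getElem (by simp [layerNext, setBits]) fun q hq _ => ?_
  have hq' : q < w := by simpa [layerNext] using hq
  simp only [layerNext, setBits, List.getElem_map, List.getElem_range, List.getElem_finRange]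
  rw [Bool.eq_iff_iff, decide_eq_true_iff]
  have h₁ := getD_layerBits_final eA L ⟨q, hq'⟩
  dsimp only at h₁
  rw [← setBits, Bool.and_eq_true, Bool.or_eq_true, h₁, getD_layerBits_finalFlag, List.any_eq_true,
    Layer.mem_next, decide_eq_true_iff, Bool.not_eq_true']
  refine and_congr ⟨?_, ?_⟩ Iff.rfl
  · rintro ⟨p, hp, h⟩
    have hp := List.mem_range.1 hp
    have h₂ := getD_setBits S ⟨p, hp⟩
    have h₃ := getD_layerBits_init eA L ⟨p, hp⟩
    have h₄ := getD_layerBits_trans eA L ⟨p, hp⟩ ⟨q, hq'⟩ a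
    dsimp only at h₂ h₃ h₄
    rw [h₂, h₃, h₄] at h
    exact ⟨⟨p, hp⟩, by simpa using h⟩
  · rintro ⟨p, h⟩
    refine ⟨p, List.mem_range.2 p.2, ?_⟩
    have h₄ := getD_layerBits_trans eA L p ⟨q, hq'⟩ a
    dsimp only at h₄
    rw [getD_setBits S p, getD_layerBits_init eA L p, h₄]
    simpa using h

end

end

/-! ### The coded automaton computes the functions of the diagrams -/

section

variable {A : Type} {w m : ℕ} (eA : A ≃ Fin m)

/-- The index of a set of states in the list of all bit vectors. -/
noncomputable def setIndex (S : Set (Fin w)) : ℕ := (allLists [false, true] w).idxOf (setBits S)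

theorem mem_allLists_of_length {t : List Bool} (h : t.length = w) : t ∈ allLists [false, true] w :=
  mem_allLists.2 ⟨h, fun b _ => by cases b <;> simp⟩

theorem getD_setIndex (S : Set (Fin w)) : (allLists [false, true] w).getD (setIndex S) [] = setBits S := by
  have h : setIndex S < (allLists [false, true] w).length :=
    List.idxOf_lt_length_iff.2 (mem_allLists_of_length (length_setBits S))
  rw [List.getD_eq_getElem _ _ h]
  exact List.getElem_idxOf h

theorem stepIndex_setIndex (L : Layer A w) (S : Set (Fin w)) (a : Fin m) :
    stepIndex m w (allLists [false, true] w) (layerBits eA L) (setIndex S) a =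
      setIndex (L.next S (eA.symm a)) := by
  rw [stepIndex, getD_setIndex, layerNext_setBits]
  rfl

theorem stepIndex_lt (b : List Bool) (i a : ℕ) :
    stepIndex m w (allLists [false, true] w) b i a < (allLists [false, true] w).length :=
  List.idxOf_lt_length_iff.2 (mem_allLists_of_length (by simp [layerNext]))

theorem runFrom_setIndex (D : List (Layer A w)) (S : Set (Fin w)) (s : List (Fin m)) :
    runFrom (stepIndex m w (allLists [false, true] w)) (D.map (layerBits eA)) (setIndex S)
      (s.map Fin.val) = setIndex (runLayers D S (s.map eA.symm)) := by
  induction D generalizing S s with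
  | nil => cases s <;> rfl
  | cons L D ih =>
    cases s with
    | nil => rfl
    | cons a s =>
      rw [List.map_cons, List.map_cons, runFrom, stepIndex_setIndex]
      exact ih _ _

open Classical in
theorem nonemptyIndex_setIndex (S : Set (Fin w)) :
    nonemptyIndex (allLists [false, true] w) (setIndex S) = decide S.Nonempty := by
  rw [nonemptyIndex, getD_setIndex, Bool.eq_iff_iff, List.any_eq_true, decide_eq_true_iff]
  simp [setBits, Set.Nonempty]

theorem setBits_empty : setBits (∅ : Set (Fin w)) = List.replicate w false := by
  rw [setBits, List.eq_replicate_iff]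
  simp

/-- The run starts at the index of the empty set, since the initial states are supplied by the first
layer itself. -/
theorem valFn_eq_oddFunction {D : List (Layer A w)} (hD : IsODD D) {k : ℕ} (hk : D.length = k) :
    valFn (stepIndex m w (allLists [false, true] w)) m (nonemptyIndex (allLists [false, true] w))
      (D.map (layerBits eA)) ((allLists [false, true] w).idxOf (List.replicate w false)) =
    fun s : Fin k → Fin m => oddFunction D k fun i => eA.symm (s i) := by
  classical
  funext s
  have h₁ : (List.ofFn fun x => (s x : ℕ)) = (List.ofFn s).map Fin.val := by
    rw [List.map_ofFn]; rfl
  have h₂ : (List.ofFn fun i => eA.symm (s i)) = (List.ofFn s).map eA.symm := by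
    rw [List.map_ofFn]; rfl
  rw [valFn, h₁, ← setBits_empty]
  change nonemptyIndex _ (runFrom _ _ (setIndex ∅) _) = _
  rw [runFrom_setIndex, nonemptyIndex_setIndex, oddFunction, h₂, Bool.eq_iff_iff, decide_eq_true_iff,
    decide_eq_true_iff, oddAccepts_iff hD (by simp [hk])]

variable {Q : Type} {n : ℕ} (eQ : Q ≃ Fin n) {F : NFA (Layer A w) Q} {ts : List (Q × Layer A w × Q)}

/-- The transitions with states as numbers and layers as bit vectors. -/
noncomputable def codedTransitions (eA : A ≃ Fin m) (eQ : Q ≃ Fin n)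
    (ts : List (Q × Layer A w × Q)) : List (ℕ × List Bool × ℕ) :=
  ts.map fun t => ((eQ t.1 : ℕ), layerBits eA t.2.1, (eQ t.2.2 : ℕ))

theorem isPath_iff (hts : IsTransitionList F ts) (p : Q) (D' : List (List Bool)) (q' : ℕ) :
    IsPath (codedTransitions eA eQ ts) (eQ p) D' q' ↔
      ∃ D q, D' = D.map (layerBits eA) ∧ q' = eQ q ∧ Nonempty (F.Path p q D) := by
  induction D' generalizing p with
  | nil =>
    constructor
    · rintro h
      exact ⟨[], p, rfl, h.symm, ⟨.nil p⟩⟩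
    · rintro ⟨D, q, hD, rfl, ⟨h⟩⟩
      obtain rfl : D = [] := List.map_eq_nil_iff.1 hD.symm
      cases h
      rfl
  | cons b D' ih =>
    constructor
    · rintro ⟨r, hr, h⟩
      obtain ⟨⟨p₁, L, r₁⟩, ht, he⟩ := List.mem_map.1 hr
      simp only [Prod.mk.injEq] at he
      obtain ⟨hp, rfl, rfl⟩ := he
      obtain rfl : p₁ = p := eQ.injective (Fin.ext hp)
      obtain ⟨D, q, rfl, rfl, ⟨h⟩⟩ := (ih r₁).1 h
      exact ⟨L :: D, q, rfl, rfl, ⟨.cons _ _ _ _ _ ((hts.2 _ _ _).1 ht) h⟩⟩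
    · rintro ⟨D, q, hD, rfl, ⟨h⟩⟩
      cases h with
      | nil => simp at hD
      | cons r _ _ L D hr h =>
        rw [List.map_cons, List.cons.injEq] at hD
        obtain ⟨rfl, rfl⟩ := hD
        exact ⟨eQ r, List.mem_map.2 ⟨(p, L, r), (hts.2 _ _ _).2 hr, rfl⟩, (ih r).2 ⟨D, q, rfl, rfl, ⟨h⟩⟩⟩

theorem getD_setBits_preimage {S : Set Q} {p : ℕ} :
    (setBits (eQ.symm ⁻¹' S)).getD p false = true ↔ ∃ p' ∈ S, p = eQ p' := by
  classical
  rcases lt_or_ge p n with h | h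
  · have := getD_setBits (eQ.symm ⁻¹' S) ⟨p, h⟩
    dsimp only at this
    rw [this, decide_eq_true_iff]
    constructor
    · intro h'
      exact ⟨_, h', by simp⟩
    · rintro ⟨p', hp', rfl⟩
      simpa using hp'
  · constructor
    · intro h'
      rw [List.getD_eq_default _ _ (by rw [length_setBits]; exact h)] at h'
      cases h'
    · rintro ⟨p', -, rfl⟩
      exact absurd (eQ p').2 (by omega)

/-- Renumbering the letters is injective on functions and preserves the count. Every accepted string
is a diagram because `F` is a SOFA, so `valFn_eq_oddFunction` applies to each path. -/
theorem ncard_eq_countFunctions (hF : IsSOFA F) (hts : IsTransitionList F ts) (k : ℕ) :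
    Set.ncard {f : (Fin k → Fin m) → Bool | ∃ p D q,
      (setBits (eQ.symm ⁻¹' F.start)).getD p false = true ∧ D.length = k ∧
      IsPath (codedTransitions eA eQ ts) p D q ∧
      (setBits (eQ.symm ⁻¹' F.accept)).getD q false = true ∧
      f = valFn (stepIndex m w (allLists [false, true] w)) m
        (nonemptyIndex (allLists [false, true] w)) D
        ((allLists [false, true] w).idxOf (List.replicate w false))} = countFunctions F k := by
  have hinj : Function.Injective fun (f : (Fin k → A) → Bool) (s : Fin k → Fin m) =>
      f fun i => eA.symm (s i) := by
    intro f g h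
    funext s
    simpa using congrFun h fun i => eA (s i)
  rw [countFunctions, ← Set.ncard_image_of_injective _ hinj]
  congr 1
  ext f
  simp only [Set.mem_ofPred_eq, Set.mem_image]
  constructor
  · rintro ⟨p, D', q', hp, hk, hpath, hq, rfl⟩
    obtain ⟨p, hp', rfl⟩ := (getD_setBits_preimage eQ).1 hp
    obtain ⟨D, q, rfl, rfl, hpath'⟩ := (isPath_iff eA eQ hts p D' q').1 hpath
    obtain ⟨q', hq', he⟩ := (getD_setBits_preimage eQ).1 hq
    obtain rfl : q = q' := eQ.injective (Fin.ext he)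
    rw [List.length_map] at hk
    have hD : D ∈ F.accepts := NFA.accepts_iff_exists_path.2 ⟨p, hp', q, hq', hpath'⟩
    exact ⟨_, ⟨D, hD, hk, rfl⟩, (valFn_eq_oddFunction eA (hF D hD) hk).symm⟩
  · rintro ⟨_, ⟨D, hD, hk, rfl⟩, rfl⟩
    obtain ⟨p, hp, q, hq, hpath⟩ := NFA.accepts_iff_exists_path.1 hD
    exact ⟨eQ p, D.map (layerBits eA), eQ q, (getD_setBits_preimage eQ).2 ⟨p, hp, rfl⟩,
      by rw [List.length_map, hk], (isPath_iff eA eQ hts p _ _).2 ⟨D, q, rfl, rfl, hpath⟩,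
      (getD_setBits_preimage eQ).2 ⟨q, hq, rfl⟩, (valFn_eq_oddFunction eA (hF D hD) hk).symm⟩

/-! ### Decoding of the input -/

/-- The input without the length. -/
noncomputable def automatonCode (eA : A ≃ Fin m) (eQ : Q ≃ Fin n) (F : NFA (Layer A w) Q)
    (ts : List (Q × Layer A w × Q)) : List (Option Bool) :=
  numCode m ++ (numCode w ++ (numCode n ++ (numCode ts.length ++
    ((setBits (eQ.symm ⁻¹' F.start) ++ setBits (eQ.symm ⁻¹' F.accept)).map some ++
      ts.flatMap fun t => numCode (eQ t.1) ++ layerCode eA t.2.1 ++ numCode (eQ t.2.2)))))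

theorem sofaCode_eq (k : ℕ) :
    sofaCode eA eQ F ts k = (Nat.bits k).map some ++ none :: automatonCode eA eQ F ts := by
  simp [sofaCode, automatonCode, numCode, setCode_eq]

theorem splitMarks_numCode (j : ℕ) (l : List (Option Bool)) :
    splitMarks ((numCode j ++ l).map symbolPair) = Nat.bits j :: splitMarks (l.map symbolPair) := by
  rw [numCode, List.append_assoc]
  exact splitMarks_append_none _ _

/-- The strings between the marks in the list of transitions. -/
noncomputable def transitionStrings (eA : A ≃ Fin m) (eQ : Q ≃ Fin n)
    (ts : List (Q × Layer A w × Q)) : List (List Bool) :=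
  splitMarks ((ts.flatMap fun t =>
    numCode (eQ t.1) ++ layerCode eA t.2.1 ++ numCode (eQ t.2.2)).map symbolPair)

theorem groupPairs_transitionStrings : groupPairs (transitionStrings eA eQ ts) =
    ts.map fun t => (Nat.bits (eQ t.1), layerBits eA t.2.1 ++ Nat.bits (eQ t.2.2)) := by
  induction ts with
  | nil => rfl
  | cons t ts ih =>
    rw [transitionStrings, List.flatMap_cons, List.append_assoc, List.append_assoc, splitMarks_numCode,
      layerCode_eq, splitMarks_append, splitMarks_numCode, List.headD_cons, List.tail_cons,
      groupPairs_cons_cons, List.map_cons, ← transitionStrings, ih]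

theorem splitMarks_automatonCode : splitMarks ((automatonCode eA eQ F ts).map symbolPair) =
    Nat.bits m :: Nat.bits w :: Nat.bits n :: Nat.bits ts.length ::
      (setBits (eQ.symm ⁻¹' F.start) ++ setBits (eQ.symm ⁻¹' F.accept) ++
        (transitionStrings eA eQ ts).headD []) :: (transitionStrings eA eQ ts).tail := by
  rw [automatonCode, splitMarks_numCode, splitMarks_numCode, splitMarks_numCode, splitMarks_numCode,
    splitMarks_append]
  rfl

theorem sizes_automatonCode :
    sizes (splitMarks ((automatonCode eA eQ F ts).map symbolPair)) = (m, w, n) := by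
  rw [splitMarks_automatonCode, sizes]
  simp [ofBits_bits]

theorem vectors_automatonCode : vectors (splitMarks ((automatonCode eA eQ F ts).map symbolPair)) =
    setBits (eQ.symm ⁻¹' F.start) ++ setBits (eQ.symm ⁻¹' F.accept) ++
      (transitionStrings eA eQ ts).headD [] := by
  rw [splitMarks_automatonCode, vectors]
  simp

theorem starts_automatonCode : starts (splitMarks ((automatonCode eA eQ F ts).map symbolPair)) =
    setBits (eQ.symm ⁻¹' F.start) := by
  rw [starts, sizes_automatonCode, vectors_automatonCode, List.append_assoc]
  exact List.take_left' (length_setBits _)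

theorem accepts_automatonCode : accepts (splitMarks ((automatonCode eA eQ F ts).map symbolPair)) =
    setBits (eQ.symm ⁻¹' F.accept) := by
  rw [accepts, sizes_automatonCode, vectors_automatonCode, List.append_assoc]
  dsimp only
  rw [List.drop_left' (length_setBits _)]
  exact List.take_left' (length_setBits _)

theorem transitions_automatonCode :
    transitions (splitMarks ((automatonCode eA eQ F ts).map symbolPair)) =
      codedTransitions eA eQ ts := by
  have h : (splitMarks ((automatonCode eA eQ F ts).map symbolPair)).drop 5 =
      (transitionStrings eA eQ ts).tail := by
    rw [splitMarks_automatonCode]; rfl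
  have h' : (transitionStrings eA eQ ts).headD [] :: (transitionStrings eA eQ ts).tail =
      transitionStrings eA eQ ts := by
    have := splitMarks_ne_nil ((ts.flatMap fun t =>
      numCode (eQ t.1) ++ layerCode eA t.2.1 ++ numCode (eQ t.2.2)).map symbolPair)
    rw [← transitionStrings] at this
    cases h : transitionStrings eA eQ ts with
    | nil => exact absurd h this
    | cons x l => rfl
  rw [transitions, sizes_automatonCode, vectors_automatonCode, h]
  dsimp only
  rw [List.drop_left' (by rw [List.length_append, length_setBits, length_setBits]), h',
    groupPairs_transitionStrings, List.map_map, codedTransitions]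
  refine List.map_congr_left fun t _ => ?_
  have hn (q : Q) : ofBitsCap n (Nat.bits (eQ q)) = eQ q := by
    rw [ofBitsCap_eq, ofBits_bits]
    exact min_eq_right (eQ q).2.le
  rw [Function.comp_apply]
  dsimp only
  rw [List.take_left' (length_layerBits eA _), List.drop_left' (length_layerBits eA _), hn, hn]

theorem result_automatonCode (hF : IsSOFA F) (hts : IsTransitionList F ts) (k : ℕ) :
    result (Nat.bits k) (splitMarks ((automatonCode eA eQ F ts).map symbolPair)) =
      countFunctions F k := by
  rw [result, countData, subsets, sizes_automatonCode, starts_automatonCode, accepts_automatonCode,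
    transitions_automatonCode, ofBits_bits]
  dsimp only
  rw [getD_iterate_mulVec (fun b i a _ _ => stepIndex_lt b i a), ncard_eq_countFunctions eA eQ hF hts]
  · intro t ht
    obtain ⟨t, -, rfl⟩ := List.mem_map.1 ht
    exact (eQ t.2.2).2
  · intro q hq
    obtain ⟨q, -, rfl⟩ := (getD_setBits_preimage eQ).1 hq
    exact (eQ q).2
  · exact List.idxOf_lt_length_iff.2 (mem_allLists_of_length (by simp))

end

/-! ### The length of the input -/

section

variable {A : Type} {w m : ℕ}

theorem setBits_injective {n : ℕ} : Function.Injective (setBits : Set (Fin n) → List Bool) := by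
  classical
  intro S S' h
  ext i
  have := congrArg (fun l : List Bool => l.getD i false) h
  rw [getD_setBits, getD_setBits] at this
  simpa using this

theorem layerBits_injective (eA : A ≃ Fin m) : Function.Injective (layerBits (w := w) eA) := by
  classical
  intro L L' h
  have ht : L.trans = L'.trans := by
    ext ⟨p, a, q⟩
    have := congrArg (fun l : List Bool => l.getD (w + w + (p * (m * w) + (eA a * w + q))) false) h
    rw [getD_layerBits_trans, getD_layerBits_trans] at this
    simpa using this
  rw [layerBits, layerBits] at h
  obtain ⟨h, hfl⟩ := List.append_inj h (by simp [length_setBits])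
  obtain ⟨h, hfi⟩ := List.append_inj h (by simp [length_setBits])
  obtain ⟨h, hin⟩ := List.append_inj h (by simp [length_setBits])
  obtain ⟨h, -⟩ := List.append_inj h (by simp [length_setBits])
  obtain ⟨hl, hr⟩ := List.append_inj h (by simp [length_setBits])
  simp only [List.cons.injEq, and_true] at hfl
  exact Layer.ext (setBits_injective hl) (setBits_injective hr) ht (setBits_injective hin)
    (setBits_injective hfi) hfl.1 hfl.2

variable {Q : Type} {n : ℕ}

/-- A transition is determined by two states and a bit vector of fixed length, and the list has no
repetitions. This bounds the length of the input in terms of `m`, `w` and `n`. -/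
theorem length_transitions_le (eA : A ≃ Fin m) (eQ : Q ≃ Fin n) {F : NFA (Layer A w) Q}
    {ts : List (Q × Layer A w × Q)} (hts : IsTransitionList F ts) :
    ts.length ≤ n * (2 ^ codeLength m w * n) := by
  let g : Q × Layer A w × Q → Fin n × List.Vector Bool (codeLength m w) × Fin n :=
    fun t => (eQ t.1, ⟨layerBits eA t.2.1, length_layerBits eA t.2.1⟩, eQ t.2.2)
  have hg : Function.Injective g := by
    rintro ⟨p, L, q⟩ ⟨p', L', q'⟩ h
    have h₁ : p = p' := eQ.injective (congrArg Prod.fst h)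
    have h₂ : L = L' := layerBits_injective eA (congrArg (fun x => x.2.1.val) h)
    have h₃ : q = q' := eQ.injective (congrArg (fun x => x.2.2) h)
    rw [h₁, h₂, h₃]
  have := (hts.1.map hg).length_le_card
  simpa using this

theorem length_bits_le (n : ℕ) : (Nat.bits n).length ≤ n := by
  rw [Nat.size_eq_bits_len]
  exact Nat.size_le.2 Nat.lt_two_pow_self

theorem length_automatonCode_le (eA : A ≃ Fin m) (eQ : Q ≃ Fin n) (F : NFA (Layer A w) Q)
    (ts : List (Q × Layer A w × Q)) : (automatonCode eA eQ F ts).length ≤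
      m + w + 3 * n + ts.length + 4 + ts.length * (2 * n + codeLength m w) := by
  have hnum : ∀ j, (numCode j).length ≤ j + 1 := fun j => by
    simpa [numCode] using length_bits_le j
  have ht : (ts.flatMap fun t => numCode (eQ t.1) ++ layerCode eA t.2.1 ++ numCode (eQ t.2.2)).length ≤
      ts.length * (2 * n + codeLength m w) := by
    induction ts with
    | nil => simp
    | cons t ts ih =>
      have h₁ := hnum (eQ t.1)
      have h₂ := hnum (eQ t.2.2)
      have h₃ := (eQ t.1).2
      have h₄ := (eQ t.2.2).2
      rw [List.flatMap_cons, List.length_append, List.length_append, List.length_append, layerCode_eq,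
        List.length_map, length_layerBits, List.length_cons, add_mul]
      omega
  have h₁ := hnum m
  have h₂ := hnum w
  have h₃ := hnum n
  have h₄ := hnum ts.length
  simp only [automatonCode, List.length_append, List.length_map, length_setBits]
  omega

end

/-! ### The final estimates and the theorem -/

theorem size_le {m w n l t : ℕ} (hm : 1 ≤ m) (hw : 1 ≤ w) (ht : t ≤ n * (2 ^ codeLength m w * n))
    (hl : l ≤ m + w + 3 * n + t + 4 + t * (2 * n + codeLength m w)) :
    blowup m w n + l + 2 ≤ 2 ^ (max n 1 * 2 ^ (10 * (m * w * 2 ^ w))) := by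
  have hmw : 1 ≤ m * w := Nat.mul_pos hm hw
  have h2 : 2 ≤ 2 ^ w := by simpa using Nat.pow_le_pow_right (n := 2) (by omega) hw
  set E := m * w * 2 ^ w with hE
  have hmE : m * w * 2 ≤ E := Nat.mul_le_mul_left _ h2
  have hE₂ : 2 ≤ E := by omega
  have hmm : m ≤ m * w := Nat.le_mul_of_pos_right _ hw
  have hww : w ≤ m * w := Nat.le_mul_of_pos_left _ hm
  have hN : n ≤ max n 1 := le_max_left _ _
  have hN₁ : 1 ≤ max n 1 := le_max_right _ _
  set N := max n 1
  have hcl : codeLength m w ≤ 4 * E := by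
    have : w * (m * w) ≤ E := by
      calc w * (m * w) = m * w * w := by ring
        _ ≤ m * w * 2 ^ w := Nat.mul_le_mul_left _ Nat.lt_two_pow_self.le
    rw [codeLength]
    omega
  have hb : blowup m w n ≤ 2 ^ (N * 2 ^ (9 * E)) := by
    refine Nat.pow_le_pow_right (by omega) ?_
    -- Here `m` and `w` must be positive, so that the additive ones can be absorbed.
    have h₁ : (m + 1) * (w + 1) * 2 ^ w ≤ 4 * E := by
      rw [hE, ← mul_assoc]
      refine Nat.mul_le_mul_right _ ?_
      nlinarith
    calc (n + 1) * 2 ^ (2 * ((m + 1) * (w + 1) * 2 ^ w)) ≤ (2 * N) * 2 ^ (8 * E) :=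
          Nat.mul_le_mul (by omega) (Nat.pow_le_pow_right (by omega) (by omega))
      _ = N * 2 ^ (8 * E + 1) := by ring
      _ ≤ N * 2 ^ (9 * E) := Nat.mul_le_mul_left _ (Nat.pow_le_pow_right (by omega) (by omega))
  -- `X` dominates the number of states and the length of a layer code, and its square the number of
  -- transitions; the length of the input is then cubic in `X`.
  set X := N * 2 ^ (4 * E) with hX
  have hpX : 2 ^ (4 * E) ≤ X := Nat.le_mul_of_pos_left _ hN₁
  have hEX : 4 * E ≤ X := Nat.lt_two_pow_self.le.trans hpX
  have hNX : N ≤ X := Nat.le_mul_of_pos_right _ (by positivity)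
  have hX₁ : 1 ≤ X := hN₁.trans hNX
  have ht' : t ≤ X * X := by
    refine ht.trans (Nat.mul_le_mul (hN.trans hNX) ?_)
    rw [mul_comm, hX]
    exact Nat.mul_le_mul hN (Nat.pow_le_pow_right (by omega) hcl)
  have hl' : l + 2 ≤ 16 * (X * X * X) := by
    have h₁ : t * (2 * n + codeLength m w) ≤ X * X * (3 * X) :=
      Nat.mul_le_mul ht' (by omega)
    have h₂ : X * X * 1 ≤ X * X * X := Nat.mul_le_mul_left _ hX₁
    have h₃ : X * 1 ≤ X * X := Nat.mul_le_mul_left _ hX₁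
    have h₄ : X * X * (3 * X) = 3 * (X * X * X) := by ring
    omega
  have hl'' : l + 2 ≤ 2 ^ (N * 2 ^ (9 * E)) := by
    have hx : X ≤ 2 ^ X := Nat.lt_two_pow_self.le
    calc l + 2 ≤ 2 ^ 4 * (2 ^ X * 2 ^ X * 2 ^ X) := hl'.trans (by gcongr; norm_num)
      _ = 2 ^ (4 + 3 * X) := by ring
      _ ≤ 2 ^ (N * 2 ^ (9 * E)) := Nat.pow_le_pow_right (by omega) ?_
    calc 4 + 3 * X ≤ 2 ^ 3 * X := by omega
      _ = N * 2 ^ (4 * E + 3) := by rw [hX]; ring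
      _ ≤ N * 2 ^ (9 * E) := Nat.mul_le_mul_left _ (Nat.pow_le_pow_right (by omega) (by omega))
  calc blowup m w n + l + 2 ≤ 2 ^ (N * 2 ^ (9 * E)) * 2 := by omega
    _ = 2 ^ (N * 2 ^ (9 * E) + 1) := by rw [pow_succ]
    _ ≤ 2 ^ (N * 2 ^ (10 * E)) := Nat.pow_le_pow_right (by omega) ?_
  have h₁ : 1 ≤ N * 2 ^ (9 * E) := Nat.mul_pos hN₁ (by positivity)
  calc N * 2 ^ (9 * E) + 1 ≤ N * 2 ^ (9 * E) * 2 := by omega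
    _ = N * 2 ^ (9 * E + 1) := by ring
    _ ≤ N * 2 ^ (10 * E) := Nat.mul_le_mul_left _ (Nat.pow_le_pow_right (by omega) (by omega))

/-- A power of the number of digits is at most linear. -/
theorem exists_pow_length_bits_le (c : ℕ) : ∃ C, ∀ k, ((Nat.bits k).length + 2) ^ c ≤ C * (k + 1) := by
  rcases Nat.eq_zero_or_pos c with rfl | hc
  · exact ⟨1, fun k => by simp⟩
  · refine ⟨c ^ c * 2 ^ c * 8, fun k => ?_⟩
    set x := (Nat.bits k).length + 2 with hx
    -- Dividing by `c` before passing to the exponential makes the `c`-th power of the right side a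
    -- constant multiple of about `2 ^ x`.
    have h₁ : x ≤ c * 2 ^ (x / c + 1) :=
      (Nat.lt_mul_div_succ x hc).le.trans (Nat.mul_le_mul_left _ Nat.lt_two_pow_self.le)
    have h₂ : 2 ^ (Nat.bits k).length ≤ 2 * (k + 1) := by
      rw [Nat.size_eq_bits_len]
      rcases Nat.eq_zero_or_pos k.size with h | h
      · rw [h]; omega
      · have := Nat.lt_size.1 (show k.size - 1 < k.size by omega)
        obtain ⟨j, hj⟩ := Nat.exists_eq_add_of_lt h
        rw [hj] at this ⊢
        simp only [zero_add, Nat.add_sub_cancel] at this ⊢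
        rw [pow_succ]
        omega
    calc x ^ c ≤ (c * 2 ^ (x / c + 1)) ^ c := Nat.pow_le_pow_left h₁ c
      _ = c ^ c * 2 ^ c * 2 ^ (x / c * c) := by rw [mul_pow, ← pow_mul, add_mul, pow_add, one_mul]; ring
      _ ≤ c ^ c * 2 ^ c * 2 ^ x :=
        Nat.mul_le_mul_left _ (Nat.pow_le_pow_right (by omega) (Nat.div_mul_le_self x c))
      _ = c ^ c * 2 ^ c * (4 * 2 ^ (Nat.bits k).length) := by rw [hx, pow_add]; ring
      _ ≤ c ^ c * 2 ^ c * (4 * (2 * (k + 1))) := by gcongr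
      _ = _ := by ring

/-- A step pushes at most one symbol. Hence the length of the output, and the cost of moving it to
the output stack, is bounded by the length of the input and the running time. -/
theorem Exec.length_le {p : Prog} {v m v' m' t} (h : Exec p v m v' m' t) :
    m'.main.length + m'.fst.length + m'.snd.length + m'.cnt.length ≤
      m.main.length + m.fst.length + m.snd.length + m.cnt.length + t := by
  induction h with
  | skip => omega
  | push k => fin_cases k <;> simp [Mem.set, Mem.get] <;> omega
  | pop k => fin_cases k <;> simp [Mem.set, Mem.get] <;> omega
  | put k => fin_cases k <;> simp [Mem.set, Mem.get] <;> omega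
  | seq => omega
  | ite_true => omega
  | ite_false => omega
  | loop_false => omega
  | loop_true => omega

theorem theorem5p6 :
    ∃ (M : Turing.TM2ComputableAux (Option Bool) Bool) (c : ℕ),
      (∀ i, Finite (M.tm.Γ i)) ∧
      ∀ (A Q : Type) [Fintype A] [Nonempty A] [Fintype Q] (w : ℕ), 1 ≤ w →
      ∀ F : NFA (Layer A w) Q, IsSOFA F →
      ∀ (eA : A ≃ Fin (Fintype.card A)) (eQ : Q ≃ Fin (Fintype.card Q))
        (ts : List (Q × Layer A w × Q)), IsTransitionList F ts →
      ∀ k : ℕ,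
        OutputsWithin M (sofaCode eA eQ F ts k) (Nat.bits (countFunctions F k))
          (2 ^ (max (Fintype.card Q) 1 * 2 ^ (c * (Fintype.card A * w * 2 ^ w))) *
            (max k 1) ^ 2) := by
  obtain ⟨p, c, hp⟩ := exists_program
  obtain ⟨C, hC⟩ := exists_pow_length_bits_le (c + 1)
  -- The summand 10 comes from `size_le`, `c + 1` from the exponent of the running time, and `12 *
  -- (C + 1)` from the constant factor in front of it.
  refine ⟨p.computer, 12 * (C + 1) + (c + 1) + 10, p.finite_stackSym,
    fun A Q _ _ _ w hw F hF eA eQ ts hts k => ?_⟩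
  obtain ⟨v, t, ht, hexec⟩ := hp (Nat.bits k) (automatonCode eA eQ F ts)
  rw [result_automatonCode eA eQ hF hts] at hexec
  rw [← sofaCode_eq] at hexec
  refine p.outputsWithin hexec ?_
  have hlen := hexec.length_le
  rw [sofaCode_eq] at hlen
  simp only [List.length_map, List.length_reverse, List.length_append, List.length_cons,
    List.length_nil] at hlen
  have hsize := size_le (Fintype.card_pos (α := A)) hw (length_transitions_le eA eQ hts)
    (length_automatonCode_le eA eQ F ts)
  rw [sizeBound, sizes_automatonCode, ofBits_bits] at ht
  dsimp only at ht
  have hCk := hC k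
  have hE : 1 ≤ Fintype.card A * w * 2 ^ w :=
    Nat.mul_pos (Nat.mul_pos Fintype.card_pos hw) (by positivity)
  have hN : 1 ≤ max (Fintype.card Q) 1 := le_max_right _ _
  generalize Fintype.card A * w * 2 ^ w = E at *
  generalize max (Fintype.card Q) 1 = N at *
  generalize (Nat.bits (countFunctions F k)).length = o at *
  have hA₁ : 2 ≤ blowup (Fintype.card A) w (Fintype.card Q) + (automatonCode eA eQ F ts).length + 2 := by
    omega
  have hA₂ : (automatonCode eA eQ F ts).length + 2 ≤
    blowup (Fintype.card A) w (Fintype.card Q) + (automatonCode eA eQ F ts).length + 2 := by omega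
  generalize blowup (Fintype.card A) w (Fintype.card Q) + (automatonCode eA eQ F ts).length + 2 = a at *
  generalize (automatonCode eA eQ F ts).length = l at *
  set P := (Nat.bits k).length + 2 with hP
  have hk : k + 1 ≤ 2 * max k 1 := by omega
  generalize max k 1 = k' at *
  -- The exponent is raised to `c + 1` so that the same bound also dominates `P * a`, and with it
  -- the length of the input, even for `c = 0`.
  have h₁ : (k + 1) * (P ^ c + (k + 1)) * a ^ c ≤ (k + 1) * (P ^ (c + 1) + (k + 1)) * a ^ (c + 1) := by
    gcongr <;> omega
  have h₂ : P * a ≤ (k + 1) * (P ^ (c + 1) + (k + 1)) * a ^ (c + 1) := by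
    have h₃ : P ≤ P ^ (c + 1) := Nat.le_self_pow (by omega) _
    have h₄ : a ≤ a ^ (c + 1) := Nat.le_self_pow (by omega) _
    refine Nat.mul_le_mul (h₃.trans ((Nat.le_add_right _ (k + 1)).trans ?_)) h₄
    exact Nat.le_mul_of_pos_left _ (Nat.succ_pos k)
  have h₃ : P + a ≤ P * a := by nlinarith
  have h₄ : (k + 1) * (P ^ (c + 1) + (k + 1)) * a ^ (c + 1) ≤
      4 * (C + 1) * a ^ (c + 1) * k' ^ 2 := by
    calc _ ≤ (k + 1) * (C * (k + 1) + (k + 1)) * a ^ (c + 1) := by gcongr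
      _ = (C + 1) * a ^ (c + 1) * (k + 1) ^ 2 := by ring
      _ ≤ (C + 1) * a ^ (c + 1) * (2 * k') ^ 2 := by gcongr
      _ = _ := by ring
  have h₅ : 12 * (C + 1) * a ^ (c + 1) ≤ 2 ^ (N * 2 ^ ((12 * (C + 1) + (c + 1) + 10) * E)) := by
    generalize 12 * (C + 1) = K
    have hb : 1 ≤ N * 2 ^ (10 * E) := Nat.mul_pos hN (by positivity)
    calc K * a ^ (c + 1) ≤ 2 ^ (K * (N * 2 ^ (10 * E))) * (2 ^ (N * 2 ^ (10 * E))) ^ (c + 1) :=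
          Nat.mul_le_mul (Nat.lt_two_pow_self.le.trans (Nat.pow_le_pow_right (by omega)
            (Nat.le_mul_of_pos_right _ hb))) (Nat.pow_le_pow_left hsize _)
      _ = 2 ^ (N * ((K + (c + 1)) * 2 ^ (10 * E))) := by rw [← pow_mul, ← pow_add]; ring_nf
      _ ≤ 2 ^ (N * (2 ^ ((K + (c + 1)) * E) * 2 ^ (10 * E))) := by
          refine Nat.pow_le_pow_right (by omega) (Nat.mul_le_mul_left _ (Nat.mul_le_mul_right _ ?_))
          exact Nat.lt_two_pow_self.le.trans
            (Nat.pow_le_pow_right (by omega) (Nat.le_mul_of_pos_right _ hE))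
      _ = _ := by rw [← pow_add, ← add_mul]
  -- The output length `o` is at most the input length plus `t`, so three copies of the bound
  -- suffice.
  calc t + o + 1 ≤ 3 * ((k + 1) * (P ^ (c + 1) + (k + 1)) * a ^ (c + 1)) := by omega
    _ ≤ 3 * (4 * (C + 1) * a ^ (c + 1) * k' ^ 2) := Nat.mul_le_mul_left _ h₄
    _ = 12 * (C + 1) * a ^ (c + 1) * k' ^ 2 := by ring
    _ ≤ _ := Nat.mul_le_mul_right _ h₅
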